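/- **Setting.** Let $N=\{1,\dots,n\}$. Let $E\subseteq N\times N$ be directed edges whose underlying undirected graph is connected, and let $\mathcal H$ be a connected undirected (communication) graph on $N$, with $N_{cj}$ the neighbours of $j$ in $\mathcal H$. Let $B_{ij}>0$ for $(i,j)\in E$. For $j\in N$ let $M_j,D_j,\beta_j>0$, $\overline P^{in}_j,d_j\in\mathbb R$, and let $k_\alpha,\gamma>0$. Let $$q_j(t)=q_{j0}+\sum_{k=1}^{s_j}q_{jk}\sin(a_{jk}t+\phi_{jk}),\qquad s_j\ge1,\ q_{jk}\ne0,\ a_{jk}>0,\ a_{jk}\neq a_{jl}\ (k\ne l).$$ Put $\bar s_j=2s_j+1$ and $\alpha_{jm}=-e_{s_j-m+1}(a_{j1}^2,\dots,a_{js_j}^2)$ for $1\le m\le s_j$ ($e_i$ is the $i$-th elementary symmetric polynomial). For $\alpha\in\mathbb R^{s_j}$ let $A_j(\alpha)$ be the $\bar s_j\times\bar s_j$ matrix with ones on the superdiagonal, last row $(0,\alpha_1,0,\alpha_2,0,\dots,\alpha_{s_j},0)$ and zeros elsewhere. Let $R_j=[r_{j1},\dots,r_{j,2s_j},1]$ be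 such that all roots of $\tau^{2s_j}+r_{j,2s_j}\tau^{2s_j-1}+\dots+r_{j1}$ have negative real part. Let $\tilde A_j(\alpha)=R_j(I+A_j(\alpha))$, let $O_j$ be the matrix with rows $\tilde A_j(\alpha_j)A_j(\alpha_j)^{i}$, $0\le i\le 2s_j$, and let $\varphi_j(t)=O_j^{-1}\,(q_j(t),q_j'(t),\dots,q_j^{(2s_j)}(t))^T$. Let $G_j=[0,\dots,0,1,\gamma]^T\in\mathbb R^{\bar s_j}$ and $\Lambda_j(\zeta)=[\zeta_2,\zeta_4,\dots,\zeta_{2s_j}]^T$. Suppose that the controller uses an estimate $\hat D_j>0$ of $D_j$, with error $\Delta D_j=\hat D_j-D_j$. The closed-loop system for the state $(\tilde\theta,\omega,\mu,\tilde\eta,\tilde\zeta,\tilde\alpha)$, where $\tilde\theta_{ij}=\theta_i-\theta_j$ for $(i,j)\in E$ (differences of node angles), is $$\begin{aligned} \dot{\tilde\theta}_{ij}&=\omega_i-\omega_j,\\ M_j\dot\omega_j&=\overline P^{in}_j+\rho_{qj}+F_j-\mu_j/\beta_j-d_j\omega_j-D_j\omega_j,\\ \dot\mu_j&=-\sum_{k\in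 N_{cj}}(\mu_j-\mu_k)+\omega_j/\beta_j,\\ \dot{\tilde\eta}_j&=-\tilde\eta_j+\overline P^{in}_j+\rho_{qj}+F_j-D_j\omega_j-\Delta D_j\omega_j-\mu_j/\beta_j-d_j\omega_j,\\ \dot{\tilde\zeta}_j&=(A_j(\hat\alpha_j)-A_j(\alpha_j))\zeta_j+(A_j(\alpha_j)-G_jR_j)\tilde\zeta_j-G_j\tilde\eta_j,\\ \dot{\tilde\alpha}_j&=-k_\alpha\Lambda_j(\zeta_j)(\tilde\eta_j+R_j\tilde\zeta_j), \end{aligned}$$ with $\zeta_j=\tilde\zeta_j+\varphi_j(t)$, $\hat\alpha_j=\alpha_j+\tilde\alpha_j$, $\rho_{qj}=\tilde A_j(\alpha_j)\varphi_j(t)-\tilde A_j(\hat\alpha_j)\zeta_j$ and $F_j=\sum_{i:(i,j)\in E}B_{ij}\tilde\theta_{ij}-\sum_{k:(j,k)\in E}B_{jk}\tilde\theta_{jk}$. An equilibrium is a state at which the right-hand side vanishes for all $t\ge0$. Write $\nu_j=(\tilde\eta_j-M_j\omega_j,\tilde\zeta_j,\tilde\alpha_j)$, and let $\phi_j(\nu_j,0)$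 be the right-hand side of the equation for $\nu_j$ when $\omega_j\equiv0$. All norms are Euclidean. Call $(U_j,\underline U_j,\overline U_j,b_{j0})$ *admissible* if $U_j(t,\nu_j)$ is $C^1$, $b_{j0}>0$, $\underline U_j,\overline U_j$ are continuous, positive definite and radially unbounded, and for all $t\ge0$ and all $\nu_j$: $\underline U_j(\nu_j)\le U_j(t,\nu_j)\le\overline U_j(\nu_j)$, $\ \partial_tU_j+\partial_{\nu_j}U_j\,\phi_j(\nu_j,0)\le-\|\nu_j\|^2$, $\ \|\partial_{\nu_j}U_j\|\le b_{j0}(\|\nu_j\|+\|\nu_j\|^3)$. **Claim.** 1. The closed-loop system has exactly one equilibrium $x^*$, and it is the same as for $\Delta D=0$. 2. Admissible functions exist for every $j$. 3. Let admissible functions be given. Let $\tilde c>0$, and let $\overline c$ be such that $\sum_jU_j(t,\nu_j)\le\tilde c$ with $t\ge 0$ implies $\|\nu_j\|\le\overline c$ for all $j$. Let $\overline\varphi_j\ge\|\varphi_j(t)\|$ for all $t\ge0$, and let, for all $j$, $$c_2\ge\|R_j\|\,\overline\varphi_j+\|R_j\|+\|R_jA_j(\alpha_j)\|,$$ $$c_3\ge\max\{1,\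 c_2(1+\overline c),\ b_{j0}(1+\overline c^2),\ |M_j+\Delta D_j|+\|G_j\||M_j|+k_\alpha|M_j|(\overline c+\overline\varphi_j)\}.$$ (These conditions force $c_3>1$.) Assume (A2) that for all $j$ $$d_j>\max\Big\{\frac{1+2c_3^6}{2}-D_j,\ \frac{2c_3^2+1}{4c_3^2}+\frac{2c_3^6-c_3^4}{2c_3^2-2}+2c_3^2-D_j\Big\}.$$ Put $$V(t,x)=\frac1{4c_3^2}\Big(\sum_{(i,j)\in E}B_{ij}(\tilde\theta_{ij}-\tilde\theta^*_{ij})^2+\sum_jM_j(\omega_j-\omega_j^*)^2+\sum_j(\mu_j-\mu_j^*)^2\Big)+\sum_jU_j(t,\nu_j),$$ let $\overline V$ be a continuous function that is positive definite about $x^*$ and radially unbounded with $V(t,x)\le\overline V(x)$ for all $t\ge0$ and all $x$, and let $\Omega_{\overline V}=\{x:\overline V(x)\le\tilde c\}$. Then from every state in $\Omega_{\overline V}$ at time $0$ (with $\tilde\theta$ consisting of differences of node angles) there starts a trajectory on $[0,\infty)$, and every such trajectory converges to $x^*$ as $t\to\infty$. -/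

import Mathlib

namespace FreqControl

/-- The Euclidean norm of a finite real vector. -/
noncomputable def eNorm {ι : Type*} [Fintype ι] (v : ι → ℝ) : ℝ := ‖WithLp.toLp 2 v‖

/-- `A(α)`, of size `2s+1`: ones on the superdiagonal, last row `(0, α₁, 0, α₂, …, 0, αₛ, 0)`. -/
def exoMatrix (s : ℕ) (α : Fin s → ℝ) : Matrix (Fin (2 * s + 1)) (Fin (2 * s + 1)) ℝ :=
  Matrix.of fun i l =>
    if (i : ℕ) = 2 * s then ∑ m : Fin s, (if (l : ℕ) = 2 * (m : ℕ) + 1 then α m else 0)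
    else if (l : ℕ) = (i : ℕ) + 1 then 1 else 0

/-- `α₁ = -∏ aₗ²`, …, `αₛ = -∑ aₗ²`: minus the elementary symmetric functions of the `aₗ²`
(with `m` counted from `0`, the one of degree `s - m ≥ 1`). -/
def alphaOf (s : ℕ) (a : Fin s → ℝ) (m : Fin s) : ℝ :=
  -∑ T ∈ Finset.powersetCard (s - (m : ℕ)) (Finset.univ : Finset (Fin s)), ∏ l ∈ T, a l ^ 2

/-- `R = [r₁, …, r_{2s}, 1]`. -/
def rowR (s : ℕ) (r : Fin (2 * s) → ℝ) : Fin (2 * s + 1) → ℝ := Fin.snoc r 1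

/-- `G = [0, …, 0, 1, γ]ᵀ`. -/
def colG (s : ℕ) (γ : ℝ) (i : Fin (2 * s + 1)) : ℝ :=
  if (i : ℕ) = 2 * s then γ else if (i : ℕ) + 1 = 2 * s then 1 else 0

/-- `Λ(ζ) = [ζ₂, ζ₄, …, ζ_{2s}]ᵀ` (entries counted from `1`). -/
def Lam (s : ℕ) (ζ : Fin (2 * s + 1) → ℝ) (m : Fin s) : ℝ := ζ ⟨2 * (m : ℕ) + 1, by omega⟩

/-- `Ã(α) = R (I + A(α))`. -/
def rowA (s : ℕ) (r : Fin (2 * s) → ℝ) (α : Fin s → ℝ) : Fin (2 * s + 1) → ℝ :=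
  Matrix.vecMul (rowR s r) (1 + exoMatrix s α)

/-- The matrix `O(α)` with rows `Ã(α), Ã(α) A(α), …, Ã(α) A(α)^{2s}`. -/
def obsMatrix (s : ℕ) (r : Fin (2 * s) → ℝ) (α : Fin s → ℝ) :
    Matrix (Fin (2 * s + 1)) (Fin (2 * s + 1)) ℝ :=
  Matrix.of fun i => Matrix.vecMul (rowA s r α) (exoMatrix s α ^ (i : ℕ))

/-- The data of the power network with nodes `Fin n`, of the power imbalance and of the
controller. -/
structure PowerSystem (n : ℕ) where
  /-- directed tie lines `i → j` -/
  E : Finset (Fin n × Fin n)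
  /-- line parameters -/
  B : E → ℝ
  /-- communication graph -/
  H : SimpleGraph (Fin n)
  /-- inertia constants -/
  M : Fin n → ℝ
  /-- true damping constants -/
  D : Fin n → ℝ
  /-- known constant part of the power imbalance -/
  P : Fin n → ℝ
  /-- cost coefficients -/
  β : Fin n → ℝ
  /-- number of sinusoidal components at each node -/
  s : Fin n → ℕ
  /-- offset of the power variation -/
  q0 : Fin n → ℝ
  /-- amplitudes -/
  q : ∀ j, Fin (s j) → ℝ
  /-- frequencies -/
  a : ∀ j, Fin (s j) → ℝ
  /-- phases -/
  ph : ∀ j, Fin (s j) → ℝ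
  /-- the coefficients of `R j` other than the last one -/
  r : ∀ j, Fin (2 * s j) → ℝ
  /-- controller gain `d` -/
  d : Fin n → ℝ
  /-- adaptation gain `k_α` -/
  kα : ℝ
  /-- controller gain `γ` -/
  γ : ℝ

namespace PowerSystem

variable {n : ℕ} (S : PowerSystem n)

/-- Standing assumptions on the data. -/
structure WellPosed : Prop where
  network_connected : (SimpleGraph.fromRel fun i j => (i, j) ∈ S.E).Connected
  comm_connected : S.H.Connected
  B_pos : ∀ e, 0 < S.B e
  M_pos : ∀ j, 0 < S.M j
  D_pos : ∀ j, 0 < S.D j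
  β_pos : ∀ j, 0 < S.β j
  s_pos : ∀ j, 0 < S.s j
  a_pos : ∀ j k, 0 < S.a j k
  /-- the sinusoidal components have pairwise different frequencies … -/
  a_inj : ∀ j, Function.Injective (S.a j)
  /-- … and are all present -/
  q_ne : ∀ j k, S.q j k ≠ 0
  /-- `τ^{2s} + r_{2s} τ^{2s-1} + ⋯ + r₂ τ + r₁` has all its roots in the open left half plane -/
  r_hurwitz : ∀ j, ∀ z : ℂ,
    z ^ (2 * S.s j) + ∑ i : Fin (2 * S.s j), (S.r j i : ℂ) * z ^ (i : ℕ) = 0 → z.re < 0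
  kα_pos : 0 < S.kα
  γ_pos : 0 < S.γ

/-- The power variation `q_j(t)`. -/
noncomputable def variation (j : Fin n) (t : ℝ) : ℝ :=
  S.q0 j + ∑ k, S.q j k * Real.sin (S.a j k * t + S.ph j k)

/-- The true exosystem parameter `α_j`. -/
def alpha (j : Fin n) : Fin (S.s j) → ℝ := alphaOf (S.s j) (S.a j)

/-- `λ_j(t)`: the function `q_j` and its first `2 s_j` derivatives. -/
noncomputable def lam (j : Fin n) (t : ℝ) (k : Fin (2 * S.s j + 1)) : ℝ :=
  iteratedDeriv (k : ℕ) (S.variation j) t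

/-- `φ_j(t) = O_j(α_j)⁻¹ λ_j(t)`. -/
noncomputable def varphi (j : Fin n) (t : ℝ) : Fin (2 * S.s j + 1) → ℝ :=
  Matrix.mulVec (obsMatrix (S.s j) (S.r j) (S.alpha j))⁻¹ (S.lam j t)

/-- The state `(θ̃, ω, μ, η̃, ζ̃, α̃)`, where `θ̃` has one entry for each tie line. -/
abbrev State : Type :=
  (S.E → ℝ) × (Fin n → ℝ) × (Fin n → ℝ) × (Fin n → ℝ) ×
    (∀ j, Fin (2 * S.s j + 1) → ℝ) × (∀ j, Fin (S.s j) → ℝ)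

variable {S}

/-- Angle differences `θ̃`. -/
def State.θ (x : S.State) : S.E → ℝ := x.1
/-- Frequency deviations. -/
def State.ω (x : S.State) : Fin n → ℝ := x.2.1
/-- Consensus variables. -/
def State.μ (x : S.State) : Fin n → ℝ := x.2.2.1
/-- `η̃`. -/
def State.η (x : S.State) : Fin n → ℝ := x.2.2.2.1
/-- `ζ̃`. -/
def State.ζ (x : S.State) : ∀ j, Fin (2 * S.s j + 1) → ℝ := x.2.2.2.2.1
/-- `α̃`. -/
def State.α (x : S.State) : ∀ j, Fin (S.s j) → ℝ := x.2.2.2.2.2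

/-- The entries of `θ̃` are differences `θ_i - θ_j` of node angles. -/
def IsAngleDifference (x : S.State) : Prop :=
  ∃ θ : Fin n → ℝ, ∀ e : S.E, State.θ x e = θ e.1.1 - θ e.1.2

variable (S)

/-- `∑_{i → j} B_{ij} θ̃_{ij} - ∑_{j → k} B_{jk} θ̃_{jk}`. -/
noncomputable def flow (θ : S.E → ℝ) (j : Fin n) : ℝ :=
  (∑ e : S.E, if e.1.2 = j then S.B e * θ e else 0) -
    ∑ e : S.E, if e.1.1 = j then S.B e * θ e else 0

/-- `ρ_{qj} = Ã(α) φ - Ã(α̂) ζ`, with `α̂ = α + α̃` and `ζ = ζ̃ + φ`. -/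
noncomputable def rho (j : Fin n) (t : ℝ) (ζ : Fin (2 * S.s j + 1) → ℝ) (α : Fin (S.s j) → ℝ) :
    ℝ :=
  rowA (S.s j) (S.r j) (S.alpha j) ⬝ᵥ S.varphi j t -
    rowA (S.s j) (S.r j) (S.alpha j + α) ⬝ᵥ (ζ + S.varphi j t)

/-- `(A(α̂) - A(α)) ζ + (A(α) - G R) ζ̃ - G η̃`, as a function of `η̃`, `ζ̃`, `α̃`. -/
noncomputable def zetaField (j : Fin n) (t η : ℝ) (ζ : Fin (2 * S.s j + 1) → ℝ)
    (α : Fin (S.s j) → ℝ) : Fin (2 * S.s j + 1) → ℝ :=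
  Matrix.mulVec (exoMatrix (S.s j) (S.alpha j + α) - exoMatrix (S.s j) (S.alpha j))
      (ζ + S.varphi j t) +
    Matrix.mulVec (exoMatrix (S.s j) (S.alpha j) -
      Matrix.vecMulVec (colG (S.s j) S.γ) (rowR (S.s j) (S.r j))) ζ -
    η • colG (S.s j) S.γ

/-- `-k_α Λ(ζ) (η̃ + R ζ̃)`, as a function of `η̃`, `ζ̃`. -/
noncomputable def alphaField (j : Fin n) (t η : ℝ) (ζ : Fin (2 * S.s j + 1) → ℝ) :
    Fin (S.s j) → ℝ :=
  (-S.kα * (η + rowR (S.s j) (S.r j) ⬝ᵥ ζ)) • Lam (S.s j) (ζ + S.varphi j t)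

open Classical in
/-- The right-hand side of the closed-loop system when the controller uses the value `Dhat`
for the damping constants; the plant itself keeps the true constants `S.D`. -/
noncomputable def closedLoop (Dhat : Fin n → ℝ) (t : ℝ) (x : S.State) : S.State :=
  (fun e => State.ω x e.1.1 - State.ω x e.1.2,
   fun j => (1 / S.M j) * (S.P j + S.rho j t (State.ζ x j) (State.α x j) + S.flow (State.θ x) j
      - State.μ x j / S.β j - S.d j * State.ω x j - S.D j * State.ω x j),
   fun j => -(∑ k, if S.H.Adj j k then State.μ x j - State.μ x k else 0)
      + State.ω x j / S.β j,
   fun j => -State.η x j + S.P j + S.rho j t (State.ζ x j) (State.α x j) + S.flow (State.θ x) j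
      - Dhat j * State.ω x j - State.μ x j / S.β j - S.d j * State.ω x j,
   fun j => S.zetaField j t (State.η x j) (State.ζ x j) (State.α x j),
   fun j => S.alphaField j t (State.η x j) (State.ζ x j))

/-- Equilibrium: the (time-dependent) right-hand side vanishes at `x` at all times `t ≥ 0`. -/
def IsEquilibrium (Dhat : Fin n → ℝ) (x : S.State) : Prop :=
  IsAngleDifference x ∧ ∀ t : ℝ, 0 ≤ t → S.closedLoop Dhat t x = 0

/-- Trajectory on `[0, ∞)`. -/
def IsTrajectory (Dhat : Fin n → ℝ) (x : ℝ → S.State) : Prop :=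
  ∀ t : ℝ, 0 ≤ t → IsAngleDifference (x t) ∧
    HasDerivWithinAt x (S.closedLoop Dhat t (x t)) (Set.Ici 0) t

/-- The space of `ν_j = (η̂_j, ζ̃_j, α̃_j)`, with the Euclidean norm. -/
abbrev NuSpace (j : Fin n) : Type :=
  EuclideanSpace ℝ (Unit ⊕ (Fin (2 * S.s j + 1) ⊕ Fin (S.s j)))

/-- The vector `(η, ζ, α)` of `NuSpace`. -/
noncomputable def mkNu (j : Fin n) (η : ℝ) (ζ : Fin (2 * S.s j + 1) → ℝ) (α : Fin (S.s j) → ℝ) :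
    S.NuSpace j :=
  WithLp.toLp 2 (Sum.elim (fun _ => η) (Sum.elim ζ α))

/-- `ν_j = (η̃_j - M_j ω_j, ζ̃_j, α̃_j)`. -/
noncomputable def nu (x : S.State) (j : Fin n) : S.NuSpace j :=
  S.mkNu j (State.η x j - S.M j * State.ω x j) (State.ζ x j) (State.α x j)

/-- The right-hand side `φ_j(ν_j, 0)` of the `ν_j`-subsystem for `ω_j ≡ 0`. -/
noncomputable def nuField (j : Fin n) (t : ℝ) (ν : S.NuSpace j) : S.NuSpace j :=
  S.mkNu j (-ν (Sum.inl ()))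
    (S.zetaField j t (ν (Sum.inl ())) (fun i => ν (Sum.inr (Sum.inl i)))
      (fun m => ν (Sum.inr (Sum.inr m))))
    (S.alphaField j t (ν (Sum.inl ())) (fun i => ν (Sum.inr (Sum.inl i))))

end PowerSystem

/-- Continuous, positive definite about the point `p`, and radially unbounded. -/
structure IsProperPosDef {X : Type*} [TopologicalSpace X] (f : X → ℝ) (p : X) : Prop where
  continuous : Continuous f
  eq_zero : f p = 0
  pos : ∀ x, x ≠ p → 0 < f x
  unbounded : Filter.Tendsto f (Filter.cocompact X) Filter.atTop

namespace PowerSystem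

variable {n : ℕ} (S : PowerSystem n)

/-- `U` is a `C¹` Lyapunov function of the subsystem `ν_j' = φ_j(ν_j, 0)` with lower and upper
bounds `Ulow`, `Uup` and gradient constant `b`. -/
structure IsSubsystemLyapunov (j : Fin n) (U : ℝ → S.NuSpace j → ℝ) (Ulow Uup : S.NuSpace j → ℝ)
    (b : ℝ) : Prop where
  contDiff : ContDiff ℝ 1 (Function.uncurry U)
  low : IsProperPosDef Ulow 0
  up : IsProperPosDef Uup 0
  low_le : ∀ t, 0 ≤ t → ∀ ν, Ulow ν ≤ U t ν
  le_up : ∀ t, 0 ≤ t → ∀ ν, U t ν ≤ Uup ν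
  decrease : ∀ t, 0 ≤ t → ∀ ν,
    deriv (fun τ => U τ ν) t + fderiv ℝ (U t) ν (S.nuField j t ν) ≤ -‖ν‖ ^ 2
  b_pos : 0 < b
  grad_le : ∀ t, 0 ≤ t → ∀ ν, ‖fderiv ℝ (U t) ν‖ ≤ b * (‖ν‖ + ‖ν‖ ^ 3)

/-- `V₁ = ½ (x₁ - x₁*)ᵀ diag(B, M, I) (x₁ - x₁*)` with `x₁ = (θ̃, ω, μ)`. -/
noncomputable def V1 (xs x : S.State) : ℝ :=
  (1 / 2) * ((∑ e, S.B e * (State.θ x e - State.θ xs e) ^ 2) +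
    (∑ j, S.M j * (State.ω x j - State.ω xs j) ^ 2) +
    ∑ j, (State.μ x j - State.μ xs j) ^ 2)

/-- `V = V₁ / (2 c₃²) + ∑ U_j(t, ν_j)`. -/
noncomputable def V (c₃ : ℝ) (U : ∀ j, ℝ → S.NuSpace j → ℝ) (xs : S.State) (t : ℝ) (x : S.State) :
    ℝ :=
  1 / (2 * c₃ ^ 2) * S.V1 xs x + ∑ j, U j t (S.nu x j)

/-- The bound on `d_j` for the controller that uses `Dhat`, so that `ΔD_j = Dhat j - D_j`.
Here `b j` is the gradient constant of `U_j`, `cbar` a bound of `‖ν_j‖`, and `phibar j` a bound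
of `‖φ_j(t)‖`. -/
structure GainCondition (Dhat b phibar : Fin n → ℝ) (cbar c₂ c₃ : ℝ) : Prop where
  phibar_bound : ∀ j, ∀ t, 0 ≤ t → eNorm (S.varphi j t) ≤ phibar j
  c₂_ge : ∀ j, eNorm (rowR (S.s j) (S.r j)) * phibar j + eNorm (rowR (S.s j) (S.r j)) +
    eNorm (Matrix.vecMul (rowR (S.s j) (S.r j)) (exoMatrix (S.s j) (S.alpha j))) ≤ c₂
  c₃_ge_one : 1 ≤ c₃
  c₃_ge_rho : c₂ * (1 + cbar) ≤ c₃
  c₃_ge_grad : ∀ j, b j * (1 + cbar ^ 2) ≤ c₃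
  c₃_ge_field : ∀ j, |S.M j + (Dhat j - S.D j)| + eNorm (colG (S.s j) S.γ) * |S.M j| +
    S.kα * |S.M j| * (cbar + phibar j) ≤ c₃
  d_gt : ∀ j, max ((1 + 2 * c₃ ^ 6) / 2 - S.D j)
    ((2 * c₃ ^ 2 + 1) / (4 * c₃ ^ 2) + (2 * c₃ ^ 6 - c₃ ^ 4) / (2 * c₃ ^ 2 - 2) + 2 * c₃ ^ 2
      - S.D j) < S.d j

end PowerSystem

end FreqControl

open Filter Topology

/-! ### Quadratic Lyapunov forms of operators, and a Barbalat lemma -/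

namespace FreqControl

/-! The function `V` decreases strictly in the directions `ω`, `ν` and the disagreement of `μ`, and
a Barbalat argument recovers the remaining directions.

The network part `V1` is a storage function: along the closed loop the tie-line terms and the
`ω`-`μ` coupling cancel, and only `ω_j ρ_{qj}`, the damping `-(d_j + D_j) ω_j²` and the disagreement
survive (`V1_closedLoop`). Passing from `η̃_j` to `η̃_j - M_j ω_j` removes the plant from the
observer, so `ν_j` obeys its unforced system plus a perturbation proportional to `ω_j`
(`nu_closedLoop`); the estimate `Dhat` is visible only there, multiplied by `ω_j`, and so has no
effect on equilibria. As long as `‖ν_j‖` is bounded, the derivative of `V` is bounded at each node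
by a quadratic form in `|ω_j|` and `‖ν_j‖`, and the lower bound on `d_j` makes its discriminant
negative, with room to spare (`exists_slack`, `lyapunov_decrease`). Sublevel sets of `V` are
therefore invariant and bounded. This gives global trajectories and, by Barbalat, convergence to `0`
of the dissipation (`DecreasesOn.tendsto_rate`).

Then `ω`, `ν` and the differences of `μ` tend to `0`. A second use of Barbalat, on `ω` itself, sends
the power mismatch at every node to `0` (`tendsto_mismatch`). Summing it over the nodes fixes the
limit of `μ`; since the flow is injective on angle differences, the limit of `θ̃` follows
(`tendsto_equilibrium`).

The functions `U_j` exist because the `ν_j`-system is an adaptive observer with a persistently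
exciting regressor. In the coordinates `η`, `ξ` (the first `2s` entries of `ζ̃`), `y = η + R ζ̃` and
`α̃`, it is a Hurwitz companion system for `ξ` driven by `η`, together with `ẏ = ℓ - γ y + α̃ · Λ`
and `α̃' = -k y Λ`. A quadratic form decreases in `(y, ξ, η)` only, because the terms in `y (α̃ ·
Λ)` cancel. The form `α̃ᵀ N(t) α̃ - y (w(t) · α̃)`, where `w = Λ(φ_j)` and `N` is a bounded
antiderivative of `w wᵀ - Γ` with `Γ` positive definite, supplies the missing decrease in `α̃`
(`hasStrictLyapunov_adaptive`, `exists_strict_lyapunov`). Excitation holds because `φ_j` contains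
all `s_j` distinct frequencies with nonzero amplitudes (`varphi_eq`, `exists_excitation`).

The same `U_j` force `ν_j = 0` at an equilibrium (`eq_zero_of_nuField_eq_zero`); connectedness of
the two graphs determines the rest. -/

/-- The real part of a complex inner product as a continuous real bilinear form. -/
noncomputable def reInner (E : Type*) [NormedAddCommGroup E] [InnerProductSpace ℂ E] :
    E →L[ℝ] E →L[ℝ] ℝ :=
  LinearMap.mkContinuous₂ (LinearMap.mk₂ ℝ (fun x y : E => (inner ℂ x y).re)
    (fun x y z => by simp)
    (fun c x y => by
      rw [← Complex.coe_smul, inner_smul_left]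
      simp)
    (fun x y z => by simp)
    (fun c x y => by
      rw [← Complex.coe_smul, inner_smul_right]
      simp)) 1 (fun x y => by
      simp only [LinearMap.mk₂_apply, one_mul]
      exact (Complex.abs_re_le_norm _).trans (norm_inner_le_norm x y))

theorem reInner_apply {E : Type*} [NormedAddCommGroup E] [InnerProductSpace ℂ E] (x y : E) :
    reInner E x y = (inner ℂ x y).re := rfl

theorem reInner_comm {E : Type*} [NormedAddCommGroup E] [InnerProductSpace ℂ E] (x y : E) :
    reInner E x y = reInner E y x := by
  rw [reInner_apply, reInner_apply, ← inner_conj_symm, Complex.conj_re]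

theorem reInner_self {E : Type*} [NormedAddCommGroup E] [InnerProductSpace ℂ E] (x : E) :
    reInner E x x = ‖x‖ ^ 2 := by
  rw [reInner_apply, inner_self_eq_norm_sq_to_K, ← Complex.ofReal_re (‖x‖ ^ 2)]
  simp [← Complex.ofReal_pow]

theorem reInner_le {E : Type*} [NormedAddCommGroup E] [InnerProductSpace ℂ E] (x y : E) :
    reInner E x y ≤ ‖x‖ * ‖y‖ :=
  (Complex.re_le_norm _).trans (norm_inner_le_norm x y)

/-- A bounded operator annihilated by a product of factors `T - z` with `Re z < 0` admits a
quadratic Lyapunov form. -/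
theorem exists_lyapunov_form_aux {E : Type*} [NormedAddCommGroup E] [InnerProductSpace ℂ E]
    (T : E →L[ℂ] E) (m : Multiset ℂ) (hm : ∀ z ∈ m, z.re < 0) :
    ∃ (B : E →L[ℝ] E →L[ℝ] ℝ) (K : ℝ), 0 ≤ K ∧ (∀ x, ‖x‖ ^ 2 ≤ B x x) ∧
      ∀ x, B x (T x) + B (T x) x ≤ -‖x‖ ^ 2 +
        K * ‖Polynomial.aeval T (m.map fun z => Polynomial.X - Polynomial.C z).prod x‖ ^ 2 := by
  induction m using Multiset.induction_on with
  | empty =>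
    refine ⟨reInner E, 1 + 2 * ‖T‖, by positivity, fun x => ?_, fun x => ?_⟩
    · rw [reInner_self]
    · have h := reInner_le x (T x)
      have h2 := T.le_opNorm x
      have h3 := norm_nonneg x
      have h4 : reInner E (T x) x = reInner E x (T x) := reInner_comm _ _
      rw [h4]
      simp only [Multiset.map_zero, Multiset.prod_zero, map_one,
        one_apply_eq_self]
      nlinarith [mul_le_mul_of_nonneg_left h2 h3]
  | cons z m ih =>
    obtain ⟨B, K, hK, hB, hd⟩ := ih fun w hw => hm w (Multiset.mem_cons_of_mem hw)
    have hz : 0 < -z.re := by linarith [hm z (Multiset.mem_cons_self z m)]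
    set c : ℝ := -z.re with hc
    -- Since `T x = z x + S x`, the term `a ‖x‖²` of the new form decreases at rate `2ac ‖x‖²` up to
    -- the cross term `2a Re⟨x, S x⟩ ≤ ac ‖x‖² + (a/c) ‖S x‖²`. The weight `a/c` in front of `B (S
    -- x) (S x)` is the one whose inherited decrease cancels `(a/c) ‖S x‖²`, and `ac ≥ 1` leaves at
    -- least `‖x‖²`.
    set a : ℝ := 1 + 1 / c with ha
    have ha1 : 1 ≤ a := by rw [ha]; linarith [one_div_pos.2 hz]
    have hac : 1 ≤ a * c := by rw [ha]; field_simp; linarith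
    let S : E →L[ℂ] E := T - z • ContinuousLinearMap.id ℂ E
    let S' : E →L[ℝ] E := S.restrictScalars ℝ
    refine ⟨a • reInner E + (a / c) • B.bilinearComp S' S', a / c * K, by positivity,
      fun x => ?_, fun x => ?_⟩
    · have h1 : 0 ≤ B (S x) (S x) := le_trans (by positivity) (hB (S x))
      have h2 : 0 ≤ a / c * B (S x) (S x) := by positivity
      have h3 : (0 : ℝ) ≤ ‖x‖ ^ 2 := by positivity
      simp only [add_apply, FunLike.coe_smul, Pi.smul_apply,
        reInner_self, smul_eq_mul,
        ContinuousLinearMap.bilinearComp_apply, S', ContinuousLinearMap.coe_restrictScalars']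
      nlinarith
    · have hcomm : S (T x) = T (S x) := by simp [S]
      have hp : Polynomial.aeval T ((z ::ₘ m).map fun z => Polynomial.X - Polynomial.C z).prod x =
          Polynomial.aeval T (m.map fun z => Polynomial.X - Polynomial.C z).prod (S x) := by
        rw [Multiset.map_cons, Multiset.prod_cons, mul_comm, map_mul]
        simp only [mul_apply_eq_comp]
        congr 1
        simp [S, Algebra.algebraMap_eq_smul_one]
      have hTx : T x = z • x + S x := by simp [S]
      have hi : reInner E x (T x) = z.re * ‖x‖ ^ 2 + reInner E x (S x) := by
        rw [hTx, map_add]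
        congr 1
        rw [reInner_apply, inner_smul_right, inner_self_eq_norm_sq_to_K]
        simp [← Complex.ofReal_pow]
      have h := reInner_le x (S x)
      have hds := hd (S x)
      rw [hp]
      simp only [add_apply, FunLike.coe_smul, Pi.smul_apply,
        smul_eq_mul,
        ContinuousLinearMap.bilinearComp_apply, S', ContinuousLinearMap.coe_restrictScalars', hcomm]
      rw [reInner_comm (T x) x, hi]
      set Z := ‖Polynomial.aeval T (m.map fun z => Polynomial.X - Polynomial.C z).prod (S x)‖ ^ 2
      have e1 : a / c * (B (S x) (T (S x)) + B (T (S x)) (S x)) ≤ a / c * (-‖S x‖ ^ 2 + K * Z) :=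
        mul_le_mul_of_nonneg_left hds (by positivity)
      have e2 : 2 * (‖x‖ * ‖S x‖) ≤ c * ‖x‖ ^ 2 + 1 / c * ‖S x‖ ^ 2 := by
        have : 0 ≤ 1 / c * (c * ‖x‖ - ‖S x‖) ^ 2 := by positivity
        have e : 1 / c * (c * ‖x‖ - ‖S x‖) ^ 2 =
          c * ‖x‖ ^ 2 + 1 / c * ‖S x‖ ^ 2 - 2 * (‖x‖ * ‖S x‖) := by field_simp; ring
        linarith
      have e3 : a * (2 * reInner E x (S x)) ≤ a * (c * ‖x‖ ^ 2 + 1 / c * ‖S x‖ ^ 2) :=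
        mul_le_mul_of_nonneg_left (by linarith) (by linarith)
      have e4 : a * (1 / c * ‖S x‖ ^ 2) = a / c * ‖S x‖ ^ 2 := by ring
      have e5 : z.re = -c := by rw [hc]; ring
      rw [e5]
      nlinarith [sq_nonneg ‖x‖]

/-- An injective linear map between finite-dimensional spaces is bounded below. -/
theorem exists_pos_mul_norm_le {E F : Type*} [NormedAddCommGroup E] [NormedSpace ℝ E]
    [FiniteDimensional ℝ E] [NormedAddCommGroup F] [NormedSpace ℝ F] (f : E →ₗ[ℝ] F)
    (hf : Function.Injective f) : ∃ c : ℝ, 0 < c ∧ ∀ x, c * ‖x‖ ≤ ‖f x‖ := by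
  obtain ⟨K, hK, h⟩ := f.exists_antilipschitzWith (LinearMap.ker_eq_bot.2 hf)
  refine ⟨(K : ℝ)⁻¹, by positivity, fun x => ?_⟩
  have := h.le_mul_dist x 0
  simp only [dist_zero_right, map_zero] at this
  have hK' : (0 : ℝ) < K := hK
  rw [inv_mul_le_iff₀ hK']
  exact this

/-- A Barbalat type lemma. -/
theorem eventually_le_of_deriv_ge {G G' h r : ℝ → ℝ} {l K : ℝ}
    (hG : ∀ t, 0 ≤ t → HasDerivWithinAt G (G' t) (Set.Ici 0) t)
    (hle : ∀ t, 0 ≤ t → h t + r t ≤ G' t)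
    (hK : ∀ t u, 0 ≤ t → t ≤ u → |h u - h t| ≤ K * (u - t))
    (hr : Tendsto r atTop (𝓝 0)) (hl : Tendsto G atTop (𝓝 l)) {ε : ℝ} (hε : 0 < ε) :
    ∀ᶠ t in atTop, h t ≤ ε := by
  set K' := |K| + 1
  have hK' : 0 < K' := by positivity
  -- If `h t > ε`, then on an interval of this length `h` stays above `3ε/4`, hence `G' ≥ ε/2` once
  -- `|r| < ε/4`, and `G` grows by at least `εδ/2`. A convergent `G` allows this only for bounded
  -- `t`.
  set δ := ε / (4 * K')
  have hδ : 0 < δ := by positivity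
  have h1 : ∀ᶠ t in atTop, |r t| < ε / 4 := by
    have := hr.eventually (Metric.ball_mem_nhds 0 (by positivity : 0 < ε / 4))
    simpa [Metric.mem_ball, Real.dist_eq] using this
  obtain ⟨T1, hT1⟩ := eventually_atTop.1 h1
  have h2 : Tendsto (fun t => G (t + δ) - G t) atTop (𝓝 (l - l)) :=
    (hl.comp (tendsto_atTop_add_const_right _ δ tendsto_id)).sub hl
  rw [sub_self] at h2
  have h3 : ∀ᶠ t in atTop, G (t + δ) - G t < ε / 2 * δ :=
    h2.eventually (gt_mem_nhds (by positivity))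
  filter_upwards [h3, eventually_ge_atTop T1, eventually_ge_atTop 0] with t ht hT ht0
  by_contra! hcon
  have hmono : MonotoneOn (fun u => G u - ε / 2 * u) (Set.Icc t (t + δ)) := by
    apply monotoneOn_of_deriv_nonneg (convex_Icc _ _)
    · intro u hu
      exact (((hG u (ht0.trans hu.1)).continuousWithinAt).mono
        (fun v hv => ht0.trans hv.1)).sub (by fun_prop)
    · rw [interior_Icc]
      intro u hu
      have := (hG u (ht0.trans hu.1.le)).hasDerivAt (Ici_mem_nhds (ht0.trans_lt hu.1))
      exact (this.sub ((hasDerivAt_id u).const_mul (ε / 2))).differentiableAt.differentiableWithinAt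
    · rw [interior_Icc]
      intro u hu
      have := (hG u (ht0.trans hu.1.le)).hasDerivAt (Ici_mem_nhds (ht0.trans_lt hu.1))
      have hd := (this.sub ((hasDerivAt_id u).const_mul (ε / 2))).deriv
      have hd' : deriv (fun u => G u - ε / 2 * u) u = G' u - ε / 2 * 1 := hd
      rw [hd']
      have e1 := hle u (ht0.trans hu.1.le)
      have e2 := abs_lt.1 (hT1 u (hT.trans hu.1.le))
      have e3 := abs_le.1 (hK t u ht0 hu.1.le)
      have e4 : K * (u - t) ≤ K' * δ := by
        apply mul_le_mul _ (by linarith [hu.2]) (by linarith [hu.1]) hK'.le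
        linarith [le_abs_self K]
      have e5 : K' * δ = ε / 4 := by simp only [δ]; field_simp
      linarith [e2.1, e3.1]
  have := hmono (Set.left_mem_Icc.2 (by linarith)) (Set.right_mem_Icc.2 (by linarith))
    (by linarith)
  simp only at this
  linarith

/-! ### Lyapunov forms for companion systems -/

/-- The companion map of the polynomial `τ ^ m + ∑ rᵢ τ ^ i`. -/
noncomputable def companionMap {m : ℕ} (r : Fin m → ℂ) :
    EuclideanSpace ℂ (Fin m) →ₗ[ℂ] EuclideanSpace ℂ (Fin m) where
  toFun x := WithLp.toLp 2 fun i =>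
    if h : (i : ℕ) + 1 < m then x ⟨i + 1, h⟩ else -∑ k, r k * x k
  map_add' x y := by
    ext i
    simp only [PiLp.add_apply]
    split_ifs
    · rfl
    · simp [mul_add, Finset.sum_add_distrib]; ring
  map_smul' c x := by
    ext i
    simp only [PiLp.smul_apply, smul_eq_mul, RingHom.id_apply]
    split_ifs
    · rfl
    · simp [Finset.mul_sum, mul_left_comm]

theorem companionMap_apply {m : ℕ} (r : Fin m → ℂ) (x : EuclideanSpace ℂ (Fin m)) (i : Fin m) :
    companionMap r x i = if h : (i : ℕ) + 1 < m then x ⟨i + 1, h⟩ else -∑ k, r k * x k := rfl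

theorem companionMap_pow_apply {m : ℕ} (r : Fin m → ℂ) (x : EuclideanSpace ℂ (Fin m)) (hm : 0 < m)
    (k : ℕ) (hk : k < m) : (companionMap r ^ k) x ⟨0, hm⟩ = x ⟨k, hk⟩ := by
  induction k generalizing x with
  | zero => simp
  | succ k ih =>
    rw [pow_succ, Module.End.mul_apply, ih _ (by omega), companionMap_apply, dif_pos hk]

-- Coordinate `k` of a vector is coordinate `0` of its image under the `k`-th power of the companion
-- map, and powers commute with `p(T)`. So it is enough that coordinate `0` of `p(T) x` vanishes for
-- all `x`, which is the last row of the companion map.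
open Polynomial in
theorem aeval_companionMap {m : ℕ} (r : Fin m → ℂ) :
    aeval (companionMap r) (X ^ m + ∑ i : Fin m, C (r i) * X ^ (i : ℕ)) = 0 := by
  set p : ℂ[X] := X ^ m + ∑ i : Fin m, C (r i) * X ^ (i : ℕ) with hp
  have h0 : ∀ (hm : 0 < m) x, aeval (companionMap r) p x ⟨0, hm⟩ = 0 := by
    intro hm x
    have h1 : (companionMap r ^ m) x ⟨0, hm⟩ = -∑ k, r k * x k := by
      obtain ⟨k, rfl⟩ : ∃ k, m = k + 1 := ⟨m - 1, by omega⟩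
      rw [pow_succ, Module.End.mul_apply, companionMap_pow_apply _ _ _ k (by omega),
        companionMap_apply, dif_neg (by simp)]
    simp only [hp, map_add, map_sum, map_mul, map_pow, aeval_X, aeval_C, LinearMap.add_apply,
      LinearMap.sum_apply, Module.End.mul_apply, PiLp.add_apply, h1]
    rw [WithLp.ofLp_sum, Finset.sum_apply]
    simp [companionMap_pow_apply, Module.algebraMap_end_apply]
  apply LinearMap.ext
  intro x
  ext k
  have hm : 0 < m := by have := k.2; omega
  have hk := companionMap_pow_apply r (aeval (companionMap r) p x) hm k k.2
  have hc : (companionMap r ^ (k : ℕ)) (aeval (companionMap r) p x) =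
      aeval (companionMap r) p ((companionMap r ^ (k : ℕ)) x) := by
    have : aeval (companionMap r) (X ^ (k : ℕ) * p) = aeval (companionMap r) (p * X ^ (k : ℕ)) := by
      rw [mul_comm]
    have := LinearMap.congr_fun this x
    simpa using this
  rw [hc, h0] at hk
  exact hk.symm

/-- A Hurwitz polynomial has a quadratic Lyapunov form for its companion system. -/
theorem exists_companion_lyapunov {m : ℕ} (r : Fin m → ℝ)
    (hr : ∀ z : ℂ, z ^ m + ∑ i : Fin m, (r i : ℂ) * z ^ (i : ℕ) = 0 → z.re < 0) :
    ∃ B : EuclideanSpace ℝ (Fin m) →L[ℝ] EuclideanSpace ℝ (Fin m) →L[ℝ] ℝ,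
      (∀ x, ‖x‖ ^ 2 ≤ B x x) ∧ ∀ x x' : EuclideanSpace ℝ (Fin m),
        (∀ i, x' i = if h : (i : ℕ) + 1 < m then x ⟨i + 1, h⟩ else -∑ k, r k * x k) →
        B x x' + B x' x ≤ -‖x‖ ^ 2 := by
  classical
  set p : Polynomial ℂ := Polynomial.X ^ m +
    ∑ i : Fin m, Polynomial.C (r i : ℂ) * Polynomial.X ^ (i : ℕ) with hp
  have hmonic : p.Monic := by
    apply Polynomial.monic_X_pow_add
    refine (Polynomial.degree_sum_fin_lt fun i => (r i : ℂ))
  have hroots : ∀ z ∈ p.roots, z.re < 0 := by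
    intro z hz
    apply hr
    have := (Polynomial.mem_roots'.1 hz).2
    simpa [hp, Polynomial.IsRoot, Polynomial.eval_finsetSum] using this
  -- Over `ℂ` the monic `p` is the product of its factors `X - z`, all with `Re z < 0`. As `p(T) =
  -- 0`, the error term with factor `K` disappears, and the form is then restricted to real vectors.
  have hprod := (IsAlgClosed.splits p).eq_prod_roots_of_monic hmonic
  set T : EuclideanSpace ℂ (Fin m) →L[ℂ] EuclideanSpace ℂ (Fin m) :=
    LinearMap.toContinuousLinearMap (companionMap fun i => (r i : ℂ)) with hT
  obtain ⟨B, K, -, hB, hd⟩ := exists_lyapunov_form_aux T p.roots hroots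
  have hz : ∀ x, Polynomial.aeval T p x = 0 := by
    intro x
    have h1 := LinearMap.congr_fun (aeval_companionMap fun i => (r i : ℂ)) x
    have h2 : ∀ k, ∀ x, (T ^ k) x = ((companionMap fun i => (r i : ℂ)) ^ k) x := by
      intro k
      induction k with
      | zero => simp
      | succ k ih => intro x; rw [pow_succ, pow_succ, mul_apply_eq_comp, Module.End.mul_apply, ih]; rfl
    refine Eq.trans ?_ h1
    simp [hp, h2, Algebra.algebraMap_eq_smul_one]
  let ι : EuclideanSpace ℝ (Fin m) →ₗ[ℝ] EuclideanSpace ℂ (Fin m) :=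
    { toFun := fun x => WithLp.toLp 2 fun i => (x i : ℂ)
      map_add' := fun x y => by ext i; simp
      map_smul' := fun c x => by ext i; simp }
  have hι : ∀ x, ‖ι x‖ = ‖x‖ := by
    intro x
    simp [EuclideanSpace.norm_eq, ι]
  refine ⟨B.bilinearComp ι.toContinuousLinearMap ι.toContinuousLinearMap, fun x => ?_,
    fun x x' hx' => ?_⟩
  · have := hB (ι x)
    rw [hι] at this
    exact this
  · have hTι : T (ι x) = ι x' := by
      ext i
      change companionMap (fun i => (r i : ℂ)) (ι x) i = ((x' i : ℝ) : ℂ)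
      rw [companionMap_apply, hx' i]
      split_ifs
      · rfl
      · simp [ι]
    have := hd (ι x)
    rw [← hprod, hz, hTι, hι] at this
    simpa using this

/-! ### Strictification of semidefinite Lyapunov functions -/

theorem tendsto_mul_norm_sq_cocompact {E : Type*} [NormedAddCommGroup E] [ProperSpace E] {c : ℝ}
    (hc : 0 < c) : Tendsto (fun x : E => c * ‖x‖ ^ 2) (cocompact E) atTop :=
  Tendsto.const_mul_atTop hc ((tendsto_pow_atTop two_ne_zero).comp tendsto_norm_cocompact_atTop)

theorem hasFDerivAt_quadratic {E : Type*} [NormedAddCommGroup E] [NormedSpace ℝ E]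
    (A : E →L[ℝ] E →L[ℝ] ℝ) (ν : E) : HasFDerivAt (fun ν => A ν ν) (A ν + A.flip ν) ν := by
  have := (A.hasFDerivAt (x := ν)).clm_apply (hasFDerivAt_id ν)
  refine this.congr_fderiv ?_
  ext h
  simp

theorem abs_quadratic_le {E : Type*} [NormedAddCommGroup E] [NormedSpace ℝ E]
    (A : E →L[ℝ] E →L[ℝ] ℝ) (ν : E) : |A ν ν| ≤ ‖A‖ * ‖ν‖ ^ 2 := by
  have := A.le_opNorm₂ ν ν
  rwa [Real.norm_eq_abs, mul_assoc, ← sq] at this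

theorem norm_add_flip_le {E : Type*} [NormedAddCommGroup E] [NormedSpace ℝ E]
    (A : E →L[ℝ] E →L[ℝ] ℝ) (ν : E) : ‖A ν + A.flip ν‖ ≤ 2 * ‖A‖ * ‖ν‖ := by
  have h1 := A.le_opNorm ν
  have h2 := A.flip.le_opNorm ν
  rw [ContinuousLinearMap.opNorm_flip] at h2
  linarith [norm_add_le (A ν) (A.flip ν)]

theorem contDiff_one_of_hasDerivAt {F : Type*} [NormedAddCommGroup F] [NormedSpace ℝ F]
    {B B' : ℝ → F} (hB : ∀ t, HasDerivAt B (B' t) t) (hB' : Continuous B') : ContDiff ℝ 1 B := by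
  rw [contDiff_one_iff_deriv]
  refine ⟨fun t => (hB t).differentiableAt, ?_⟩
  rwa [show deriv B = B' from funext fun t => (hB t).deriv]

/-- `x' = f t x` admits a `C¹` strict Lyapunov function with quadratic decrease and cubic gradient
growth. -/
def HasStrictLyapunov {E : Type*} [NormedAddCommGroup E] [NormedSpace ℝ E] (f : ℝ → E → E) : Prop :=
  ∃ (U : ℝ → E → ℝ) (Ulow Uup : E → ℝ) (b : ℝ), ContDiff ℝ 1 (Function.uncurry U) ∧
    IsProperPosDef Ulow 0 ∧ IsProperPosDef Uup 0 ∧ (∀ t ν, Ulow ν ≤ U t ν) ∧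
    (∀ t ν, U t ν ≤ Uup ν) ∧
    (∀ t ν, deriv (fun τ => U τ ν) t + fderiv ℝ (U t) ν (f t ν) ≤ -‖ν‖ ^ 2) ∧ 0 < b ∧
    ∀ t ν, ‖fderiv ℝ (U t) ν‖ ≤ b * (‖ν‖ + ‖ν‖ ^ 3)

/-- Strictification of a Lyapunov form `B₀` whose derivative is only semidefinite, by a bounded
time-varying form `B`. -/
theorem exists_strict_lyapunov {E : Type*} [NormedAddCommGroup E] [NormedSpace ℝ E]
    [FiniteDimensional ℝ E] (f : ℝ → E → E) (B₀ : E →L[ℝ] E →L[ℝ] ℝ)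
    (B B' : ℝ → E →L[ℝ] E →L[ℝ] ℝ) (m : E → ℝ) {v c κ C C₁ : ℝ} (hv : 0 < v) (hc : 0 < c)
    (hκ : 0 < κ) (h0 : ∀ ν, v * ‖ν‖ ^ 2 ≤ B₀ ν ν)
    (h0d : ∀ t ν, B₀ ν (f t ν) + B₀ (f t ν) ν ≤ -c * m ν ^ 2)
    (hB : ∀ t, HasDerivAt B (B' t) t) (hB' : Continuous B') (hC : ∀ t, ‖B t‖ ≤ C)
    (hd : ∀ t ν, B' t ν ν + (B t ν (f t ν) + B t (f t ν) ν) ≤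
      -κ * ‖ν‖ ^ 2 + C₁ * (m ν ^ 2 + m ν ^ 2 * ‖ν‖ ^ 2)) :
    HasStrictLyapunov f := by
  have hC0 : 0 ≤ C := le_trans (norm_nonneg (B 0)) (hC 0)
  -- The function is `κ⁻¹ (K (B₀ + B₀²) + B_t)`. The three summands of `K` serve, in order, to
  -- dominate `B_t` so that the function is at least `κ⁻¹ ‖ν‖²`, to absorb `C₁ m²` by the decrease
  -- of `B₀`, and to absorb `C₁ m² ‖ν‖²` by that of `B₀²`, which is at least `2cv m² ‖ν‖²`. The
  -- square is what makes the gradient grow cubically.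
  obtain ⟨K, hK⟩ : ∃ K : ℝ, K = (C + 1) / v + |C₁| / c + |C₁| / (2 * c * v) := ⟨_, rfl⟩
  have hK0 : 0 ≤ K := by rw [hK]; positivity
  have hKv : C + 1 ≤ K * v := by
    have : (C + 1) / v ≤ K := by
      rw [hK]; linarith [show 0 ≤ |C₁| / c by positivity, show 0 ≤ |C₁| / (2 * c * v) by positivity]
    rwa [div_le_iff₀ hv] at this
  have hKc : C₁ ≤ K * c := by
    have : |C₁| / c ≤ K := by
      rw [hK]; linarith [show 0 ≤ (C + 1) / v by positivity, show 0 ≤ |C₁| / (2 * c * v) by positivity]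
    rw [div_le_iff₀ hc] at this
    exact (le_abs_self _).trans this
  have hKcv : C₁ ≤ K * (2 * c * v) := by
    have : |C₁| / (2 * c * v) ≤ K := by
      rw [hK]; linarith [show 0 ≤ (C + 1) / v by positivity, show 0 ≤ |C₁| / c by positivity]
    rw [div_le_iff₀ (by positivity)] at this
    exact (le_abs_self _).trans this
  have hB1 : ContDiff ℝ 1 B := contDiff_one_of_hasDerivAt hB hB'
  have hq := fun (A : E →L[ℝ] E →L[ℝ] ℝ) ν => hasFDerivAt_quadratic A ν
  have hqb := fun (A : E →L[ℝ] E →L[ℝ] ℝ) ν => abs_quadratic_le A ν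
  have hgb := fun (A : E →L[ℝ] E →L[ℝ] ℝ) ν => norm_add_flip_le A ν
  have hCν : ∀ t ν, |B t ν ν| ≤ C * ‖ν‖ ^ 2 := fun t ν =>
    (hqb (B t) ν).trans (mul_le_mul_of_nonneg_right (hC t) (by positivity))
  have hU : ∀ t ν, HasFDerivAt (fun ν => κ⁻¹ * (K * (B₀ ν ν + B₀ ν ν ^ 2) + B t ν ν))
      (κ⁻¹ • ((K * (1 + 2 * B₀ ν ν)) • (B₀ ν + B₀.flip ν) + (B t ν + (B t).flip ν))) ν := by
    intro t ν
    have h1 := (((hq B₀ ν).add ((hq B₀ ν).pow 2)).const_mul K).add (hq (B t) ν)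
    refine (h1.const_mul κ⁻¹).congr_fderiv ?_
    ext h
    simp
    ring
  refine ⟨fun t ν => κ⁻¹ * (K * (B₀ ν ν + B₀ ν ν ^ 2) + B t ν ν), fun ν => κ⁻¹ * ‖ν‖ ^ 2,
    fun ν => κ⁻¹ * (K * ‖B₀‖ + K * ‖B₀‖ ^ 2 + C + 1) * ‖ν‖ ^ 2 * (1 + ‖ν‖ ^ 2),
    κ⁻¹ * (2 * K * ‖B₀‖ + 4 * K * ‖B₀‖ ^ 2 + 2 * C + 1), ?_, ?_, ?_, ?_, ?_, ?_, ?_, ?_⟩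
  · have h1 : ContDiff ℝ 1 (fun p : ℝ × E => B p.1 p.2 p.2) :=
      ((hB1.comp contDiff_fst).clm_apply contDiff_snd).clm_apply contDiff_snd
    have h2 : ContDiff ℝ 1 (fun p : ℝ × E => B₀ p.2 p.2) :=
      (B₀.contDiff.comp contDiff_snd).clm_apply contDiff_snd
    exact contDiff_const.mul ((contDiff_const.mul (h2.add (h2.pow 2))).add h1)
  · exact ⟨by fun_prop, by simp, fun x hx => by have := norm_pos_iff.2 hx; positivity,
      tendsto_mul_norm_sq_cocompact (by positivity)⟩
  · refine ⟨by fun_prop, by simp, fun x hx => by have := norm_pos_iff.2 hx; positivity, ?_⟩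
    refine tendsto_atTop_mono (fun x => ?_) (tendsto_mul_norm_sq_cocompact
      (show 0 < κ⁻¹ * (K * ‖B₀‖ + K * ‖B₀‖ ^ 2 + C + 1) by positivity))
    exact le_mul_of_one_le_right (by positivity) (by nlinarith [sq_nonneg ‖x‖])
  · intro t ν
    have h1 := (abs_le.1 (hCν t ν)).1
    have h2 : K * (v * ‖ν‖ ^ 2) ≤ K * (B₀ ν ν + B₀ ν ν ^ 2) :=
      mul_le_mul_of_nonneg_left (by nlinarith [h0 ν, sq_nonneg (B₀ ν ν)]) hK0
    have h3 : (C + 1) * ‖ν‖ ^ 2 ≤ K * v * ‖ν‖ ^ 2 :=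
      mul_le_mul_of_nonneg_right hKv (by positivity)
    exact mul_le_mul_of_nonneg_left (by linarith) (by positivity)
  · intro t ν
    have h1 := (abs_le.1 (hCν t ν)).2
    have h2 := (abs_le.1 (hqb B₀ ν)).2
    have h3 : (B₀ ν ν) ^ 2 ≤ (‖B₀‖ * ‖ν‖ ^ 2) ^ 2 := by
      rw [← sq_abs]; exact pow_le_pow_left₀ (abs_nonneg _) (hqb B₀ ν) 2
    beta_reduce
    rw [mul_assoc, mul_assoc]
    apply mul_le_mul_of_nonneg_left _ (by positivity)
    have h4 : K * (B₀ ν ν + B₀ ν ν ^ 2) ≤ K * (‖B₀‖ * ‖ν‖ ^ 2 + (‖B₀‖ * ‖ν‖ ^ 2) ^ 2) :=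
      mul_le_mul_of_nonneg_left (by linarith) hK0
    have h5 : 0 ≤ K * ‖B₀‖ * ‖ν‖ ^ 4 := by positivity
    have h6 : 0 ≤ (C + 1) * ‖ν‖ ^ 4 := by positivity
    have h7 : 0 ≤ K * ‖B₀‖ ^ 2 * ‖ν‖ ^ 2 := by positivity
    have h8 : 0 ≤ ‖ν‖ ^ 2 := by positivity
    linarith
  · intro t ν
    have e1 : HasDerivAt (fun τ => κ⁻¹ * (K * (B₀ ν ν + B₀ ν ν ^ 2) + B τ ν ν))
        (κ⁻¹ * (B' t ν ν)) t := by
      have h1 : HasDerivAt (fun τ => B τ ν ν) (B' t ν ν) t := by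
        have := ((hB t).clm_apply (hasDerivAt_const t ν)).clm_apply (hasDerivAt_const t ν)
        simpa using this
      exact (h1.const_add _).const_mul _
    rw [e1.deriv, (hU t ν).fderiv]
    simp only [FunLike.coe_smul, Pi.smul_apply, add_apply, smul_eq_mul,
      ContinuousLinearMap.flip_apply]
    have h1 := hd t ν
    have h2 : K * (1 + 2 * B₀ ν ν) * (B₀ ν (f t ν) + B₀ (f t ν) ν) ≤
        K * (1 + 2 * B₀ ν ν) * (-c * m ν ^ 2) := by
      have : 0 ≤ B₀ ν ν := le_trans (by positivity) (h0 ν)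
      exact mul_le_mul_of_nonneg_left (h0d t ν) (by positivity)
    have h3 : K * c * m ν ^ 2 * (v * ‖ν‖ ^ 2) ≤ K * c * m ν ^ 2 * B₀ ν ν :=
      mul_le_mul_of_nonneg_left (h0 ν) (by positivity)
    have h4 : C₁ * m ν ^ 2 ≤ K * c * m ν ^ 2 := mul_le_mul_of_nonneg_right hKc (by positivity)
    have h5 : C₁ * (m ν ^ 2 * ‖ν‖ ^ 2) ≤ K * (2 * c * v) * (m ν ^ 2 * ‖ν‖ ^ 2) :=
      mul_le_mul_of_nonneg_right hKcv (by positivity)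
    rw [← mul_add]
    rw [inv_mul_le_iff₀ hκ]
    linarith
  · positivity
  · intro t ν
    rw [(hU t ν).fderiv]
    rw [norm_smul, Real.norm_of_nonneg (by positivity), mul_assoc]
    apply mul_le_mul_of_nonneg_left _ (by positivity)
    have h0' : 0 ≤ B₀ ν ν := le_trans (by positivity) (h0 ν)
    have h1 := norm_add_le ((K * (1 + 2 * B₀ ν ν)) • (B₀ ν + B₀.flip ν)) (B t ν + (B t).flip ν)
    rw [norm_smul, Real.norm_of_nonneg (by positivity)] at h1
    have h2 : K * (1 + 2 * B₀ ν ν) * ‖B₀ ν + B₀.flip ν‖ ≤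
        K * (1 + 2 * (‖B₀‖ * ‖ν‖ ^ 2)) * (2 * ‖B₀‖ * ‖ν‖) := by
      have := (abs_le.1 (hqb B₀ ν)).2
      apply mul_le_mul _ (hgb B₀ ν) (norm_nonneg _) (by positivity)
      exact mul_le_mul_of_nonneg_left (by linarith) hK0
    have h3 : ‖B t ν + (B t).flip ν‖ ≤ 2 * C * ‖ν‖ := by
      refine (hgb (B t) ν).trans ?_
      have := mul_le_mul_of_nonneg_right (hC t) (norm_nonneg ν)
      linarith
    have h5 : 0 ≤ (2 * K * ‖B₀‖ + 2 * C + 1) * ‖ν‖ ^ 3 := by positivity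
    have h6 : 0 ≤ (4 * K * ‖B₀‖ ^ 2 + 1) * ‖ν‖ := by positivity
    linarith

/-! ### Barrier argument and global existence -/

/-- A function that is nonincreasing near the times at which it is at most `c` stays below `c`. -/
theorem le_of_barrier {v : ℝ → ℝ} {c : ℝ} (hv : ContinuousOn v (Set.Ici 0)) (h0 : v 0 ≤ c)
    (hd : ∀ t, 0 ≤ t → v t ≤ c →
      ∀ᶠ u in 𝓝[≥] t, ∃ v' ≤ 0, HasDerivWithinAt v v' (Set.Ici 0) u) :
    ∀ t, 0 ≤ t → v t ≤ c := by
  intro T hT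
  have hsub : Set.Icc 0 T ⊆ {t | v t ≤ c} := by
    apply IsClosed.Icc_subset_of_forall_exists_gt
    · have : {t | v t ≤ c} ∩ Set.Icc 0 T = Set.Icc 0 T ∩ v ⁻¹' Set.Iic c := by
        rw [Set.inter_comm]; rfl
      rw [this]
      exact (hv.mono fun t ht => ht.1).preimage_isClosed_of_isClosed isClosed_Icc isClosed_Iic
    · exact h0
    · rintro t ⟨htc, ht0, -⟩ y hy
      have hE := hd t ht0 htc
      rw [eventually_iff, mem_nhdsGE_iff_exists_Icc_subset] at hE
      obtain ⟨u, hu, hsub⟩ := hE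
      have hu' : t < u := hu
      have hy' : t < y := hy
      have hanti : AntitoneOn v (Set.Icc t u) := by
        apply antitoneOn_of_deriv_nonpos (convex_Icc _ _)
        · exact hv.mono fun w hw => ht0.trans hw.1
        · rw [interior_Icc]
          intro w hw
          obtain ⟨v', -, h⟩ := hsub (Set.Ioo_subset_Icc_self hw)
          exact (h.hasDerivAt (Ici_mem_nhds (ht0.trans_lt hw.1))).differentiableAt.differentiableWithinAt
        · rw [interior_Icc]
          intro w hw
          obtain ⟨v', hv', h⟩ := hsub (Set.Ioo_subset_Icc_self hw)
          rwa [(h.hasDerivAt (Ici_mem_nhds (ht0.trans_lt hw.1))).deriv]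
      refine ⟨min u y, ?_, lt_min hu' hy', min_le_right _ _⟩
      exact (hanti (Set.left_mem_Icc.2 hu'.le) ⟨(lt_min hu' hy').le, min_le_left _ _⟩
        (lt_min hu' hy').le).trans htc
  exact hsub ⟨hT, le_rfl⟩

/-- Global existence for bounded, globally Lipschitz time-dependent vector fields. -/
theorem exists_global_solution {E : Type*} [NormedAddCommGroup E] [NormedSpace ℝ E]
    [CompleteSpace E] (f : ℝ → E → E) (K L : NNReal)
    (hK : ∀ t, 0 ≤ t → LipschitzWith K (f t)) (hf : ∀ x, ContinuousOn (f · x) (Set.Ici 0))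
    (hL : ∀ t, 0 ≤ t → ∀ x, ‖f t x‖ ≤ L) (x₀ : E) :
    ∃ x : ℝ → E, x 0 = x₀ ∧ ∀ t, 0 ≤ t → HasDerivWithinAt x (f t (x t)) (Set.Ici 0) t := by
  have hloc : ∀ N : ℕ, ∃ α : ℝ → E, α 0 = x₀ ∧
      ∀ t ∈ Set.Icc (0 : ℝ) N, HasDerivWithinAt α (f t (α t)) (Set.Icc (0 : ℝ) N) t := by
    intro N
    -- A field bounded by `L` cannot carry a solution farther than `L * N` in time `N`, so this
    -- radius makes Picard-Lindelöf valid on the whole interval. The solutions on `[0, N]` agree by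
    -- uniqueness and are glued.
    have hP : IsPicardLindelof f (tmin := 0) (tmax := N) ⟨0, le_rfl, N.cast_nonneg⟩ x₀
        (L * N) 0 L K :=
      { lipschitzOnWith := fun t ht => (hK t ht.1).lipschitzOnWith
        continuousOn := fun x _ => (hf x).mono fun t ht => ht.1
        norm_le := fun t ht x _ => hL t ht.1 x
        mul_max_le := by simp }
    exact hP.exists_eq_forall_mem_Icc_hasDerivWithinAt₀
  choose α hα0 hα using hloc
  have huniq : ∀ M N : ℕ, M ≤ N → Set.EqOn (α M) (α N) (Set.Icc 0 M) := by
    intro M N hMN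
    have hMN' : (M : ℝ) ≤ N := by exact_mod_cast hMN
    have hIci : ∀ P : ℕ, ∀ t ∈ Set.Ico (0 : ℝ) P,
        HasDerivWithinAt (α P) (f t (α P t)) (Set.Ici t) t := by
      intro P t ht
      refine ((hα P t ⟨ht.1, ht.2.le⟩).mono_of_mem_nhdsWithin ?_)
      exact mem_of_superset (Icc_mem_nhdsGE ht.2) (Set.Icc_subset_Icc_left ht.1)
    refine ODE_solution_unique_of_mem_Icc_right (v := f) (s := fun _ => Set.univ) (K := K)
      (fun t ht => (hK t ht.1).lipschitzOnWith) ?_ (hIci M) (fun _ _ => trivial) ?_ ?_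
      (fun _ _ => trivial) (by rw [hα0, hα0])
    · exact fun t ht => (hα M t ht).continuousWithinAt
    · exact fun t ht => ((hα N t ⟨ht.1, ht.2.trans hMN'⟩).continuousWithinAt).mono
        (Set.Icc_subset_Icc_right hMN')
    · exact fun t ht => hIci N t ⟨ht.1, ht.2.trans_le hMN'⟩
  have heq : ∀ (N : ℕ) (t : ℝ), 0 ≤ t → t ≤ N → α (⌈t⌉₊) t = α N t := fun N t h0 h1 =>
    huniq _ _ (Nat.ceil_le.2 h1) ⟨h0, Nat.le_ceil t⟩
  refine ⟨fun t => α (⌈t⌉₊) t, by simp [hα0], fun t ht => ?_⟩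
  set N := ⌈t⌉₊ + 1 with hN
  have htN : t < N := by
    rw [hN]; push_cast; linarith [Nat.le_ceil t]
  have h1 := hα N t ⟨ht, htN.le⟩
  have h2 : HasDerivWithinAt (α N) (f t (α N t)) (Set.Ici 0) t := by
    apply h1.mono_of_mem_nhdsWithin
    have : Set.Icc (0 : ℝ) N = Set.Ici 0 ∩ Set.Iic (N : ℝ) := rfl
    rw [this]
    exact inter_mem self_mem_nhdsWithin (mem_nhdsWithin_of_mem_nhds (Iic_mem_nhds htN))
  have h3 := heq N t ht htN.le
  simp only [h3]
  refine h2.congr_of_eventuallyEq ?_ h3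
  filter_upwards [self_mem_nhdsWithin, mem_nhdsWithin_of_mem_nhds (Iic_mem_nhds htN)] with u hu hu'
  exact heq N u hu hu'

end FreqControl

/-! ### Oscillations and persistency of excitation -/

namespace FreqControl

/-- The oscillation `Re (c e^{iat})`. -/
noncomputable def osc (c : ℂ) (a t : ℝ) : ℝ := (c * Complex.exp (a * t * Complex.I)).re

theorem hasDerivAt_osc (c : ℂ) (a t : ℝ) :
    HasDerivAt (osc c a) (osc (c * (a * Complex.I)) a t) t := by
  have h1 : HasDerivAt (fun u : ℝ => c * Complex.exp (a * u * Complex.I))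
      (c * (a * Complex.I) * Complex.exp (a * t * Complex.I)) t := by
    have h2 : HasDerivAt (fun u : ℝ => (a : ℂ) * u * Complex.I) (a * 1 * Complex.I) t :=
      (((hasDerivAt_id (t : ℂ)).comp_ofReal).const_mul (a : ℂ)).mul_const _
    refine (h2.cexp.const_mul c).congr_deriv ?_
    ring
  exact (Complex.reCLM.hasFDerivAt.comp_hasDerivAt t h1)

theorem abs_osc_le (c : ℂ) (a t : ℝ) : |osc c a t| ≤ ‖c‖ := by
  refine (Complex.abs_re_le_norm _).trans ?_
  rw [norm_mul, show (a : ℂ) * t * Complex.I = ((a * t : ℝ) : ℂ) * Complex.I by push_cast; ring,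
    Complex.norm_exp_ofReal_mul_I, mul_one]

/-- `Re u · Re v = (Re (u v) + Re (u v̄)) / 2`: a product of oscillations is a sum of oscillations
at the sum and at the difference of the frequencies. -/
theorem osc_mul_osc (c d : ℂ) (a b t : ℝ) :
    osc c a t * osc d b t = osc (c * d / 2) (a + b) t + osc (c * starRingEnd ℂ d / 2) (a - b) t := by
  have h1 : Complex.exp (((a + b : ℝ) : ℂ) * t * Complex.I) =
      Complex.exp (a * t * Complex.I) * Complex.exp (b * t * Complex.I) := by
    rw [← Complex.exp_add]; congr 1; push_cast; ring
  have h2 : Complex.exp (((a - b : ℝ) : ℂ) * t * Complex.I) =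
      Complex.exp (a * t * Complex.I) * starRingEnd ℂ (Complex.exp (b * t * Complex.I)) := by
    rw [← Complex.exp_conj, ← Complex.exp_add]; congr 1; simp; ring
  simp only [osc, h1, h2]
  set u := Complex.exp (a * t * Complex.I)
  set v := Complex.exp (b * t * Complex.I)
  rw [show c * d / 2 * (u * v) = ((1 / 2 : ℝ) : ℂ) * (c * u * (d * v)) by push_cast; ring,
    show c * starRingEnd ℂ d / 2 * (u * starRingEnd ℂ v) =
      ((1 / 2 : ℝ) : ℂ) * (c * u * starRingEnd ℂ (d * v)) by push_cast; rw [map_mul]; ring,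
    Complex.re_ofReal_mul, Complex.re_ofReal_mul, Complex.mul_re (c * u) (d * v),
    Complex.mul_re (c * u) (starRingEnd ℂ (d * v)), Complex.conj_re, Complex.conj_im]
  ring

theorem exists_antideriv_osc (c : ℂ) {a : ℝ} (ha : a ≠ 0) :
    ∃ (n : ℝ → ℝ) (C : ℝ), (∀ t, HasDerivAt n (osc c a t) t) ∧ ∀ t, |n t| ≤ C := by
  refine ⟨osc (c / (a * Complex.I)) a, _, fun t => ?_, fun t => abs_osc_le _ _ _⟩
  have := hasDerivAt_osc (c / (a * Complex.I)) a t
  rwa [div_mul_cancel₀ _ (by simp [ha])] at this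

/-- The sum of the frequencies is positive and their difference is nonzero unless `k = l`. Only the
zero frequency has no bounded antiderivative; it occurs just for `k = l` and contributes the
subtracted mean. -/
theorem exists_antideriv_osc_mul {ι : Type*} [DecidableEq ι] (c : ι → ℂ) {a : ι → ℝ}
    (ha : ∀ k, 0 < a k) (hinj : Function.Injective a) (k l : ι) :
    ∃ (n : ℝ → ℝ) (C : ℝ), (∀ t, HasDerivAt n (osc (c k) (a k) t * osc (c l) (a l) t -
      if k = l then ‖c k‖ ^ 2 / 2 else 0) t) ∧ ∀ t, |n t| ≤ C := by
  obtain ⟨n₁, C₁, h₁, hC₁⟩ := exists_antideriv_osc (c k * c l / 2)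
    (show a k + a l ≠ 0 by linarith [ha k, ha l])
  by_cases hkl : k = l
  · subst hkl
    refine ⟨n₁, C₁, fun t => ?_, hC₁⟩
    refine (h₁ t).congr_deriv ?_
    rw [osc_mul_osc, if_pos rfl, sub_self]
    have : osc (c k * starRingEnd ℂ (c k) / 2) 0 t = ‖c k‖ ^ 2 / 2 := by
      rw [osc, Complex.mul_conj, Complex.normSq_eq_norm_sq]
      simp [-Complex.ofReal_pow]
    rw [this]; ring
  · obtain ⟨n₂, C₂, h₂, hC₂⟩ := exists_antideriv_osc (c k * starRingEnd ℂ (c l) / 2)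
      (sub_ne_zero.2 fun h => hkl (hinj h))
    refine ⟨fun t => n₁ t + n₂ t, C₁ + C₂, fun t => ?_, fun t =>
      (abs_add_le _ _).trans (add_le_add (hC₁ t) (hC₂ t))⟩
    refine ((h₁ t).add (h₂ t)).congr_deriv ?_
    rw [osc_mul_osc, if_neg hkl, sub_zero]

/-- Persistency of excitation of the signals `w_m = ∑ₖ (-aₖ²)^m Re (cₖ e^{i aₖ t})`: up to a
positive definite constant, `w wᵀ` has a bounded antiderivative. -/
theorem exists_excitation {s : ℕ} (c : Fin s → ℂ) {a : Fin s → ℝ} (hc : ∀ k, c k ≠ 0)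
    (ha : ∀ k, 0 < a k) (hinj : Function.Injective a) (w : ℝ → Fin s → ℝ)
    (hw : ∀ t m, w t m = ∑ k, (-(a k) ^ 2) ^ (m : ℕ) * osc (c k) (a k) t) :
    ∃ (N : Fin s → Fin s → ℝ → ℝ) (Γ : Fin s → Fin s → ℝ) (κ C : ℝ), 0 < κ ∧
      (∀ m l t, HasDerivAt (N m l) (w t m * w t l - Γ m l) t) ∧ (∀ m l t, |N m l t| ≤ C) ∧
      ∀ x : Fin s → ℝ, κ * ∑ m, x m ^ 2 ≤ ∑ m, ∑ l, Γ m l * (x m * x l) := by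
  choose n C hn hC using fun k l => exists_antideriv_osc_mul c ha hinj k l
  let p : Fin s → Fin s → ℝ := fun k m => (-(a k) ^ 2) ^ (m : ℕ)
  -- The time average of `w wᵀ` is `Γ`, and `xᵀ Γ x = ‖f x‖² / 2`. Up to the nonzero factors `‖c
  -- k‖`, `f` is the Vandermonde matrix with the distinct nodes `-a_k²`, hence injective and bounded
  -- below.
  let f : EuclideanSpace ℝ (Fin s) →ₗ[ℝ] EuclideanSpace ℝ (Fin s) :=
    { toFun := fun x => WithLp.toLp 2 fun k => ‖c k‖ * ∑ m, p k m * x m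
      map_add' := fun x y => by ext k; simp [mul_add, Finset.sum_add_distrib]
      map_smul' := fun r x => by
        ext k
        simp only [PiLp.smul_apply, smul_eq_mul, RingHom.id_apply]
        rw [mul_left_comm, Finset.mul_sum Finset.univ _ r]
        congr 1
        exact Finset.sum_congr rfl fun m _ => by ring }
  have hf : Function.Injective f := by
    rw [← LinearMap.ker_eq_bot, LinearMap.ker_eq_bot']
    intro x hx
    have h1 : (Matrix.vandermonde fun k => -(a k) ^ 2).mulVec x = 0 := by
      ext k
      have hk : ‖c k‖ * ∑ m, p k m * x m = 0 := congrArg (fun y => y.ofLp k) hx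
      have := (mul_eq_zero.1 hk).resolve_left (norm_ne_zero_iff.2 (hc k))
      simpa [Matrix.mulVec, dotProduct, Matrix.vandermonde_apply] using this
    have hdet : (Matrix.vandermonde fun k => -(a k) ^ 2).det ≠ 0 := by
      rw [Matrix.det_vandermonde_ne_zero_iff]
      intro k l hkl
      have : a k ^ 2 = a l ^ 2 := neg_injective hkl
      exact hinj ((pow_left_inj₀ (ha k).le (ha l).le two_ne_zero).1 this)
    have := Matrix.eq_zero_of_mulVec_eq_zero hdet h1
    ext k
    exact congrFun this k
  obtain ⟨κ, hκ, hκf⟩ := exists_pos_mul_norm_le f hf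
  refine ⟨fun m l t => ∑ k, ∑ k', p k m * p k' l * n k k' t,
    fun m l => ∑ k, p k m * p k l * (‖c k‖ ^ 2 / 2), κ ^ 2 / 2,
    ∑ m, ∑ l, ∑ k, ∑ k', |p k m * p k' l| * |C k k'|, by positivity, ?_, ?_, ?_⟩
  · intro m l t
    have h1 : HasDerivAt (fun t => ∑ k, ∑ k', p k m * p k' l * n k k' t)
        (∑ k, ∑ k', p k m * p k' l * (osc (c k) (a k) t * osc (c k') (a k') t -
          if k = k' then ‖c k‖ ^ 2 / 2 else 0)) t :=
      HasDerivAt.fun_sum fun k _ => HasDerivAt.fun_sum fun k' _ => (hn k k' t).const_mul _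
    refine h1.congr_deriv ?_
    rw [hw, hw, Finset.sum_mul_sum, ← Finset.sum_sub_distrib]
    refine Finset.sum_congr rfl fun k _ => ?_
    simp only [mul_sub, Finset.sum_sub_distrib, mul_ite, mul_zero, Finset.sum_ite_eq,
      Finset.mem_univ, if_true]
    congr 1
    exact Finset.sum_congr rfl fun k' _ => by simp only [p]; ring
  · intro m l t
    have h1 : |∑ k, ∑ k', p k m * p k' l * n k k' t| ≤
        ∑ k, ∑ k', |p k m * p k' l| * |C k k'| := by
      refine (Finset.abs_sum_le_sum_abs _ _).trans (Finset.sum_le_sum fun k _ => ?_)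
      refine (Finset.abs_sum_le_sum_abs _ _).trans (Finset.sum_le_sum fun k' _ => ?_)
      rw [abs_mul]
      exact mul_le_mul_of_nonneg_left ((hC k k' t).trans (le_abs_self _)) (abs_nonneg _)
    refine h1.trans ?_
    refine le_trans ?_ (Finset.single_le_sum (f := fun m => ∑ l, ∑ k, ∑ k', |p k m * p k' l| *
      |C k k'|) (fun i _ => by positivity) (Finset.mem_univ m))
    exact Finset.single_le_sum (f := fun l => ∑ k, ∑ k', |p k m * p k' l| *
      |C k k'|) (fun i _ => by positivity) (Finset.mem_univ l)
  · intro x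
    have h1 := hκf (WithLp.toLp 2 x)
    have h2 := pow_le_pow_left₀ (by positivity) h1 2
    rw [mul_pow, EuclideanSpace.real_norm_sq_eq, EuclideanSpace.real_norm_sq_eq] at h2
    have h3 : ∑ m, ∑ l, (∑ k, p k m * p k l * (‖c k‖ ^ 2 / 2)) * (x m * x l) =
        (∑ k, (‖c k‖ * ∑ m, p k m * x m) ^ 2) / 2 := by
      simp only [sq, Finset.sum_mul, Finset.mul_sum,
        Finset.sum_div]
      rw [Finset.sum_comm]
      conv_rhs => rw [Finset.sum_comm]; enter [2, m]; rw [Finset.sum_comm]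
      rw [Finset.sum_comm]
      refine Finset.sum_congr rfl fun m _ => Finset.sum_congr rfl fun l _ =>
        Finset.sum_congr rfl fun k _ => by ring
    rw [h3]
    have h4 : ∑ i, (f (WithLp.toLp 2 x)).ofLp i ^ 2 = ∑ k, (‖c k‖ * ∑ m, p k m * x m) ^ 2 := rfl
    rw [h4] at h2
    linarith

end FreqControl

/-! ### The exosystem, invertibility of `O_j` and the steady state `φ_j` -/

namespace FreqControl

/-- Expanding `∏ (x + a_l²)`, which has the root `x = -a_k²`, gives the elementary symmetric
functions as coefficients. -/
theorem sum_alphaOf_mul_pow (s : ℕ) (a : Fin s → ℝ) (k : Fin s) :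
    ∑ m, alphaOf s a m * (-(a k) ^ 2) ^ (m : ℕ) = (-(a k) ^ 2) ^ s := by
  set x := -(a k) ^ 2 with hx
  have h0 : ∏ l, (a l ^ 2 + x) = 0 := Finset.prod_eq_zero (Finset.mem_univ k) (by rw [hx]; ring)
  rw [Finset.prod_add, Finset.sum_powerset, Finset.card_univ, Fintype.card_fin] at h0
  have h1 : ∀ j ∈ Finset.range (s + 1), ∑ T ∈ Finset.powersetCard j (Finset.univ : Finset (Fin s)),
      (∏ l ∈ T, a l ^ 2) * ∏ l ∈ Finset.univ \ T, x =
      (∑ T ∈ Finset.powersetCard j (Finset.univ : Finset (Fin s)), ∏ l ∈ T, a l ^ 2) *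
        x ^ (s - j) := by
    intro j hj
    rw [Finset.sum_mul]
    refine Finset.sum_congr rfl fun T hT => ?_
    rw [Finset.prod_const, Finset.card_sdiff_of_subset (Finset.subset_univ _), Finset.card_univ,
      Fintype.card_fin, (Finset.mem_powersetCard.1 hT).2]
  rw [Finset.sum_congr rfl h1, ← Finset.sum_range_reflect, Finset.sum_range_succ] at h0
  simp only [Nat.add_sub_cancel, Nat.sub_self, Finset.powersetCard_zero, Finset.sum_singleton,
    Finset.prod_empty, Nat.sub_zero, one_mul] at h0
  have h2 : ∑ m, alphaOf s a m * x ^ (m : ℕ) = -∑ j ∈ Finset.range s,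
      (∑ T ∈ Finset.powersetCard (s - j) (Finset.univ : Finset (Fin s)), ∏ l ∈ T, a l ^ 2) *
        x ^ (s - (s - j)) := by
    rw [Finset.sum_range, ← Finset.sum_neg_distrib]
    refine Finset.sum_congr rfl fun m _ => ?_
    rw [alphaOf, Nat.sub_sub_self m.2.le, neg_mul]
  rw [h2]
  linarith

/-- `z` is an eigenvalue of `A(α)`. -/
def IsExoRoot (s : ℕ) (α : Fin s → ℝ) (z : ℂ) : Prop :=
  ∑ m : Fin s, (α m : ℂ) * z ^ (2 * (m : ℕ) + 1) = z ^ (2 * s + 1)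

theorem isExoRoot_zero (s : ℕ) (α : Fin s → ℝ) : IsExoRoot s α 0 := by
  simp [IsExoRoot]

theorem isExoRoot_of_sq {s : ℕ} (a : Fin s → ℝ) (k : Fin s) {z : ℂ} (hz : z ^ 2 = -(a k) ^ 2) :
    IsExoRoot s (alphaOf s a) z := by
  have h := congrArg (fun x : ℝ => (x : ℂ)) (sum_alphaOf_mul_pow s a k)
  push_cast at h
  simp only [IsExoRoot, pow_succ _ (2 * _), pow_mul, hz, ← mul_assoc]
  rw [← Finset.sum_mul, h]

/-- The matrix has companion shape, so `(1, z, …, z^{2s})` is an eigenvector for each root `z` of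
its characteristic equation. Everything built from `A(α)` below is evaluated on these vectors. -/
theorem exoMatrix_eigen {s : ℕ} {α : Fin s → ℝ} {z : ℂ} (hz : IsExoRoot s α z)
    (i : Fin (2 * s + 1)) : ∑ l, (exoMatrix s α i l : ℂ) * z ^ (l : ℕ) = z * z ^ (i : ℕ) := by
  by_cases hi : (i : ℕ) = 2 * s
  · have h1 : ∀ l : Fin (2 * s + 1), (exoMatrix s α i l : ℂ) * z ^ (l : ℕ) =
        ∑ m : Fin s, if l = (⟨2 * (m : ℕ) + 1, by omega⟩ : Fin (2 * s + 1))
          then (α m : ℂ) * z ^ (l : ℕ) else 0 := by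
      intro l
      simp only [exoMatrix, Matrix.of_apply, if_pos hi, Complex.ofReal_sum, Finset.sum_mul]
      refine Finset.sum_congr rfl fun m _ => ?_
      simp only [Fin.ext_iff]
      split_ifs <;> simp
    simp only [h1]
    rw [Finset.sum_comm]
    simp only [Finset.sum_ite_eq', Finset.mem_univ, if_true]
    rw [hi, hz, pow_succ, mul_comm]
  · have hi' : (i : ℕ) + 1 < 2 * s + 1 := by have := i.2; omega
    rw [Finset.sum_eq_single (⟨i + 1, hi'⟩ : Fin (2 * s + 1))]
    · rw [exoMatrix, Matrix.of_apply, if_neg hi, if_pos rfl]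
      simp [pow_succ']
    · intro l _ hl
      have : ¬ (l : ℕ) = i + 1 := fun h => hl (Fin.ext h)
      simp [exoMatrix, hi, this]
    · simp

theorem sum_one_apply_mul_pow {p : ℕ} (z : ℂ) (i : Fin p) :
    ∑ l, ((1 : Matrix (Fin p) (Fin p) ℝ) i l : ℂ) * z ^ (l : ℕ) = z ^ (i : ℕ) := by
  rw [Finset.sum_eq_single i]
  · simp
  · intro l _ hl
    simp [Matrix.one_apply_ne hl.symm]
  · simp

theorem exoMatrix_pow_eigen {s : ℕ} {α : Fin s → ℝ} {z : ℂ} (hz : IsExoRoot s α z) (k : ℕ)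
    (i : Fin (2 * s + 1)) :
    ∑ l, ((exoMatrix s α ^ k) i l : ℂ) * z ^ (l : ℕ) = z ^ k * z ^ (i : ℕ) := by
  induction k generalizing i with
  | zero => simp [sum_one_apply_mul_pow]
  | succ k ih =>
    simp only [pow_succ' (exoMatrix s α), Matrix.mul_apply, Complex.ofReal_sum, Complex.ofReal_mul,
      Finset.sum_mul]
    rw [Finset.sum_comm]
    simp only [mul_assoc, ← Finset.mul_sum, ih]
    simp only [mul_left_comm _ (z ^ k), ← Finset.mul_sum, exoMatrix_eigen hz]
    ring

/-- The polynomial with coefficient row `R`. -/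
noncomputable def rowPoly {s : ℕ} (r : Fin (2 * s) → ℝ) (z : ℂ) : ℂ :=
  ∑ i, (rowR s r i : ℂ) * z ^ (i : ℕ)

theorem rowPoly_eq {s : ℕ} (r : Fin (2 * s) → ℝ) (z : ℂ) :
    rowPoly r z = z ^ (2 * s) + ∑ i : Fin (2 * s), (r i : ℂ) * z ^ (i : ℕ) := by
  rw [rowPoly, Fin.sum_univ_castSucc, add_comm]
  simp [rowR]

theorem rowA_eigen {s : ℕ} {α : Fin s → ℝ} {z : ℂ} (hz : IsExoRoot s α z)
    (r : Fin (2 * s) → ℝ) :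
    ∑ l, (rowA s r α l : ℂ) * z ^ (l : ℕ) = (1 + z) * rowPoly r z := by
  have h1 : ∀ i : Fin (2 * s + 1), ∑ l, ((1 + exoMatrix s α) i l : ℂ) * z ^ (l : ℕ) =
      (1 + z) * z ^ (i : ℕ) := by
    intro i
    simp only [Matrix.add_apply, Complex.ofReal_add, add_mul, Finset.sum_add_distrib,
      exoMatrix_eigen hz, sum_one_apply_mul_pow, one_mul]
  simp only [rowA, Matrix.vecMul, dotProduct, Complex.ofReal_sum, Complex.ofReal_mul,
    Finset.sum_mul]
  rw [Finset.sum_comm]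
  simp only [mul_assoc, ← Finset.mul_sum, h1]
  rw [rowPoly, Finset.mul_sum]
  exact Finset.sum_congr rfl fun i _ => by ring

/-- On the eigenvector each power of `A(α)` is a power of `z`, so `O(α)` acts on it as the scalar
`(1 + z) R(z)`. -/
theorem obsMatrix_eigen {s : ℕ} {α : Fin s → ℝ} {z : ℂ} (hz : IsExoRoot s α z)
    (r : Fin (2 * s) → ℝ) (i : Fin (2 * s + 1)) :
    ∑ l, (obsMatrix s r α i l : ℂ) * z ^ (l : ℕ) = (1 + z) * rowPoly r z * z ^ (i : ℕ) := by
  simp only [obsMatrix, Matrix.of_apply, Matrix.vecMul, dotProduct, Complex.ofReal_sum,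
    Complex.ofReal_mul, Finset.sum_mul]
  rw [Finset.sum_comm]
  simp only [mul_assoc, ← Finset.mul_sum, exoMatrix_pow_eigen hz]
  simp only [mul_left_comm _ (z ^ (i : ℕ)), ← Finset.mul_sum, rowA_eigen hz]
  ring

/-- Both `1 + z` and the Hurwitz polynomial have their zeros in the open left half plane, so neither
vanishes on the imaginary axis, where the exosystem has its eigenvalues. -/
theorem rowPoly_factor_ne_zero {s : ℕ} {r : Fin (2 * s) → ℝ}
    (hr : ∀ z : ℂ, z ^ (2 * s) + ∑ i : Fin (2 * s), (r i : ℂ) * z ^ (i : ℕ) = 0 → z.re < 0)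
    {z : ℂ} (hz : z.re = 0) : (1 + z) * rowPoly r z ≠ 0 := by
  apply mul_ne_zero
  · intro h
    have := congrArg Complex.re h
    simp [hz] at this
  · intro h
    rw [rowPoly_eq] at h
    have := hr z h
    linarith

/-- Pairing a left null vector `y` with the eigenvectors at `0` and `±i a_k` shows that the
polynomial with coefficients `y`, of degree at most `2s`, has these `2s + 1` distinct zeros. Hence
`y = 0`. -/
theorem det_obsMatrix_ne_zero {s : ℕ} {r : Fin (2 * s) → ℝ} {a : Fin s → ℝ}
    (hr : ∀ z : ℂ, z ^ (2 * s) + ∑ i : Fin (2 * s), (r i : ℂ) * z ^ (i : ℕ) = 0 → z.re < 0)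
    (ha : ∀ k, 0 < a k) (hinj : Function.Injective a) :
    (obsMatrix s r (alphaOf s a)).det ≠ 0 := by
  intro hdet
  obtain ⟨y, hy, hyO⟩ := Matrix.exists_vecMul_eq_zero_iff.2 hdet
  let node : Option (Fin s ⊕ Fin s) → ℂ := fun o =>
    ((o.elim 0 (Sum.elim a fun k => -a k) : ℝ) : ℂ) * Complex.I
  have hnode : Function.Injective node := by
    intro o o' h
    have h' := mul_right_cancel₀ Complex.I_ne_zero h
    have h'' := Complex.ofReal_injective h'
    rcases o with _ | k | k <;> rcases o' with _ | l | l <;>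
      simp only [Option.elim_none, Option.elim_some, Sum.elim_inl, Sum.elim_inr] at h'' ⊢
    · linarith [ha l]
    · linarith [ha l]
    · linarith [ha k]
    · rw [hinj h'']
    · linarith [ha k, ha l]
    · linarith [ha k]
    · linarith [ha k, ha l]
    · rw [hinj (neg_injective h'')]
  have hroot : ∀ o, IsExoRoot s (alphaOf s a) (node o) := by
    intro o
    rcases o with _ | k | k
    · simpa [node] using isExoRoot_zero s (alphaOf s a)
    · exact isExoRoot_of_sq a k (by simp [node, mul_pow])
    · exact isExoRoot_of_sq a k (by simp [node, mul_pow])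
  have hre : ∀ o, (node o).re = 0 := fun o => by simp [node]
  let p : Polynomial ℂ := ∑ i : Fin (2 * s + 1), Polynomial.C (y i : ℂ) * Polynomial.X ^ (i : ℕ)
  have hev : ∀ o, p.eval (node o) = 0 := by
    intro o
    have h1 : ∑ l, ((Matrix.vecMul y (obsMatrix s r (alphaOf s a)) l : ℝ) : ℂ) *
        node o ^ (l : ℕ) = 0 := by simp [hyO]
    simp only [Matrix.vecMul, dotProduct, Complex.ofReal_sum, Complex.ofReal_mul,
      Finset.sum_mul] at h1
    rw [Finset.sum_comm] at h1
    simp only [mul_assoc, ← Finset.mul_sum, obsMatrix_eigen (hroot o)] at h1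
    simp only [← mul_assoc] at h1
    have h2 : ∑ i, (y i : ℂ) * (1 + node o) * rowPoly r (node o) * node o ^ (i : ℕ) =
        ((1 + node o) * rowPoly r (node o)) * ∑ i, (y i : ℂ) * node o ^ (i : ℕ) := by
      rw [Finset.mul_sum]
      exact Finset.sum_congr rfl fun i _ => by ring
    rw [h2] at h1
    have := (mul_eq_zero.1 h1).resolve_left (rowPoly_factor_ne_zero hr (hre o))
    simpa [p, Polynomial.eval_finsetSum] using this
  have hp0 : p = 0 := by
    apply Polynomial.eq_zero_of_natDegree_lt_card_of_eval_eq_zero p hnode hev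
    have hd : p.degree < ((2 * s + 1 : ℕ) : WithBot ℕ) :=
      Polynomial.degree_sum_fin_lt fun i => (y i : ℂ)
    have : Fintype.card (Option (Fin s ⊕ Fin s)) = 2 * s + 1 := by simp; ring
    rw [this]
    by_cases h0 : p = 0
    · simp [h0]
    · exact (Polynomial.natDegree_lt_iff_degree_lt h0).2 hd
  apply hy
  ext i
  have := congrArg (fun q => Polynomial.coeff q (i : ℕ)) hp0
  simp only [p, Polynomial.finsetSum_coeff, Polynomial.coeff_C_mul, Polynomial.coeff_X_pow,
    Polynomial.coeff_zero] at this
  rw [Finset.sum_eq_single i] at this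
  · simpa using this
  · intro l _ hl
    have : ¬ (i : ℕ) = l := fun h => hl (Fin.ext h.symm)
    simp [this]
  · simp

theorem sum_mul_osc {ι : Type*} [Fintype ι] (x : ι → ℝ) (d : ℂ) (u : ι → ℂ) (a t : ℝ) :
    ∑ l, x l * osc (d * u l) a t = osc (d * ∑ l, (x l : ℂ) * u l) a t := by
  simp only [osc]
  rw [Finset.mul_sum, Finset.sum_mul, Complex.re_sum]
  refine Finset.sum_congr rfl fun l _ => ?_
  rw [← Complex.re_ofReal_mul]
  congr 1
  ring

namespace PowerSystem

variable {n : ℕ} {S : PowerSystem n}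

theorem iteratedDeriv_variation (j : Fin n) (i : ℕ) (t : ℝ) :
    iteratedDeriv i (S.variation j) t = S.q0 j * 0 ^ i + ∑ k, osc (-Complex.I * S.q j k *
      Complex.exp (S.ph j k * Complex.I) * (S.a j k * Complex.I) ^ i) (S.a j k) t := by
  induction i generalizing t with
  | zero =>
    simp only [iteratedDeriv_zero, variation, pow_zero, mul_one]
    congr 1
    refine Finset.sum_congr rfl fun k _ => ?_
    rw [osc, mul_assoc, ← Complex.exp_add, mul_assoc,
      show (S.ph j k : ℂ) * Complex.I + S.a j k * t * Complex.I =
        ((S.a j k * t + S.ph j k : ℝ) : ℂ) * Complex.I by push_cast; ring,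
      Complex.exp_mul_I, ← Complex.ofReal_cos, ← Complex.ofReal_sin]
    simp [-Complex.ofReal_cos, -Complex.ofReal_sin]
  | succ i ih =>
    rw [iteratedDeriv_succ, funext ih]
    refine HasDerivAt.deriv ?_
    refine ((HasDerivAt.fun_sum fun k _ => hasDerivAt_osc _ _ t).const_add _).congr_deriv ?_
    simp only [ne_eq, Nat.add_eq_zero_iff, one_ne_zero, and_false, not_false_eq_true, zero_pow,
      mul_zero, zero_add]
    exact Finset.sum_congr rfl fun k _ => by rw [pow_succ]; ring_nf

/-- The steady state `φ_j` is a sum of a constant and of all `s_j` oscillations. -/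
theorem varphi_eq (hS : S.WellPosed) (j : Fin n) : ∃ (c₀ : ℝ) (d : Fin (S.s j) → ℂ),
    (∀ k, d k ≠ 0) ∧ ∀ t i, S.varphi j t i =
      c₀ * 0 ^ (i : ℕ) + ∑ k, osc (d k * (S.a j k * Complex.I) ^ (i : ℕ)) (S.a j k) t := by
  set O := obsMatrix (S.s j) (S.r j) (S.alpha j) with hO
  have hdet : O.det ≠ 0 := det_obsMatrix_ne_zero (hS.r_hurwitz j) (hS.a_pos j) (hS.a_inj j)
  -- `g z` is the scalar by which `O` acts on the eigenvector at `z`. Since `λ_j` is a combination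
  -- of eigenvectors at `0` and `i a_k` (real parts), `O⁻¹` divides the amplitudes by `g 0`, which
  -- is real, and by `g (i a_k)`.
  let g : ℂ → ℂ := fun z => (1 + z) * rowPoly (S.r j) z
  have hg : ∀ x : ℝ, g (x * Complex.I) ≠ 0 := fun x =>
    rowPoly_factor_ne_zero (hS.r_hurwitz j) (by simp)
  let D : Fin (S.s j) → ℂ := fun k => -Complex.I * S.q j k * Complex.exp (S.ph j k * Complex.I)
  let c₀ : ℝ := S.q0 j / (g 0).re
  let d : Fin (S.s j) → ℂ := fun k => D k / g (S.a j k * Complex.I)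
  refine ⟨c₀, d, fun k => ?_, fun t => ?_⟩
  · have := hS.q_ne j k
    simp [d, D, hg, this]
  · suffices h : S.varphi j t = fun i : Fin (2 * S.s j + 1) => c₀ * 0 ^ (i : ℕ) +
        ∑ k, osc (d k * (S.a j k * Complex.I) ^ (i : ℕ)) (S.a j k) t from fun i => congrFun h i
    rw [varphi, ← hO]
    have hu : IsUnit O.det := isUnit_iff_ne_zero.2 hdet
    have h0 : ∀ x : Fin (2 * S.s j + 1), ∑ l, O x l * 0 ^ (l : ℕ) = (g 0).re * 0 ^ (x : ℕ) := by
      intro x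
      have := congrArg Complex.re (obsMatrix_eigen (isExoRoot_zero _ (S.alpha j)) (S.r j) x)
      rw [Complex.re_sum] at this
      simp only [Complex.re_ofReal_mul] at this
      have hz : ∀ l : ℕ, (0 : ℂ) ^ l = ((0 ^ l : ℝ) : ℂ) := fun l => by simp
      simp only [hz, Complex.ofReal_re, Complex.re_mul_ofReal] at this
      exact this
    have hg0 : (g 0).re ≠ 0 := by
      have h1 : g 0 = ((g 0).re : ℂ) := by
        have h2 := obsMatrix_eigen (isExoRoot_zero _ (S.alpha j)) (S.r j) 0
        simp only [Fin.val_zero, pow_zero, mul_one] at h2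
        have h3 : ∀ l : ℕ, (0 : ℂ) ^ l = ((0 ^ l : ℝ) : ℂ) := fun l => by simp
        simp only [h3, ← Complex.ofReal_mul, ← Complex.ofReal_sum] at h2
        change _ = g 0 at h2
        rw [← h2, Complex.ofReal_re]
      intro h
      have := hg 0
      rw [Complex.ofReal_zero, zero_mul, h1, h] at this
      exact this rfl
    have key : O.mulVec (fun i : Fin (2 * S.s j + 1) => c₀ * 0 ^ (i : ℕ) +
        ∑ k, osc (d k * (S.a j k * Complex.I) ^ (i : ℕ)) (S.a j k) t) = S.lam j t := by
      ext x
      simp only [Matrix.mulVec, dotProduct, mul_add, Finset.sum_add_distrib, lam,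
        iteratedDeriv_variation]
      congr 1
      · simp only [mul_left_comm _ c₀, ← Finset.mul_sum, h0]
        simp only [c₀]
        field_simp
      · simp only [Finset.mul_sum]
        rw [Finset.sum_comm]
        refine Finset.sum_congr rfl fun k _ => ?_
        have e : ∑ l, (O x l : ℂ) * (S.a j k * Complex.I) ^ (l : ℕ) =
            g (S.a j k * Complex.I) * (S.a j k * Complex.I) ^ (x : ℕ) :=
          obsMatrix_eigen (isExoRoot_of_sq (S.a j) k (by simp [mul_pow])) (S.r j) x
        rw [sum_mul_osc, e, ← mul_assoc, div_mul_cancel₀ _ (hg _)]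
    rw [← key, Matrix.mulVec_mulVec, Matrix.nonsing_inv_mul _ hu, Matrix.one_mulVec]

theorem continuous_varphi (hS : S.WellPosed) (j : Fin n) : Continuous (S.varphi j) := by
  obtain ⟨c₀, d, -, h⟩ := varphi_eq hS j
  refine continuous_pi fun i => ?_
  simp only [h]
  refine continuous_const.add (continuous_finsetSum _ fun k _ => ?_)
  exact continuous_iff_continuousAt.2 fun t => (hasDerivAt_osc _ _ t).continuousAt

/-- The regressor `Λ(φ_j)` is bounded with a bounded derivative. -/
theorem exists_hasDerivAt_Lam (hS : S.WellPosed) (j : Fin n) :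
    ∃ (w' : Fin (S.s j) → ℝ → ℝ) (C : ℝ), (∀ m, Continuous (w' m)) ∧
      (∀ m t, HasDerivAt (fun t => Lam (S.s j) (S.varphi j t) m) (w' m t) t) ∧
      (∀ m t, |Lam (S.s j) (S.varphi j t) m| ≤ C) ∧ ∀ m t, |w' m t| ≤ C := by
  obtain ⟨c₀, d, -, h⟩ := varphi_eq hS j
  have hw : ∀ m t, Lam (S.s j) (S.varphi j t) m =
      ∑ k, osc (d k * (S.a j k * Complex.I) ^ (2 * (m : ℕ) + 1)) (S.a j k) t := by
    intro m t
    rw [Lam, h]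
    simp
  let c : Fin (S.s j) → Fin (S.s j) → ℂ := fun m k =>
    d k * (S.a j k * Complex.I) ^ (2 * (m : ℕ) + 1)
  have hb : ∀ (c : Fin (S.s j) → Fin (S.s j) → ℂ) m t,
      |∑ k, osc (c m k) (S.a j k) t| ≤ ∑ m, ∑ k, ‖c m k‖ := by
    intro c m t
    refine (Finset.abs_sum_le_sum_abs _ _).trans
      ((Finset.sum_le_sum fun k _ => abs_osc_le (c m k) _ t).trans ?_)
    exact Finset.single_le_sum (f := fun m => ∑ k, ‖c m k‖) (fun i _ => by positivity)
      (Finset.mem_univ m)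
  let c' : Fin (S.s j) → Fin (S.s j) → ℂ := fun m k => c m k * (S.a j k * Complex.I)
  refine ⟨fun m t => ∑ k, osc (c' m k) (S.a j k) t,
    max (∑ m, ∑ k, ‖c m k‖) (∑ m, ∑ k, ‖c' m k‖), fun m => ?_, fun m t => ?_, fun m t => ?_,
    fun m t => (hb c' m t).trans (le_max_right _ _)⟩
  · refine continuous_finsetSum _ fun k _ => ?_
    exact continuous_iff_continuousAt.2 fun t => (hasDerivAt_osc _ _ t).continuousAt
  · simp only [hw]
    exact HasDerivAt.fun_sum fun k _ => hasDerivAt_osc _ _ t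
  · rw [hw]
    exact (hb c m t).trans (le_max_left _ _)

/-- `Λ` picks the entries with odd index counted from `0`. There the constant part of `φ_j` is
absent and `(i a)^{2m+1} = (-a²)^m (i a)`, which is the form required by `exists_excitation`. -/
theorem exists_excitation_Lam (hS : S.WellPosed) (j : Fin n) :
    ∃ (N : Fin (S.s j) → Fin (S.s j) → ℝ → ℝ) (Γ : Fin (S.s j) → Fin (S.s j) → ℝ) (κ C : ℝ),
      0 < κ ∧ (∀ m l t, HasDerivAt (N m l) (Lam (S.s j) (S.varphi j t) m *
        Lam (S.s j) (S.varphi j t) l - Γ m l) t) ∧ (∀ m l t, |N m l t| ≤ C) ∧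
      ∀ x : Fin (S.s j) → ℝ, κ * ∑ m, x m ^ 2 ≤ ∑ m, ∑ l, Γ m l * (x m * x l) := by
  obtain ⟨c₀, d, hd, h⟩ := varphi_eq hS j
  refine exists_excitation (fun k => d k * (S.a j k * Complex.I)) (fun k => ?_) (hS.a_pos j)
    (hS.a_inj j) (fun t => Lam (S.s j) (S.varphi j t)) fun t m => ?_
  · have := (hS.a_pos j k).ne'
    simp [hd k, this]
  · rw [Lam, h]
    simp only [ne_eq, Nat.add_eq_zero_iff, one_ne_zero, and_false, not_false_eq_true, zero_pow,
      mul_zero, zero_add]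
    refine Finset.sum_congr rfl fun k _ => ?_
    have e : d k * (S.a j k * Complex.I) ^ (2 * (m : ℕ) + 1) =
        (((-(S.a j k) ^ 2) ^ (m : ℕ) : ℝ) : ℂ) * (d k * (S.a j k * Complex.I)) := by
      rw [pow_succ, pow_mul, mul_pow, Complex.I_sq]
      push_cast
      ring
    rw [e, osc, osc, mul_assoc, Complex.re_ofReal_mul]

end PowerSystem
end FreqControl

/-! ### Strict Lyapunov functions for adaptive observers -/

namespace FreqControl

/-- The scalar estimate behind the strictification. -/
theorem excitation_algebra {κ D Cq Cm a M x : ℝ} (hκ : 0 < κ) (hD : 0 ≤ D) (hCq : 0 < Cq)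
    (hCm : 0 ≤ Cm) (hx : x ^ 2 ≤ Cq * (M ^ 2 + a ^ 2))
    (hax : a ^ 2 ≤ x ^ 2) (hMx : M ^ 2 ≤ Cm * x ^ 2) :
    -κ * a ^ 2 + D * (M * a + M ^ 2 * (1 + M) + a ^ 2 * M + a * M * (1 + M)) ≤
      -(κ / (2 * Cq)) * x ^ 2 + (κ / 2 + 3 * D + 4 * D ^ 2 / κ + (D ^ 2 / κ + 2 * D) * (1 + Cm)) *
        (M ^ 2 + M ^ 2 * x ^ 2) := by
  -- The two terms containing `a` with a single factor `M` are split by Young's inequality, each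
  -- using a quarter of `κ a²`. The remaining half is turned into decrease in `x²`.
  have e1 : D * (2 * (M * a)) ≤ κ / 4 * a ^ 2 + 4 * D ^ 2 / κ * M ^ 2 := by
    have : 0 ≤ κ⁻¹ * (κ / 2 * a - 2 * D * M) ^ 2 := by positivity
    have e : κ⁻¹ * (κ / 2 * a - 2 * D * M) ^ 2 =
        κ / 4 * a ^ 2 + 4 * D ^ 2 / κ * M ^ 2 - D * (2 * (M * a)) := by field_simp; ring
    linarith
  have e2 : D * (a ^ 2 * M) ≤ κ / 4 * a ^ 2 + D ^ 2 / κ * (a ^ 2 * M ^ 2) := by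
    have : 0 ≤ κ⁻¹ * a ^ 2 * (κ / 2 - D * M) ^ 2 := by positivity
    have e : κ⁻¹ * a ^ 2 * (κ / 2 - D * M) ^ 2 =
        κ / 4 * a ^ 2 + D ^ 2 / κ * (a ^ 2 * M ^ 2) - D * (a ^ 2 * M) := by field_simp; ring
    linarith
  have e3 : D * (M ^ 2 * M) ≤ D * (M ^ 2 + M ^ 2 * M ^ 2) := by
    refine mul_le_mul_of_nonneg_left ?_ hD
    nlinarith [mul_nonneg (sq_nonneg M) (sq_nonneg (M - 1)),
      mul_nonneg (sq_nonneg M) (sq_nonneg M), sq_nonneg M]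
  have e4 : D * (a * M * M) ≤ D * (M ^ 2 + a ^ 2 * M ^ 2) := by
    refine mul_le_mul_of_nonneg_left ?_ hD
    nlinarith [mul_nonneg (sq_nonneg M) (sq_nonneg (a - 1)),
      mul_nonneg (sq_nonneg M) (sq_nonneg a), sq_nonneg M]
  have e5 : κ / (2 * Cq) * x ^ 2 ≤ κ / 2 * (M ^ 2 + a ^ 2) := by
    have := mul_le_mul_of_nonneg_left hx (show 0 ≤ κ / (2 * Cq) by positivity)
    have e : κ / (2 * Cq) * (Cq * (M ^ 2 + a ^ 2)) = κ / 2 * (M ^ 2 + a ^ 2) := by field_simp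
    linarith
  have e6 : a ^ 2 * M ^ 2 ≤ M ^ 2 * x ^ 2 := by nlinarith [sq_nonneg M]
  have e7 : M ^ 2 * M ^ 2 ≤ Cm * (M ^ 2 * x ^ 2) := by nlinarith [sq_nonneg M]
  have e8 : 0 ≤ M ^ 2 * x ^ 2 := by positivity
  have e9 : D ^ 2 / κ * (a ^ 2 * M ^ 2) ≤ D ^ 2 / κ * (M ^ 2 * x ^ 2) :=
    mul_le_mul_of_nonneg_left e6 (by positivity)
  have e10 : D * (a ^ 2 * M ^ 2) ≤ D * (M ^ 2 * x ^ 2) := mul_le_mul_of_nonneg_left e6 hD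
  have e11 : D * (M ^ 2 * M ^ 2) ≤ D * (Cm * (M ^ 2 * x ^ 2)) := mul_le_mul_of_nonneg_left e7 hD
  have f1 : 0 ≤ D ^ 2 / κ := by positivity
  have f2 : 0 ≤ D ^ 2 / κ * Cm * (M ^ 2 * x ^ 2) := by positivity
  have f3 : 0 ≤ D * Cm * (M ^ 2 * x ^ 2) := by positivity
  have f4 : 0 ≤ κ * (M ^ 2 * x ^ 2) := by positivity
  have f5 : 0 ≤ D * (M ^ 2 * x ^ 2) := by positivity
  have f6 : 4 * D ^ 2 / κ = 4 * (D ^ 2 / κ) := by ring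
  have f7 : 0 ≤ D ^ 2 / κ * (M ^ 2 * x ^ 2) := by positivity
  have f8 : 0 ≤ D ^ 2 / κ * (1 + Cm) * M ^ 2 := by positivity
  have f9 : 0 ≤ D * (1 + Cm) * M ^ 2 := by positivity
  have f10 : 0 ≤ D * M ^ 2 := by positivity
  rw [f6] at e1 ⊢
  linarith

section Adaptive

variable {E V : Type*} [NormedAddCommGroup E] [NormedSpace ℝ E]
  [NormedAddCommGroup V] [NormedSpace ℝ V] {s : ℕ}

/-- The time-invariant part of the Lyapunov function of an adaptive observer. -/
theorem exists_semidefinite_form (y η : E →L[ℝ] ℝ) (ξ : E →L[ℝ] V) (α : Fin s → E →L[ℝ] ℝ)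
    (P : V →L[ℝ] V →L[ℝ] ℝ) {γ k Cl Cp Cq : ℝ} (hγ : 0 < γ) (hk : 0 < k)
    (hCq : 0 < Cq) (hP : ∀ v, ‖v‖ ^ 2 ≤ P v v)
    (hq : ∀ ν, ‖ν‖ ^ 2 ≤ Cq * (y ν ^ 2 + ‖ξ ν‖ ^ 2 + η ν ^ 2 + ∑ m, α m ν ^ 2)) :
    ∃ (B : E →L[ℝ] E →L[ℝ] ℝ) (v c : ℝ), 0 < v ∧ 0 < c ∧ (∀ ν, v * ‖ν‖ ^ 2 ≤ B ν ν) ∧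
      ∀ ν h (l : ℝ) (Λ : Fin s → ℝ), η h = -η ν → y h = l - γ * y ν + ∑ m, α m ν * Λ m →
        (∀ m, α m h = -k * y ν * Λ m) →
        P (ξ ν) (ξ h) + P (ξ h) (ξ ν) ≤ -‖ξ ν‖ ^ 2 + Cp * |η ν| * ‖ξ ν‖ →
        |l| ≤ Cl * (‖ξ ν‖ + |η ν|) →
        B ν h + B h ν ≤ -c * (y ν ^ 2 + ‖ξ ν‖ ^ 2 + η ν ^ 2) := by
  -- `K₁` lets half of the dissipation in `ξ` exceed by `‖ξ‖²` the share `Cl²/γ` of the cross term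
  -- `y l`. `K₂` then does the same in `η`, including the cross term between `η` and `ξ`, already
  -- weighted with `K₁`.
  obtain ⟨K₁, hK₁⟩ : ∃ K₁ : ℝ, K₁ = 2 * (Cl ^ 2 / γ + 1) := ⟨_, rfl⟩
  obtain ⟨K₂, hK₂⟩ : ∃ K₂ : ℝ, K₂ = (Cl ^ 2 / γ + K₁ * Cp ^ 2 / 2 + 1) / 2 := ⟨_, rfl⟩
  have hK₁p : 0 < K₁ := by rw [hK₁]; positivity
  have hK₂p : 0 < K₂ := by rw [hK₂]; positivity
  let B : E →L[ℝ] E →L[ℝ] ℝ := (1 / 2 : ℝ) • y.smulRight y +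
    (1 / (2 * k)) • (∑ m, (α m).smulRight (α m)) + K₁ • P.bilinearComp ξ ξ + K₂ • η.smulRight η
  have hB : ∀ ν h, B ν h = 1 / 2 * (y ν * y h) + 1 / (2 * k) * (∑ m, α m ν * α m h) +
      K₁ * P (ξ ν) (ξ h) + K₂ * (η ν * η h) := by
    intro ν h
    simp [B, sum_apply]
  let v₀ := min (min (1 / 2) (1 / (2 * k))) (min K₁ K₂)
  have hv₀ : 0 < v₀ := by simp only [v₀]; positivity
  have hv1 : v₀ ≤ 1 / 2 := (min_le_left _ _).trans (min_le_left _ _)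
  have hv2 : v₀ ≤ 1 / (2 * k) := (min_le_left _ _).trans (min_le_right _ _)
  have hv3 : v₀ ≤ K₁ := (min_le_right _ _).trans (min_le_left _ _)
  have hv4 : v₀ ≤ K₂ := (min_le_right _ _).trans (min_le_right _ _)
  refine ⟨B, v₀ / Cq, min (γ / 2) 1, by positivity, by positivity, fun ν => ?_, ?_⟩
  · have h1 := mul_le_mul_of_nonneg_left (hq ν) (show 0 ≤ v₀ / Cq by positivity)
    rw [← mul_assoc, div_mul_cancel₀ _ hCq.ne'] at h1
    refine h1.trans ?_
    rw [hB]
    simp only [← sq]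
    have e1 := mul_le_mul_of_nonneg_right hv1 (sq_nonneg (y ν))
    have e2 := mul_le_mul_of_nonneg_right hv2
      (show 0 ≤ ∑ m, α m ν ^ 2 from Finset.sum_nonneg fun _ _ => sq_nonneg _)
    have e3 := mul_le_mul_of_nonneg_right hv3 (sq_nonneg ‖ξ ν‖)
    have e4 := mul_le_mul_of_nonneg_right hv4 (sq_nonneg (η ν))
    have e5 := mul_le_mul_of_nonneg_left (hP (ξ ν)) hK₁p.le
    linarith
  · intro ν h l Λ hη hy hα hPd hl
    rw [hB, hB, hη, hy]
    simp only [hα]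
    have e1 : ∑ m, α m ν * (-k * y ν * Λ m) = -k * y ν * ∑ m, α m ν * Λ m := by
      rw [Finset.mul_sum]; exact Finset.sum_congr rfl fun m _ => by ring
    have e2 : ∑ m, -k * y ν * Λ m * α m ν = -k * y ν * ∑ m, α m ν * Λ m := by
      rw [Finset.mul_sum]; exact Finset.sum_congr rfl fun m _ => by ring
    rw [e1, e2]
    -- The adaptation law is chosen so that `y W`, coming from `y`, is cancelled by the derivative
    -- of `|α|² / (2k)`.
    set W := ∑ m, α m ν * Λ m
    have e3 : 1 / (2 * k) * (-k * y ν * W) = -(1 / 2) * (y ν * W) := by field_simp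
    rw [e3]
    have e4 := mul_le_mul_of_nonneg_left hPd hK₁p.le
    have e5 : y ν * l ≤ |y ν| * (Cl * (‖ξ ν‖ + |η ν|)) := by
      refine (le_abs_self _).trans ?_
      rw [abs_mul]
      exact mul_le_mul_of_nonneg_left hl (abs_nonneg _)
    have hyy : |y ν| ^ 2 = y ν ^ 2 := sq_abs _
    have hηη : |η ν| ^ 2 = η ν ^ 2 := sq_abs _
    have yo : ∀ x, Cl * (|y ν| * x) ≤ γ / 4 * y ν ^ 2 + Cl ^ 2 / γ * x ^ 2 := by
      intro x
      have : 0 ≤ γ⁻¹ * (γ / 2 * |y ν| - Cl * x) ^ 2 := by positivity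
      have e : γ⁻¹ * (γ / 2 * |y ν| - Cl * x) ^ 2 =
        γ / 4 * |y ν| ^ 2 + Cl ^ 2 / γ * x ^ 2 - Cl * (|y ν| * x) := by field_simp; ring
      rw [hyy] at e
      linarith
    have e6 := yo ‖ξ ν‖
    have e7 := yo |η ν|
    have e8 : K₁ * (Cp * |η ν| * ‖ξ ν‖) ≤ K₁ / 2 * ‖ξ ν‖ ^ 2 + K₁ * Cp ^ 2 / 2 * η ν ^ 2 := by
      have : 0 ≤ K₁ / 2 * (‖ξ ν‖ - Cp * |η ν|) ^ 2 := by positivity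
      have e : K₁ / 2 * (‖ξ ν‖ - Cp * |η ν|) ^ 2 = K₁ / 2 * ‖ξ ν‖ ^ 2 +
        K₁ * Cp ^ 2 / 2 * |η ν| ^ 2 - K₁ * (Cp * |η ν| * ‖ξ ν‖) := by ring
      rw [hηη] at e
      linarith
    have e9 : K₁ / 2 * ‖ξ ν‖ ^ 2 = (Cl ^ 2 / γ + 1) * ‖ξ ν‖ ^ 2 := by rw [hK₁]; ring
    have e10 : 2 * K₂ * η ν ^ 2 = (Cl ^ 2 / γ + K₁ * Cp ^ 2 / 2 + 1) * η ν ^ 2 := by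
      rw [hK₂]; ring
    rw [hηη] at e7
    have g1 := mul_le_mul_of_nonneg_right (min_le_left (γ / 2) 1) (sq_nonneg (y ν))
    have g2 := mul_le_mul_of_nonneg_right (min_le_right (γ / 2) 1) (sq_nonneg ‖ξ ν‖)
    have g3 := mul_le_mul_of_nonneg_right (min_le_right (γ / 2) 1) (sq_nonneg (η ν))
    linarith

theorem timeVarying_comb_regularity {F : Type*} [NormedAddCommGroup F] [NormedSpace ℝ F]
    (A : Fin s → Fin s → F) (D : Fin s → F)
    {w w' : Fin s → ℝ → ℝ} {N : Fin s → Fin s → ℝ → ℝ} {Γ : Fin s → Fin s → ℝ} {C : ℝ}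
    (hw : ∀ m t, HasDerivAt (w m) (w' m t) t) (hw' : ∀ m, Continuous (w' m))
    (hwC : ∀ m t, |w m t| ≤ C)
    (hN : ∀ m l t, HasDerivAt (N m l) (w m t * w l t - Γ m l) t) (hNC : ∀ m l t, |N m l t| ≤ C) :
    (∀ t, HasDerivAt (fun t => ∑ m, ∑ l, N m l t • A m l - ∑ m, w m t • D m)
      (∑ m, ∑ l, (w m t * w l t - Γ m l) • A m l - ∑ m, w' m t • D m) t) ∧
    Continuous (fun t => ∑ m, ∑ l, (w m t * w l t - Γ m l) • A m l - ∑ m, w' m t • D m) ∧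
    ∀ t, ‖∑ m, ∑ l, N m l t • A m l - ∑ m, w m t • D m‖ ≤
      ∑ m, ∑ l, C * ‖A m l‖ + ∑ m, C * ‖D m‖ := by
  refine ⟨fun t => ?_, ?_, fun t => ?_⟩
  · refine HasDerivAt.sub ?_ ?_
    · exact HasDerivAt.fun_sum fun m _ => HasDerivAt.fun_sum fun l _ =>
        (hN m l t).smul_const _
    · exact HasDerivAt.fun_sum fun m _ => (hw m t).smul_const _
  · have hwc : ∀ m, Continuous (w m) := fun m =>
      continuous_iff_continuousAt.2 fun t => (hw m t).continuousAt
    refine Continuous.sub ?_ ?_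
    · exact continuous_finsetSum _ fun m _ => continuous_finsetSum _ fun l _ =>
        (((hwc m).mul (hwc l)).sub continuous_const).smul continuous_const
    · exact continuous_finsetSum _ fun m _ => (hw' m).smul continuous_const
  · refine (norm_sub_le _ _).trans (add_le_add ?_ ?_)
    · refine (norm_sum_le _ _).trans (Finset.sum_le_sum fun m _ => ?_)
      refine (norm_sum_le _ _).trans (Finset.sum_le_sum fun l _ => ?_)
      rw [norm_smul]
      exact mul_le_mul_of_nonneg_right (hNC m l t) (norm_nonneg _)
    · refine (norm_sum_le _ _).trans (Finset.sum_le_sum fun m _ => ?_)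
      rw [norm_smul]
      exact mul_le_mul_of_nonneg_right (hwC m t) (norm_nonneg _)

/-- The excitation term of the Lyapunov function of an adaptive observer. -/
theorem exists_excitation_form (y : E →L[ℝ] ℝ) (α : Fin s → E →L[ℝ] ℝ)
    (w w' : Fin s → ℝ → ℝ) (N : Fin s → Fin s → ℝ → ℝ) (Γ : Fin s → Fin s → ℝ) {C : ℝ}
    (hw : ∀ m t, HasDerivAt (w m) (w' m t) t) (hw' : ∀ m, Continuous (w' m))
    (hwC : ∀ m t, |w m t| ≤ C)
    (hN : ∀ m l t, HasDerivAt (N m l) (w m t * w l t - Γ m l) t) (hNC : ∀ m l t, |N m l t| ≤ C) :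
    ∃ (B B' : ℝ → E →L[ℝ] E →L[ℝ] ℝ) (C' : ℝ), (∀ t, HasDerivAt B (B' t) t) ∧ Continuous B' ∧
      (∀ t, ‖B t‖ ≤ C') ∧
      (∀ t ν h, B t ν h = ∑ m, ∑ l, N m l t * (α m ν * α l h) - ∑ m, w m t * (y ν * α m h)) ∧
      ∀ t ν h, B' t ν h = ∑ m, ∑ l, (w m t * w l t - Γ m l) * (α m ν * α l h) -
        ∑ m, w' m t * (y ν * α m h) := by
  obtain ⟨h1, h2, h3⟩ := timeVarying_comb_regularity (fun m l => (α m).smulRight (α l))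
    (fun m => y.smulRight (α m)) hw hw' hwC hN hNC
  refine ⟨_, _, _, h1, h2, h3, fun t ν h => ?_, fun t ν h => ?_⟩
  · simp [sum_apply]
  · simp [sum_apply]

theorem abs_sum_le_card_mul {x : Fin s → ℝ} {c : ℝ} (hx : ∀ m, |x m| ≤ c) :
    |∑ m, x m| ≤ s * c := by
  refine (Finset.abs_sum_le_sum_abs _ _).trans ((Finset.sum_le_sum fun m _ => hx m).trans ?_)
  simp

/-- Decrease contributed by the excitation term. -/
theorem excitation_decrease {y a M C k γ Cl κ l : ℝ} {α Λ w w' : Fin s → ℝ}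
    {N Γ : Fin s → Fin s → ℝ} (hk : 0 < k) (hγ : 0 < γ) (hC : 0 ≤ C) (hCl : 0 ≤ Cl) (ha : 0 ≤ a)
    (hM : 0 ≤ M) (hy : |y| ≤ M) (hα : ∀ m, |α m| ≤ a) (hw : ∀ m, |w m| ≤ C)
    (hw' : ∀ m, |w' m| ≤ C) (hN : ∀ m l, |N m l| ≤ C) (hΛ : ∀ m, |Λ m - w m| ≤ M)
    (hl : |l| ≤ Cl * M) (hΓ : κ * a ^ 2 ≤ ∑ m, ∑ l, Γ m l * (α m * α l)) :
    (∑ m, ∑ l, (w m * w l - Γ m l) * (α m * α l) - ∑ m, w' m * (y * α m)) +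
      ((∑ m, ∑ l, N m l * (α m * (-k * y * Λ l)) - ∑ m, w m * (y * (-k * y * Λ m))) +
      (∑ m, ∑ l, N m l * ((-k * y * Λ m) * α l) -
        ∑ m, w m * ((l - γ * y + ∑ m, α m * Λ m) * α m))) ≤
    -κ * a ^ 2 + (s * C + k * s * C + k * s * C * C + (Cl + γ) * s * C + s * s * C +
        2 * k * s * s * C + 2 * k * s * s * C * C) *
      (M * a + M ^ 2 * (1 + M) + a ^ 2 * M + a * M * (1 + M)) := by
  set W := ∑ m, w m * α m with hW
  have hΛb : ∀ m, |Λ m| ≤ M + C := fun m => by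
    have := abs_add_le (Λ m - w m) (w m)
    rw [sub_add_cancel] at this
    linarith [hΛ m, hw m]
  have hMC : 0 ≤ M + C := by positivity
  have i1 : ∑ m, ∑ l, (w m * w l - Γ m l) * (α m * α l) =
      W * W - ∑ m, ∑ l, Γ m l * (α m * α l) := by
    rw [hW, Finset.sum_mul_sum, ← Finset.sum_sub_distrib]
    refine Finset.sum_congr rfl fun m _ => ?_
    rw [← Finset.sum_sub_distrib]
    exact Finset.sum_congr rfl fun l _ => by ring
  -- The derivative of `-y (w · α)` contains `-W²`, which cancels the `W²` from the derivative of
  -- `N`. What remains of the main term is `-αᵀ Γ α`; every error has a factor `M`, since `y`, `l`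
  -- and `Λ - w` are of order `M`.
  have i2 : ∑ m, w m * ((l - γ * y + ∑ m, α m * Λ m) * α m) =
      (l - γ * y) * W + W * W + (∑ m, α m * (Λ m - w m)) * W := by
    have e : ∑ m, α m * (Λ m - w m) = ∑ m, α m * Λ m - W := by
      rw [hW, ← Finset.sum_sub_distrib]
      exact Finset.sum_congr rfl fun m _ => by ring
    have e' : ∑ m, w m * ((l - γ * y + ∑ m, α m * Λ m) * α m) =
        (l - γ * y + ∑ m, α m * Λ m) * W := by
      rw [hW, Finset.mul_sum]
      exact Finset.sum_congr rfl fun m _ => by ring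
    rw [e, e']
    ring
  have b1 : |∑ m, w' m * (y * α m)| ≤ s * (C * (M * a)) := by
    refine abs_sum_le_card_mul fun m => ?_
    rw [abs_mul, abs_mul]
    exact mul_le_mul (hw' m) (mul_le_mul hy (hα m) (abs_nonneg _) hM) (by positivity) hC
  have b0 : ∀ m, |(-k * y * Λ m)| ≤ k * M * (M + C) := by
    intro m
    rw [abs_mul, abs_mul, abs_neg, abs_of_pos hk]
    exact mul_le_mul (mul_le_mul_of_nonneg_left hy hk.le) (hΛb m) (abs_nonneg _) (by positivity)
  have b2 : |∑ m, w m * (y * (-k * y * Λ m))| ≤ s * (C * (M * (k * M * (M + C)))) := by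
    refine abs_sum_le_card_mul fun m => ?_
    rw [abs_mul, abs_mul]
    exact mul_le_mul (hw m) (mul_le_mul hy (b0 m) (abs_nonneg _) hM) (by positivity) hC
  have b3 : |∑ m, ∑ l, N m l * (α m * (-k * y * Λ l))| ≤
      s * (s * (C * (a * (k * M * (M + C))))) := by
    refine abs_sum_le_card_mul fun m => abs_sum_le_card_mul fun l => ?_
    rw [abs_mul, abs_mul]
    exact mul_le_mul (hN m l) (mul_le_mul (hα m) (b0 l) (abs_nonneg _) ha) (by positivity) hC
  have b4 : |∑ m, ∑ l, N m l * ((-k * y * Λ m) * α l)| ≤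
      s * (s * (C * (k * M * (M + C) * a))) := by
    refine abs_sum_le_card_mul fun m => abs_sum_le_card_mul fun l => ?_
    rw [abs_mul, abs_mul]
    exact mul_le_mul (hN m l) (mul_le_mul (b0 m) (hα l) (abs_nonneg _) (by positivity))
      (by positivity) hC
  have bW : |W| ≤ s * (C * a) := by
    refine abs_sum_le_card_mul fun m => ?_
    rw [abs_mul]
    exact mul_le_mul (hw m) (hα m) (abs_nonneg _) hC
  have b5 : |(l - γ * y) * W| ≤ (Cl + γ) * M * (s * (C * a)) := by
    rw [abs_mul]
    refine mul_le_mul ?_ bW (abs_nonneg _) (by positivity)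
    have := abs_sub l (γ * y)
    rw [abs_mul, abs_of_pos hγ] at this
    have := mul_le_mul_of_nonneg_left hy hγ.le
    linarith
  have b6 : |(∑ m, α m * (Λ m - w m)) * W| ≤ s * (a * M) * (s * (C * a)) := by
    rw [abs_mul]
    refine mul_le_mul ?_ bW (abs_nonneg _) (by positivity)
    refine abs_sum_le_card_mul fun m => ?_
    rw [abs_mul]
    exact mul_le_mul (hα m) (hΛ m) (abs_nonneg _) ha
  rw [i1, i2]
  have c1 := (abs_le.1 b1).1
  have c2 := (abs_le.1 b2).1
  have c3 := (abs_le.1 b3).2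
  have c4 := (abs_le.1 b4).2
  have c5 := (abs_le.1 b5).1
  have c6 := (abs_le.1 b6).1
  have key : s * (C * (M * a)) + s * (C * (M * (k * M * (M + C)))) +
      s * (s * (C * (a * (k * M * (M + C))))) + s * (s * (C * (k * M * (M + C) * a))) +
      (Cl + γ) * M * (s * (C * a)) + s * (a * M) * (s * (C * a)) ≤
      (s * C + k * s * C + k * s * C * C + (Cl + γ) * s * C + s * s * C +
        2 * k * s * s * C + 2 * k * s * s * C * C) *
      (M * a + M ^ 2 * (1 + M) + a ^ 2 * M + a * M * (1 + M)) := by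
    -- The difference of the two sides expands into monomials with nonnegative coefficients.
    rw [← sub_nonneg]
    ring_nf
    positivity
  linarith

/-- A strict Lyapunov function for an adaptive observer with an exciting regressor. -/
theorem hasStrictLyapunov_adaptive [FiniteDimensional ℝ E] (f : ℝ → E → E) (y η : E →L[ℝ] ℝ)
    (ξ : E →L[ℝ] V) (α : Fin s → E →L[ℝ] ℝ) (P : V →L[ℝ] V →L[ℝ] ℝ) (ℓ : E → ℝ)
    (Λ : ℝ → E → Fin s → ℝ) (w w' : Fin s → ℝ → ℝ) (N : Fin s → Fin s → ℝ → ℝ)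
    (Γ : Fin s → Fin s → ℝ) {γ k κ C Cl Cp Cq : ℝ} (hγ : 0 < γ) (hk : 0 < k) (hκ : 0 < κ)
    (hC : 0 ≤ C) (hCl : 0 ≤ Cl) (hCq : 0 < Cq)
    (hη : ∀ t ν, η (f t ν) = -η ν)
    (hy : ∀ t ν, y (f t ν) = ℓ ν - γ * y ν + ∑ m, α m ν * Λ t ν m)
    (hα : ∀ t ν m, α m (f t ν) = -k * y ν * Λ t ν m) (hP : ∀ v, ‖v‖ ^ 2 ≤ P v v)
    (hPd : ∀ t ν, P (ξ ν) (ξ (f t ν)) + P (ξ (f t ν)) (ξ ν) ≤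
      -‖ξ ν‖ ^ 2 + Cp * |η ν| * ‖ξ ν‖)
    (hℓ : ∀ ν, |ℓ ν| ≤ Cl * (‖ξ ν‖ + |η ν|)) (hΛ : ∀ t ν m, |Λ t ν m - w m t| ≤ ‖ξ ν‖)
    (hw : ∀ m t, HasDerivAt (w m) (w' m t) t) (hw' : ∀ m, Continuous (w' m))
    (hwC : ∀ m t, |w m t| ≤ C) (hwC' : ∀ m t, |w' m t| ≤ C)
    (hN : ∀ m l t, HasDerivAt (N m l) (w m t * w l t - Γ m l) t) (hNC : ∀ m l t, |N m l t| ≤ C)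
    (hΓ : ∀ x : Fin s → ℝ, κ * ∑ m, x m ^ 2 ≤ ∑ m, ∑ l, Γ m l * (x m * x l))
    (hq : ∀ ν, ‖ν‖ ^ 2 ≤ Cq * (y ν ^ 2 + ‖ξ ν‖ ^ 2 + η ν ^ 2 + ∑ m, α m ν ^ 2))
    (hαν : ∀ ν, ∑ m, α m ν ^ 2 ≤ ‖ν‖ ^ 2) : HasStrictLyapunov f := by
  obtain ⟨B₀, v, c, hv, hc, hB₀, hB₀d⟩ :=
    exists_semidefinite_form (Cl := Cl) (Cp := Cp) y η ξ α P hγ hk hCq hP hq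
  obtain ⟨B, B', C', hB, hB'c, hBC, hBe, hBe'⟩ :=
    exists_excitation_form y α w w' N Γ hw hw' hwC hN hNC
  have hm0 : ∀ ν, 0 ≤ y ν ^ 2 + ‖ξ ν‖ ^ 2 + η ν ^ 2 := fun ν => by positivity
  have ha0 : ∀ ν, 0 ≤ ∑ m, α m ν ^ 2 := fun ν => Finset.sum_nonneg fun _ _ => sq_nonneg _
  -- Here `m` is the norm of `(y, ξ, η)`, the part in which `B₀` decreases, and `C₁` is the constant
  -- of `excitation_algebra` for the error factor of `excitation_decrease`. The factor in front of
  -- `Cl` is `2` because `‖ξ ν‖ + |η ν| ≤ 2 m`.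
  refine exists_strict_lyapunov f B₀ B B' (fun ν => √(y ν ^ 2 + ‖ξ ν‖ ^ 2 + η ν ^ 2)) hv hc
    (show 0 < κ / (2 * Cq) by positivity) hB₀ (fun t ν => ?_) hB hB'c hBC
    (C₁ := κ / 2 + 3 * (s * C + k * s * C + k * s * C * C + (2 * Cl + γ) * s * C + s * s * C +
        2 * k * s * s * C + 2 * k * s * s * C * C) + 4 * (s * C + k * s * C + k * s * C * C +
        (2 * Cl + γ) * s * C + s * s * C + 2 * k * s * s * C + 2 * k * s * s * C * C) ^ 2 / κ +
        ((s * C + k * s * C + k * s * C * C + (2 * Cl + γ) * s * C + s * s * C +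
        2 * k * s * s * C + 2 * k * s * s * C * C) ^ 2 / κ + 2 * (s * C + k * s * C +
        k * s * C * C + (2 * Cl + γ) * s * C + s * s * C + 2 * k * s * s * C +
        2 * k * s * s * C * C)) * (1 + (‖y‖ ^ 2 + ‖ξ‖ ^ 2 + ‖η‖ ^ 2))) (fun t ν => ?_)
  · rw [Real.sq_sqrt (hm0 ν)]
    exact hB₀d ν _ _ _ (hη t ν) (hy t ν) (hα t ν) (hPd t ν) (hℓ ν)
  · set M := √(y ν ^ 2 + ‖ξ ν‖ ^ 2 + η ν ^ 2) with hM
    have hMsq : M ^ 2 = y ν ^ 2 + ‖ξ ν‖ ^ 2 + η ν ^ 2 := Real.sq_sqrt (hm0 ν)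
    have hM0 : 0 ≤ M := Real.sqrt_nonneg _
    have hasq : √(∑ m, α m ν ^ 2) ^ 2 = ∑ m, α m ν ^ 2 := Real.sq_sqrt (ha0 ν)
    have hyM : |y ν| ≤ M := abs_le_of_sq_le_sq
      (by nlinarith [sq_nonneg (η ν), sq_nonneg ‖ξ ν‖]) hM0
    have hηM : |η ν| ≤ M := abs_le_of_sq_le_sq
      (by nlinarith [sq_nonneg (y ν), sq_nonneg ‖ξ ν‖]) hM0
    have hξM : ‖ξ ν‖ ≤ M := (pow_le_pow_iff_left₀ (norm_nonneg _) hM0 two_ne_zero).1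
      (by nlinarith [sq_nonneg (y ν), sq_nonneg (η ν)])
    have hop : ∀ g : E →L[ℝ] ℝ, g ν ^ 2 ≤ ‖g‖ ^ 2 * ‖ν‖ ^ 2 := by
      intro g
      rw [← mul_pow, ← sq_abs]
      exact pow_le_pow_left₀ (abs_nonneg _) (g.le_opNorm ν) 2
    have hopξ : ‖ξ ν‖ ^ 2 ≤ ‖ξ‖ ^ 2 * ‖ν‖ ^ 2 := by
      rw [← mul_pow]
      exact pow_le_pow_left₀ (norm_nonneg _) (ξ.le_opNorm ν) 2
    rw [hBe, hBe, hBe', hy t ν]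
    simp only [hα t ν]
    refine (excitation_decrease (Cl := 2 * Cl) (κ := κ) hk hγ hC (by positivity)
      (Real.sqrt_nonneg (∑ m, α m ν ^ 2)) hM0 hyM (fun m => ?_) (fun m => hwC m t)
      (fun m => hwC' m t) (fun m l => hNC m l t) (fun m => (hΛ t ν m).trans hξM) ?_ ?_).trans ?_
    · rw [← Real.sqrt_sq_eq_abs]
      exact Real.sqrt_le_sqrt (Finset.single_le_sum (f := fun m => α m ν ^ 2)
        (fun i _ => sq_nonneg _) (Finset.mem_univ m))
    · refine (hℓ ν).trans ?_
      nlinarith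
    · rw [hasq]
      exact hΓ fun m => α m ν
    · refine excitation_algebra hκ (by positivity) hCq (by positivity) ?_ ?_ ?_
      · rw [hasq, hMsq]; exact hq ν
      · rw [hasq]; exact hαν ν
      · rw [hMsq]; linarith [hop y, hop η]

end Adaptive

end FreqControl

/-! ### The `ν_j`-subsystem as an adaptive observer -/

namespace FreqControl

theorem exoMatrix_mulVec_castSucc {s : ℕ} (α : Fin s → ℝ) (x : Fin (2 * s + 1) → ℝ)
    (k : Fin (2 * s)) : (exoMatrix s α).mulVec x k.castSucc = x k.succ := by
  have hk : ¬ (k.castSucc : ℕ) = 2 * s := by have := k.2; simp; omega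
  rw [Matrix.mulVec, dotProduct, Finset.sum_eq_single k.succ]
  · rw [exoMatrix, Matrix.of_apply, if_neg hk, if_pos (by simp), one_mul]
  · intro l _ hl
    have : ¬ (l : ℕ) = k.castSucc + 1 := fun h => hl (Fin.ext (by simpa using h))
    rw [exoMatrix, Matrix.of_apply, if_neg hk, if_neg this, zero_mul]
  · simp

theorem exoMatrix_mulVec_last {s : ℕ} (α : Fin s → ℝ) (x : Fin (2 * s + 1) → ℝ) :
    (exoMatrix s α).mulVec x (Fin.last _) = ∑ m, α m * Lam s x m := by
  have h1 : ∀ l : Fin (2 * s + 1), exoMatrix s α (Fin.last _) l * x l =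
      ∑ m : Fin s, if l = (⟨2 * (m : ℕ) + 1, by omega⟩ : Fin (2 * s + 1)) then α m * x l else 0 := by
    intro l
    simp only [exoMatrix, Matrix.of_apply, Fin.val_last, if_true, Finset.sum_mul]
    refine Finset.sum_congr rfl fun m _ => ?_
    simp only [Fin.ext_iff]
    split_ifs <;> simp
  simp only [Matrix.mulVec, dotProduct, h1]
  rw [Finset.sum_comm]
  simp only [Finset.sum_ite_eq', Finset.mem_univ, if_true]
  rfl

theorem rowR_dotProduct {s : ℕ} (r : Fin (2 * s) → ℝ) (x : Fin (2 * s + 1) → ℝ) :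
    rowR s r ⬝ᵥ x = ∑ k, r k * x k.castSucc + x (Fin.last _) := by
  rw [dotProduct, Fin.sum_univ_castSucc]
  simp [rowR]

theorem Lam_add (s : ℕ) (x x' : Fin (2 * s + 1) → ℝ) (m : Fin s) :
    Lam s (x + x') m = Lam s x m + Lam s x' m := rfl

namespace PowerSystem

variable {n : ℕ} {S : PowerSystem n}

/-- `R` ends in `1`, so in the row where `G` equals `1` the last entry of `ζ̃` cancels. The first
`2s` entries form the companion system of the Hurwitz polynomial, driven by `η` alone and free of
`t` and `α`. -/
theorem zetaField_castSucc (j : Fin n) (t η : ℝ) (ζ : Fin (2 * S.s j + 1) → ℝ)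
    (α : Fin (S.s j) → ℝ) (k : Fin (2 * S.s j)) :
    S.zetaField j t η ζ α k.castSucc =
      if h : (k : ℕ) + 1 < 2 * S.s j then ζ (⟨k + 1, h⟩ : Fin (2 * S.s j)).castSucc
      else -(∑ i, S.r j i * ζ i.castSucc) - η := by
  have hk : ¬ (k.castSucc : ℕ) = 2 * S.s j := by have := k.2; simp; omega
  simp only [zetaField, Pi.add_apply, Pi.sub_apply, Pi.smul_apply, Matrix.sub_mulVec,
    exoMatrix_mulVec_castSucc, Matrix.vecMulVec_mulVec, smul_eq_mul, rowR_dotProduct,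
    MulOpposite.smul_eq_mul_unop, MulOpposite.unop_op]
  rw [colG, if_neg hk]
  split_ifs with h1 h2 h2
  · simp at h1; omega
  · have : k.succ = Fin.last _ := Fin.ext (by simpa using h1)
    rw [this]
    ring
  · have : k.succ = (⟨k + 1, h2⟩ : Fin (2 * S.s j)).castSucc := rfl
    rw [this]
    ring
  · simp at h1; have := k.2; omega

/-- The parameter error enters only this row, and `γ` multiplies the output `R ζ̃ + η`. This gives
the output its damping and its linear dependence on `α`. -/
theorem zetaField_last (j : Fin n) (t η : ℝ) (ζ : Fin (2 * S.s j + 1) → ℝ)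
    (α : Fin (S.s j) → ℝ) :
    S.zetaField j t η ζ α (Fin.last _) = ∑ m, α m * Lam (S.s j) (ζ + S.varphi j t) m +
      ∑ m, S.alpha j m * Lam (S.s j) ζ m - S.γ * (rowR (S.s j) (S.r j) ⬝ᵥ ζ + η) := by
  simp only [zetaField, Pi.add_apply, Pi.sub_apply, Pi.smul_apply, Matrix.sub_mulVec,
    exoMatrix_mulVec_last, Matrix.vecMulVec_mulVec, smul_eq_mul,
    MulOpposite.smul_eq_mul_unop, MulOpposite.unop_op]
  rw [colG, if_pos (by simp)]
  have : ∑ m, (S.alpha j m + α m) * Lam (S.s j) (ζ + S.varphi j t) m =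
      ∑ m, S.alpha j m * Lam (S.s j) (ζ + S.varphi j t) m +
        ∑ m, α m * Lam (S.s j) (ζ + S.varphi j t) m := by
    rw [← Finset.sum_add_distrib]
    exact Finset.sum_congr rfl fun m _ => by ring
  rw [this]
  ring

/-- The coordinate functionals of `NuSpace`. -/
noncomputable def nuCoord (j : Fin n) (i : Unit ⊕ (Fin (2 * S.s j + 1) ⊕ Fin (S.s j))) :
    S.NuSpace j →L[ℝ] ℝ := EuclideanSpace.proj i

theorem nuCoord_apply (j : Fin n) (i : Unit ⊕ (Fin (2 * S.s j + 1) ⊕ Fin (S.s j)))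
    (ν : S.NuSpace j) : nuCoord j i ν = ν i := rfl

/-- The first `2 s_j` entries of the `ζ̃`-part. -/
noncomputable def nuXi (j : Fin n) : S.NuSpace j →L[ℝ] EuclideanSpace ℝ (Fin (2 * S.s j)) :=
  LinearMap.toContinuousLinearMap
    { toFun := fun ν => WithLp.toLp 2 fun k => ν (Sum.inr (Sum.inl k.castSucc))
      map_add' := fun _ _ => rfl
      map_smul' := fun _ _ => rfl }

theorem nuXi_apply (j : Fin n) (ν : S.NuSpace j) (k : Fin (2 * S.s j)) :
    nuXi j ν k = ν (Sum.inr (Sum.inl k.castSucc)) := rfl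

/-- The output `η̃ + R ζ̃`. -/
noncomputable def nuOut (j : Fin n) : S.NuSpace j →L[ℝ] ℝ :=
  nuCoord j (Sum.inl ()) + ∑ k, S.r j k • nuCoord j (Sum.inr (Sum.inl k.castSucc)) +
    nuCoord j (Sum.inr (Sum.inl (Fin.last _)))

theorem nuOut_apply (j : Fin n) (ν : S.NuSpace j) :
    nuOut j ν = ν (Sum.inl ()) + ∑ k, S.r j k * ν (Sum.inr (Sum.inl k.castSucc)) +
      ν (Sum.inr (Sum.inl (Fin.last _))) := by
  simp [nuOut, nuCoord_apply, sum_apply]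

theorem nuOut_eq (j : Fin n) (ν : S.NuSpace j) :
    nuOut j ν = ν (Sum.inl ()) +
      rowR (S.s j) (S.r j) ⬝ᵥ fun i => ν (Sum.inr (Sum.inl i)) := by
  rw [nuOut_apply, rowR_dotProduct, add_assoc]

theorem nuField_inl (j : Fin n) (t : ℝ) (ν : S.NuSpace j) :
    S.nuField j t ν (Sum.inl ()) = -ν (Sum.inl ()) := rfl

theorem nuField_zeta (j : Fin n) (t : ℝ) (ν : S.NuSpace j) (i : Fin (2 * S.s j + 1)) :
    S.nuField j t ν (Sum.inr (Sum.inl i)) = S.zetaField j t (ν (Sum.inl ()))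
      (fun i => ν (Sum.inr (Sum.inl i))) (fun m => ν (Sum.inr (Sum.inr m))) i := rfl

theorem nuField_alpha (j : Fin n) (t : ℝ) (ν : S.NuSpace j) (m : Fin (S.s j)) :
    S.nuField j t ν (Sum.inr (Sum.inr m)) = -S.kα * nuOut j ν *
      Lam (S.s j) ((fun i => ν (Sum.inr (Sum.inl i))) + S.varphi j t) m := by
  rw [nuOut_eq]
  rfl

theorem abs_nuXi_le (j : Fin n) (ν : S.NuSpace j) (k : Fin (2 * S.s j)) :
    |ν (Sum.inr (Sum.inl k.castSucc))| ≤ ‖nuXi j ν‖ := by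
  have := PiLp.norm_apply_le (nuXi j ν) k
  rwa [nuXi_apply, Real.norm_eq_abs] at this

theorem abs_Lam_nu_le (j : Fin n) (ν : S.NuSpace j) (m : Fin (S.s j)) :
    |Lam (S.s j) (fun i => ν (Sum.inr (Sum.inl i))) m| ≤ ‖nuXi j ν‖ :=
  abs_nuXi_le j ν ⟨2 * (m : ℕ) + 1, by omega⟩

theorem sum_abs_r_mul_le (j : Fin n) (ν : S.NuSpace j) :
    |∑ k, S.r j k * ν (Sum.inr (Sum.inl k.castSucc))| ≤ (∑ k, |S.r j k|) * ‖nuXi j ν‖ := by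
  rw [Finset.sum_mul]
  refine (Finset.abs_sum_le_sum_abs _ _).trans (Finset.sum_le_sum fun k _ => ?_)
  rw [abs_mul]
  exact mul_le_mul_of_nonneg_left (abs_nuXi_le j ν k) (abs_nonneg _)

theorem norm_sq_nu (j : Fin n) (ν : S.NuSpace j) :
    ‖ν‖ ^ 2 = ν (Sum.inl ()) ^ 2 + (‖nuXi j ν‖ ^ 2 + ν (Sum.inr (Sum.inl (Fin.last _))) ^ 2 +
      ∑ m, ν (Sum.inr (Sum.inr m)) ^ 2) := by
  rw [EuclideanSpace.real_norm_sq_eq, EuclideanSpace.real_norm_sq_eq, Fintype.sum_sum_type,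
    Fintype.sum_sum_type, Fin.sum_univ_castSucc]
  simp [nuXi_apply]

/-- Replacing the last entry of `ζ̃` by the output `y = η + R ζ̃` is an invertible change of
coordinates that puts the field in the form required by `hasStrictLyapunov_adaptive`. The companion
form of `R` supplies `P`. -/
theorem hasStrictLyapunov_nuField (hS : S.WellPosed) (j : Fin n) :
    HasStrictLyapunov (S.nuField j) := by
  obtain ⟨w', C₁, hw'c, hw', hwC, hwC'⟩ := exists_hasDerivAt_Lam hS j
  obtain ⟨N, Γ, κ, C₂, hκ, hN, hNC, hΓ⟩ := exists_excitation_Lam hS j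
  obtain ⟨P, hP, hPd⟩ := exists_companion_lyapunov (S.r j) (hS.r_hurwitz j)
  have hs := hS.s_pos j
  let kl : Fin (2 * S.s j) := ⟨2 * S.s j - 1, by omega⟩
  let e : EuclideanSpace ℝ (Fin (2 * S.s j)) := EuclideanSpace.single kl 1
  have he : ‖e‖ = 1 := by simp [e]
  set ρ := ∑ k, |S.r j k| with hρ
  set σ := ∑ m, |S.alpha j m| with hσ
  -- The part of the derivative of `y` other than `-γ y + α · Λ`. Time `0` stands for any time,
  -- because the first `2s` components of the field do not depend on `t`.
  let ℓ : S.NuSpace j → ℝ := fun ν => -ν (Sum.inl ()) +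
    ∑ k, S.r j k * (S.nuField j 0 ν (Sum.inr (Sum.inl k.castSucc))) +
    ∑ m, S.alpha j m * Lam (S.s j) (fun i => ν (Sum.inr (Sum.inl i))) m
  have hρ0 : 0 ≤ ρ := Finset.sum_nonneg fun _ _ => abs_nonneg _
  have hσ0 : 0 ≤ σ := Finset.sum_nonneg fun _ _ => abs_nonneg _
  refine hasStrictLyapunov_adaptive (S.nuField j) (nuOut j) (nuCoord j (Sum.inl ())) (nuXi j)
    (fun m => nuCoord j (Sum.inr (Sum.inr m))) P ℓ
    (fun t ν => Lam (S.s j) ((fun i => ν (Sum.inr (Sum.inl i))) + S.varphi j t))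
    (fun m t => Lam (S.s j) (S.varphi j t) m) w' N Γ (C := max 0 (max C₁ C₂))
    (Cl := 1 + ρ * (1 + ρ) + σ) (Cp := 2 * ‖P‖) (Cq := 4 + 3 * ρ ^ 2)
    hS.γ_pos hS.kα_pos hκ (le_max_left _ _) (by positivity) (by positivity)
    (fun t ν => nuField_inl j t ν) (fun t ν => ?_) (fun t ν m => nuField_alpha j t ν m) hP
    (fun t ν => ?_) (fun ν => ?_) (fun t ν m => ?_) hw' hw'c
    (fun m t => (hwC m t).trans ((le_max_left _ _).trans (le_max_right _ _)))
    (fun m t => (hwC' m t).trans ((le_max_left _ _).trans (le_max_right _ _))) hN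
    (fun m l t => (hNC m l t).trans ((le_max_right _ _).trans (le_max_right _ _))) hΓ
    (fun ν => ?_) (fun ν => ?_)
  · rw [nuOut_apply, nuField_inl]
    simp only [ℓ, nuField_zeta, zetaField_castSucc, zetaField_last]
    rw [nuOut_eq]
    simp only [nuCoord_apply]
    ring
  -- Adding `η e` removes the input from the last companion row, so that `v'` is the exact companion
  -- image of `ξ`. The correction costs at most `2 ‖P‖ |η| ‖ξ‖`.
  · let v' : EuclideanSpace ℝ (Fin (2 * S.s j)) := nuXi j (S.nuField j t ν) + ν (Sum.inl ()) • e
    have h1 := hPd (nuXi j ν) v' fun k => by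
      simp only [v', PiLp.add_apply, PiLp.smul_apply, nuXi_apply, nuField_zeta,
        zetaField_castSucc, e, PiLp.single_apply, smul_eq_mul]
      split_ifs with h1 h2 h2
      · exfalso; rw [h2] at h1; simp only [kl] at h1; omega
      · simp
      · ring
      · exfalso; exact h2 (Fin.ext (by simp only [kl]; omega))
    have h2 : nuXi j (S.nuField j t ν) = v' - ν (Sum.inl ()) • e := by simp [v']
    rw [h2]
    simp only [map_sub, map_smul, sub_apply, FunLike.coe_smul, Pi.smul_apply,
      smul_eq_mul]
    have h3 := P.le_opNorm₂ (nuXi j ν) e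
    have h4 := P.le_opNorm₂ e (nuXi j ν)
    rw [he, Real.norm_eq_abs] at h3 h4
    have h5 : |ν (Sum.inl ()) * (P (nuXi j ν) e + P e (nuXi j ν))| ≤
        |ν (Sum.inl ())| * (2 * ‖P‖ * ‖nuXi j ν‖) := by
      rw [abs_mul]
      refine mul_le_mul_of_nonneg_left ?_ (abs_nonneg _)
      refine (abs_add_le _ _).trans ?_
      linarith
    have h6 := (abs_le.1 h5).1
    rw [nuCoord_apply]
    linarith
  · have h1 : ∀ k : Fin (2 * S.s j), |S.nuField j 0 ν (Sum.inr (Sum.inl k.castSucc))| ≤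
        (1 + ρ) * ‖nuXi j ν‖ + |ν (Sum.inl ())| := by
      intro k
      rw [nuField_zeta, zetaField_castSucc]
      have hx := norm_nonneg (nuXi j ν)
      split_ifs with h
      · refine (abs_nuXi_le j ν _).trans ?_
        nlinarith [abs_nonneg (ν (Sum.inl ())), mul_nonneg hρ0 hx]
      · have h2 := sum_abs_r_mul_le j ν
        have h3 := abs_sub (-∑ i, S.r j i * ν (Sum.inr (Sum.inl i.castSucc))) (ν (Sum.inl ()))
        rw [abs_neg] at h3
        linarith
    have h2 : |∑ k, S.r j k * (S.nuField j 0 ν (Sum.inr (Sum.inl k.castSucc)))| ≤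
        ρ * ((1 + ρ) * ‖nuXi j ν‖ + |ν (Sum.inl ())|) := by
      rw [hρ, Finset.sum_mul]
      refine (Finset.abs_sum_le_sum_abs _ _).trans (Finset.sum_le_sum fun k _ => ?_)
      rw [abs_mul]
      exact mul_le_mul_of_nonneg_left (h1 k) (abs_nonneg _)
    have h3 : |∑ m, S.alpha j m * Lam (S.s j) (fun i => ν (Sum.inr (Sum.inl i))) m| ≤
        σ * ‖nuXi j ν‖ := by
      rw [hσ, Finset.sum_mul]
      refine (Finset.abs_sum_le_sum_abs _ _).trans (Finset.sum_le_sum fun m _ => ?_)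
      rw [abs_mul]
      exact mul_le_mul_of_nonneg_left (abs_Lam_nu_le j ν m) (abs_nonneg _)
    have h4 := abs_add_three (-ν (Sum.inl ()))
      (∑ k, S.r j k * (S.nuField j 0 ν (Sum.inr (Sum.inl k.castSucc))))
      (∑ m, S.alpha j m * Lam (S.s j) (fun i => ν (Sum.inr (Sum.inl i))) m)
    rw [abs_neg] at h4
    rw [nuCoord_apply]
    have hx := norm_nonneg (nuXi j ν)
    have hy := abs_nonneg (ν (Sum.inl ()))
    have g1 := mul_nonneg (mul_nonneg hρ0 hρ0) hy
    have g2 := mul_nonneg hσ0 hy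
    have : |ℓ ν| ≤ _ := h4
    linarith
  · rw [Lam_add, add_sub_cancel_right]
    exact abs_Lam_nu_le j ν m
  · rw [norm_sq_nu]
    simp only [nuCoord_apply]
    have h1 := sum_abs_r_mul_le j ν
    have h2 : (∑ k, S.r j k * ν (Sum.inr (Sum.inl k.castSucc))) ^ 2 ≤ ρ ^ 2 * ‖nuXi j ν‖ ^ 2 := by
      rw [← mul_pow, ← sq_abs]
      exact pow_le_pow_left₀ (abs_nonneg _) h1 2
    have h3 : ν (Sum.inr (Sum.inl (Fin.last _))) = nuOut j ν - ν (Sum.inl ()) -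
        ∑ k, S.r j k * ν (Sum.inr (Sum.inl k.castSucc)) := by
      rw [nuOut_apply]; ring
    rw [h3]
    set b := ∑ k, S.r j k * ν (Sum.inr (Sum.inl k.castSucc))
    set y := nuOut j ν
    set η := ν (Sum.inl ())
    set a := ∑ m, ν (Sum.inr (Sum.inr m)) ^ 2 with ha
    have ha0 : 0 ≤ a := Finset.sum_nonneg fun _ _ => sq_nonneg _
    have h4 : (y - η - b) ^ 2 ≤ 3 * (y ^ 2 + η ^ 2 + b ^ 2) := by
      nlinarith [sq_nonneg (y + η), sq_nonneg (y + b), sq_nonneg (η - b)]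
    have g1 : 0 ≤ ρ ^ 2 * y ^ 2 := by positivity
    have g2 : 0 ≤ ρ ^ 2 * η ^ 2 := by positivity
    have g3 : 0 ≤ ρ ^ 2 * a := by positivity
    nlinarith [sq_nonneg y, sq_nonneg η, sq_nonneg ‖nuXi j ν‖]
  · rw [norm_sq_nu]
    simp only [nuCoord_apply]
    linarith [sq_nonneg (ν (Sum.inl ())), sq_nonneg ‖nuXi j ν‖,
      sq_nonneg (ν (Sum.inr (Sum.inl (Fin.last _))))]

theorem exists_isSubsystemLyapunov (hS : S.WellPosed) (j : Fin n) :
    ∃ (U : ℝ → S.NuSpace j → ℝ) (Ulow Uup : S.NuSpace j → ℝ) (b : ℝ),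
      S.IsSubsystemLyapunov j U Ulow Uup b := by
  obtain ⟨U, Ulow, Uup, b, h1, h2, h3, h4, h5, h6, h7, h8⟩ := hasStrictLyapunov_nuField hS j
  exact ⟨U, Ulow, Uup, b, h1, h2, h3, fun t _ => h4 t, fun t _ => h5 t, fun t _ => h6 t, h7,
    fun t _ => h8 t⟩

end PowerSystem
end FreqControl

/-! ### Network graph, flows and equilibria -/

namespace FreqControl

theorem eq_of_connected {n : ℕ} {G : SimpleGraph (Fin n)} (hG : G.Connected) {X : Type*}
    {u : Fin n → X} (h : ∀ i j, G.Adj i j → u i = u j) (i j : Fin n) : u i = u j := by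
  obtain ⟨p⟩ := hG.preconnected i j
  induction p with
  | nil => rfl
  | cons hadj _ ih => exact (h _ _ hadj).trans ih

-- Exchanging `j` and `k` changes the sign of `μ_j - μ_k`; averaging the two expressions gives the
-- symmetric one.
open Classical in
theorem sum_laplacian_mul {n : ℕ} (G : SimpleGraph (Fin n)) (μ ν : Fin n → ℝ) :
    ∑ j, ν j * ∑ k, (if G.Adj j k then μ j - μ k else 0) =
      (∑ j, ∑ k, if G.Adj j k then (ν j - ν k) * (μ j - μ k) else 0) / 2 := by
  have h1 : ∑ j, ν j * ∑ k, (if G.Adj j k then μ j - μ k else 0) =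
      ∑ j, ∑ k, if G.Adj j k then ν j * (μ j - μ k) else 0 := by
    refine Finset.sum_congr rfl fun j _ => ?_
    rw [Finset.mul_sum]
    exact Finset.sum_congr rfl fun k _ => by split_ifs <;> ring
  have h2 : ∑ j, ∑ k, (if G.Adj j k then ν j * (μ j - μ k) else 0) =
      ∑ j, ∑ k, if G.Adj j k then -ν k * (μ j - μ k) else 0 := by
    rw [Finset.sum_comm]
    refine Finset.sum_congr rfl fun j _ => Finset.sum_congr rfl fun k _ => ?_
    rw [G.adj_comm]
    split_ifs <;> ring
  rw [h1, eq_div_iff two_ne_zero, mul_two]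
  nth_rw 2 [h2]
  rw [← Finset.sum_add_distrib]
  refine Finset.sum_congr rfl fun j _ => ?_
  rw [← Finset.sum_add_distrib]
  exact Finset.sum_congr rfl fun k _ => by split_ifs <;> ring

open Classical in
theorem sum_laplacian_eq_zero {n : ℕ} (G : SimpleGraph (Fin n)) (μ : Fin n → ℝ) :
    ∑ j, ∑ k, (if G.Adj j k then μ j - μ k else 0) = 0 := by
  have := sum_laplacian_mul G μ fun _ => 1
  simpa using this

namespace PowerSystem

variable {n : ℕ} {S : PowerSystem n}

theorem WellPosed.nonempty (hS : S.WellPosed) : Nonempty (Fin n) := hS.comm_connected.nonempty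

theorem WellPosed.eq_of_tie_lines (hS : S.WellPosed) {X : Type*} {u : Fin n → X}
    (h : ∀ e : S.E, u e.1.1 = u e.1.2) (i j : Fin n) : u i = u j := by
  refine eq_of_connected hS.network_connected (fun i j hij => ?_) i j
  rw [SimpleGraph.fromRel_adj] at hij
  rcases hij.2 with h' | h'
  · exact h ⟨_, h'⟩
  · exact (h ⟨_, h'⟩).symm

theorem sum_mul_flow (θ : S.E → ℝ) (u : Fin n → ℝ) :
    ∑ j, u j * S.flow θ j = ∑ e : S.E, S.B e * θ e * (u e.1.2 - u e.1.1) := by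
  have h : ∀ g : S.E → Fin n, ∑ j, u j * (∑ e : S.E, if g e = j then S.B e * θ e else 0) =
      ∑ e : S.E, S.B e * θ e * u (g e) := by
    intro g
    simp only [Finset.mul_sum]
    rw [Finset.sum_comm]
    refine Finset.sum_congr rfl fun e _ => ?_
    simp [mul_comm]
  simp only [flow, mul_sub, Finset.sum_sub_distrib]
  rw [h fun e => e.1.2, h fun e => e.1.1]

theorem sum_flow (θ : S.E → ℝ) : ∑ j, S.flow θ j = 0 := by
  have := sum_mul_flow θ fun _ => 1
  simpa using this

/-- `flow` as a linear map. -/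
noncomputable def flowLin (S : PowerSystem n) : (S.E → ℝ) →ₗ[ℝ] (Fin n → ℝ) where
  toFun := S.flow
  map_add' θ θ' := by
    ext j
    simp only [flow, Pi.add_apply, mul_add, ite_add_zero, Finset.sum_add_distrib]
    ring
  map_smul' c θ := by
    ext j
    simp only [flow, Pi.smul_apply, smul_eq_mul, RingHom.id_apply, mul_sub, Finset.mul_sum]
    congr 1 <;> exact Finset.sum_congr rfl fun e _ => by split_ifs <;> ring

/-- The map from node angles to angle differences. -/
def diffLin (S : PowerSystem n) : (Fin n → ℝ) →ₗ[ℝ] (S.E → ℝ) where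
  toFun θ e := θ e.1.1 - θ e.1.2
  map_add' θ θ' := by ext e; simp; ring
  map_smul' c θ := by ext e; simp; ring

theorem isAngleDifference_iff (x : S.State) :
    IsAngleDifference x ↔ State.θ x ∈ LinearMap.range S.diffLin := by
  constructor
  · rintro ⟨θ, h⟩
    exact ⟨θ, funext fun e => (h e).symm⟩
  · rintro ⟨θ, h⟩
    exact ⟨θ, fun e => (congrFun h e).symm⟩

/-- Pairing the flow of `θ = (u_i - u_j)` with `u` gives `-∑ B θ²`, so a zero flow has zero energy.
-/
theorem eq_zero_of_flow_eq_zero (hS : S.WellPosed) {θ : S.E → ℝ}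
    (hθ : θ ∈ LinearMap.range S.diffLin) (h : S.flow θ = 0) : θ = 0 := by
  obtain ⟨u, rfl⟩ := hθ
  have h1 := sum_mul_flow (S.diffLin u) u
  rw [h] at h1
  simp only [Pi.zero_apply, mul_zero, Finset.sum_const_zero] at h1
  have h2 : ∑ e : S.E, S.B e * S.diffLin u e ^ 2 = 0 := by
    rw [← neg_eq_zero, h1, ← Finset.sum_neg_distrib]
    refine Finset.sum_congr rfl fun e _ => ?_
    change -(S.B e * (u e.1.1 - u e.1.2) ^ 2) = S.B e * (u e.1.1 - u e.1.2) * (u e.1.2 - u e.1.1)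
    ring
  rw [Finset.sum_eq_zero_iff_of_nonneg fun e _ => mul_nonneg (hS.B_pos e).le (sq_nonneg _)] at h2
  ext e
  have := h2 e (Finset.mem_univ e)
  exact pow_eq_zero_iff two_ne_zero |>.1 ((mul_eq_zero.1 this).resolve_left (hS.B_pos e).ne')

/-- The weighted Laplacian has the constants as kernel and takes values of sum zero. Adding the map
`u ↦ (∑ u) 1` makes it injective, hence surjective, and for `v` of sum zero the preimage also has
sum zero, so the added term vanishes. -/
theorem exists_flow_eq (hS : S.WellPosed) {v : Fin n → ℝ} (hv : ∑ j, v j = 0) :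
    ∃ θ ∈ LinearMap.range S.diffLin, S.flow θ = v := by
  let one : Fin n → ℝ := fun _ => 1
  let sumL : (Fin n → ℝ) →ₗ[ℝ] ℝ := ∑ j, LinearMap.proj j
  have hsum : ∀ u, sumL u = ∑ j, u j := fun u => by simp [sumL]
  let L : (Fin n → ℝ) →ₗ[ℝ] (Fin n → ℝ) := S.flowLin ∘ₗ S.diffLin + sumL.smulRight one
  have hL : ∀ u j, L u j = S.flow (S.diffLin u) j + ∑ i, u i := by
    intro u j
    simp only [L, LinearMap.add_apply, LinearMap.smulRight_apply, hsum]
    simp [one, flowLin]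
  have hLs : ∀ u, ∑ j, L u j = n * ∑ i, u i := by
    intro u
    simp only [hL, Finset.sum_add_distrib, sum_flow]
    simp
  have hne := hS.nonempty
  have hn : (n : ℝ) ≠ 0 := by
    have := Fin.pos_iff_nonempty.2 hne
    positivity
  have hinj : Function.Injective L := by
    rw [← LinearMap.ker_eq_bot, LinearMap.ker_eq_bot']
    intro u hu
    have h1 := hLs u
    rw [hu] at h1
    simp only [Pi.zero_apply, Finset.sum_const_zero] at h1
    have h2 := (mul_eq_zero.1 h1.symm).resolve_left hn
    have h3 : S.flow (S.diffLin u) = 0 := by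
      ext j
      have := congrFun hu j
      rw [hL, h2, add_zero] at this
      exact this
    have h4 := eq_zero_of_flow_eq_zero hS ⟨u, rfl⟩ h3
    have h5 : ∀ i j, u i = u j := hS.eq_of_tie_lines fun e => sub_eq_zero.1 (congrFun h4 e)
    ext i
    have h6 : ∑ k, u k = n * u i := by
      rw [Finset.sum_congr rfl fun k _ => h5 k i]
      simp
    rw [h2] at h6
    exact (mul_eq_zero.1 h6.symm).resolve_left hn
  obtain ⟨u, hu⟩ := LinearMap.injective_iff_surjective.1 hinj v
  have h1 := hLs u
  rw [hu, hv] at h1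
  have h2 := (mul_eq_zero.1 h1.symm).resolve_left hn
  refine ⟨S.diffLin u, ⟨u, rfl⟩, ?_⟩
  ext j
  have := hL u j
  rw [hu, h2, add_zero] at this
  exact this.symm

theorem flow_bounded_below (hS : S.WellPosed) :
    ∃ c : ℝ, 0 < c ∧ ∀ θ ∈ LinearMap.range S.diffLin, c * ‖θ‖ ≤ ‖S.flow θ‖ := by
  obtain ⟨c, hc, h⟩ := exists_pos_mul_norm_le
    (S.flowLin.comp (LinearMap.range S.diffLin).subtype) (by
      rw [← LinearMap.ker_eq_bot, LinearMap.ker_eq_bot']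
      intro θ hθ
      exact Subtype.ext (eq_zero_of_flow_eq_zero hS θ.2 hθ))
  exact ⟨c, hc, fun θ hθ => h ⟨θ, hθ⟩⟩

/-- At a nonzero stationary point `U(t, ν)` would fall at rate at least `‖ν‖²` for all time,
contradicting its positive lower bound. Stationarity is needed for all `t ≥ 0`, not just at one
instant. -/
theorem eq_zero_of_nuField_eq_zero (hS : S.WellPosed) (j : Fin n) {ν : S.NuSpace j}
    (h : ∀ t, 0 ≤ t → S.nuField j t ν = 0) : ν = 0 := by
  obtain ⟨U, Ulow, Uup, b, hU⟩ := exists_isSubsystemLyapunov hS j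
  by_contra hν
  have hνp : 0 < ‖ν‖ ^ 2 := by have := norm_pos_iff.2 hν; positivity
  have hdiff : Differentiable ℝ fun t => U t ν := by
    have h1 : Differentiable ℝ (Function.uncurry U) := hU.contDiff.differentiable (by simp)
    exact h1.comp (differentiable_id.prodMk (differentiable_const ν))
  have hbound : ∀ t, 0 ≤ t → U t ν - U 0 ν ≤ -‖ν‖ ^ 2 * (t - 0) := by
    intro t ht
    refine (convex_Ici (0 : ℝ)).image_sub_le_mul_sub_of_deriv_le hdiff.continuous.continuousOn
      hdiff.differentiableOn (fun u hu => ?_) 0 (Set.mem_Ici.2 le_rfl) t ht ht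
    rw [interior_Ici] at hu
    have := hU.decrease u (le_of_lt hu) ν
    rwa [h u (le_of_lt hu), map_zero, add_zero] at this
  have hlow := hU.low.pos ν hν
  have h0 := hU.low_le 0 le_rfl ν
  have hT : 0 ≤ U 0 ν / ‖ν‖ ^ 2 := by
    apply div_nonneg _ hνp.le
    linarith
  have h1 := hbound _ hT
  have h2 := hU.low_le _ hT ν
  rw [sub_zero, neg_mul, mul_div_cancel₀ _ hνp.ne'] at h1
  linarith

theorem rho_zero (j : Fin n) (t : ℝ) : S.rho j t 0 0 = 0 := by
  simp [rho]

theorem zetaField_zero (j : Fin n) (t : ℝ) : S.zetaField j t 0 0 0 = 0 := by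
  simp [zetaField]

theorem alphaField_zero (j : Fin n) (t : ℝ) : S.alphaField j t 0 0 = 0 := by
  simp [alphaField]

/-- Description of the equilibria; it does not involve the damping estimates. -/
theorem isEquilibrium_iff (hS : S.WellPosed) (Dhat : Fin n → ℝ) (x : S.State) :
    S.IsEquilibrium Dhat x ↔ State.θ x ∈ LinearMap.range S.diffLin ∧ State.ω x = 0 ∧
      State.η x = 0 ∧ State.ζ x = 0 ∧ State.α x = 0 ∧
      ∃ c : ℝ, (∀ j, State.μ x j = c) ∧ ∀ j, S.P j + S.flow (State.θ x) j - c / S.β j = 0 := by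
  classical
  constructor
  · rintro ⟨hx, h⟩
    have hθ : ∀ e : S.E, State.ω x e.1.1 = State.ω x e.1.2 := fun e =>
      sub_eq_zero.1 (congrFun (congrArg Prod.fst (h 0 le_rfl)) e)
    have hμ : ∀ j, -(∑ k, if S.H.Adj j k then State.μ x j - State.μ x k else 0) +
        State.ω x j / S.β j = 0 := fun j => by
      have := congrFun (congrArg (fun z : S.State => z.2.2.1) (h 0 le_rfl)) j
      exact this
    -- Connectedness makes all frequencies equal; summing the `μ`-equations cancels the Laplacian
    -- and leaves `ω ∑ 1/β_j = 0`.
    have hω : State.ω x = 0 := by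
      obtain ⟨i₀⟩ := hS.nonempty
      have hc : ∀ j, State.ω x j = State.ω x i₀ := fun j => hS.eq_of_tie_lines hθ j i₀
      have h1 : ∑ j, State.ω x j / S.β j = 0 := by
        have := Finset.sum_congr rfl fun j (_ : j ∈ Finset.univ) => hμ j
        rw [Finset.sum_add_distrib, Finset.sum_neg_distrib, sum_laplacian_eq_zero] at this
        simpa using this
      have h2 : State.ω x i₀ * ∑ j, 1 / S.β j = 0 := by
        rw [← h1, Finset.mul_sum]
        exact Finset.sum_congr rfl fun j _ => by rw [hc j]; ring
      have h3 : 0 < ∑ j, 1 / S.β j :=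
        Finset.sum_pos (fun j _ => one_div_pos.2 (hS.β_pos j)) ⟨i₀, Finset.mem_univ _⟩
      ext j
      rw [hc j]
      exact (mul_eq_zero.1 h2).resolve_right h3.ne'
    have hωj : ∀ j, State.ω x j = 0 := fun j => congrFun hω j
    have hμc : ∀ i j, State.μ x i = State.μ x j := by
      have h1 : ∑ j, State.μ x j * ∑ k, (if S.H.Adj j k then State.μ x j - State.μ x k else 0) =
          0 := Finset.sum_eq_zero fun j _ => by
        have := hμ j
        rw [hωj j, zero_div, add_zero, neg_eq_zero] at this
        rw [this, mul_zero]
      rw [sum_laplacian_mul, div_eq_zero_iff, or_iff_left two_ne_zero] at h1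
      have hnn : ∀ j k, 0 ≤ if S.H.Adj j k then (State.μ x j - State.μ x k) *
          (State.μ x j - State.μ x k) else 0 := fun j k => by
        split_ifs
        · exact mul_self_nonneg _
        · exact le_rfl
      refine eq_of_connected hS.comm_connected fun i j hij => ?_
      have h2 := (Finset.sum_eq_zero_iff_of_nonneg
        fun j _ => Finset.sum_nonneg fun k _ => hnn j k).1 h1 i (Finset.mem_univ i)
      have h3 := (Finset.sum_eq_zero_iff_of_nonneg fun k _ => hnn i k).1 h2 j (Finset.mem_univ j)
      rw [if_pos hij] at h3
      exact sub_eq_zero.1 (mul_self_eq_zero.1 h3)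
    have hMe : ∀ t, 0 ≤ t → ∀ j, S.P j + S.rho j t (State.ζ x j) (State.α x j) +
        S.flow (State.θ x) j - State.μ x j / S.β j = 0 := fun t ht j => by
      have := congrFun (congrArg (fun z : S.State => z.2.1) (h t ht)) j
      have h1 := (mul_eq_zero.1 this).resolve_left (one_div_pos.2 (hS.M_pos j)).ne'
      rw [hωj j] at h1
      linarith
    have hη : State.η x = 0 := by
      ext j
      have := congrFun (congrArg (fun z : S.State => z.2.2.2.1) (h 0 le_rfl)) j
      change -State.η x j + S.P j + S.rho j 0 (State.ζ x j) (State.α x j) + S.flow (State.θ x) j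
        - Dhat j * State.ω x j - State.μ x j / S.β j - S.d j * State.ω x j = 0 at this
      rw [hωj j] at this
      have h1 := hMe 0 le_rfl j
      change State.η x j = 0
      linarith
    -- Once `ω` and `η̃` vanish, the last two equations say that the unforced `ν_j`-field vanishes
    -- at this point at all times.
    have hν : ∀ j, S.mkNu j 0 (State.ζ x j) (State.α x j) = 0 := by
      intro j
      refine eq_zero_of_nuField_eq_zero hS j fun t ht => ?_
      have h1 := congrFun (congrArg (fun z : S.State => z.2.2.2.2.1) (h t ht)) j
      have h2 := congrFun (congrArg (fun z : S.State => z.2.2.2.2.2) (h t ht)) j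
      change S.zetaField j t (State.η x j) (State.ζ x j) (State.α x j) = 0 at h1
      change S.alphaField j t (State.η x j) (State.ζ x j) = 0 at h2
      rw [hη] at h1 h2
      change S.mkNu j (-0) (S.zetaField j t 0 (State.ζ x j) (State.α x j))
        (S.alphaField j t 0 (State.ζ x j)) = 0
      simp only [Pi.zero_apply] at h1 h2
      rw [h1, h2]
      ext i
      rcases i with i | i | i <;> simp [mkNu]
    have hζ : State.ζ x = 0 := by
      funext j i
      exact congrArg (fun z : S.NuSpace j => z (Sum.inr (Sum.inl i))) (hν j)
    have hα : State.α x = 0 := by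
      funext j i
      exact congrArg (fun z : S.NuSpace j => z (Sum.inr (Sum.inr i))) (hν j)
    obtain ⟨i₀⟩ := hS.nonempty
    refine ⟨(isAngleDifference_iff x).1 hx, hω, hη, hζ, hα, State.μ x i₀, fun j => hμc j i₀,
      fun j => ?_⟩
    have := hMe 0 le_rfl j
    rw [hζ, hα, hμc j i₀] at this
    simp only [Pi.zero_apply, rho_zero] at this
    linarith
  · rintro ⟨hx, hω, hη, hζ, hα, c, hμ, hP⟩
    refine ⟨(isAngleDifference_iff x).2 hx, fun t _ => ?_⟩
    refine Prod.ext ?_ (Prod.ext ?_ (Prod.ext ?_ (Prod.ext ?_ (Prod.ext ?_ ?_))))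
    · funext e
      change State.ω x e.1.1 - State.ω x e.1.2 = 0
      simp [hω]
    · funext j
      change 1 / S.M j * (S.P j + S.rho j t (State.ζ x j) (State.α x j) + S.flow (State.θ x) j
        - State.μ x j / S.β j - S.d j * State.ω x j - S.D j * State.ω x j) = 0
      have := hP j
      simp only [hω, hζ, hα, hμ j, Pi.zero_apply, rho_zero, mul_zero, sub_zero, add_zero, this]
    · funext j
      change -(∑ k, if S.H.Adj j k then State.μ x j - State.μ x k else 0)
        + State.ω x j / S.β j = 0
      simp [hω, hμ]
    · funext j
      change -State.η x j + S.P j + S.rho j t (State.ζ x j) (State.α x j) + S.flow (State.θ x) j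
        - Dhat j * State.ω x j - State.μ x j / S.β j - S.d j * State.ω x j = 0
      have := hP j
      simp only [hω, hη, hζ, hα, hμ j, Pi.zero_apply, rho_zero, mul_zero, sub_zero, add_zero,
        neg_zero, zero_add, this]
    · funext j
      change S.zetaField j t (State.η x j) (State.ζ x j) (State.α x j) = 0
      simp [hη, hζ, hα, zetaField_zero]
    · funext j
      change S.alphaField j t (State.η x j) (State.ζ x j) = 0
      simp [hη, hζ, alphaField_zero]

/-- The closed loop has exactly one equilibrium, which does not depend on the estimates. -/
theorem exists_unique_equilibrium (hS : S.WellPosed) :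
    ∃ xs : S.State, ∀ (Dhat : Fin n → ℝ) (x : S.State), S.IsEquilibrium Dhat x ↔ x = xs := by
  have hne := hS.nonempty
  have hβ : 0 < ∑ j, 1 / S.β j :=
    Finset.sum_pos (fun j _ => one_div_pos.2 (hS.β_pos j)) Finset.univ_nonempty
  -- The flows sum to zero, so the power balances summed over the nodes force this common value of
  -- `μ`; conversely it makes the required flow have sum zero.
  set c := (∑ j, S.P j) / ∑ j, 1 / S.β j with hc
  obtain ⟨θ, hθ, hθv⟩ := exists_flow_eq hS (v := fun j => c / S.β j - S.P j) (by
    rw [Finset.sum_sub_distrib, sub_eq_zero]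
    have : ∀ j, c / S.β j = c * (1 / S.β j) := fun j => by ring
    simp only [this]
    rw [← Finset.mul_sum, hc, div_mul_cancel₀ _ hβ.ne'])
  refine ⟨(θ, 0, fun _ => c, 0, 0, 0), fun Dhat x => ?_⟩
  rw [isEquilibrium_iff hS]
  constructor
  · rintro ⟨hx, hω, hη, hζ, hα, c', hμ, hP⟩
    have hcc : c' = c := by
      have h1 : ∑ j, (S.P j + S.flow (State.θ x) j - c' / S.β j) = 0 :=
        Finset.sum_eq_zero fun j _ => hP j
      rw [Finset.sum_sub_distrib, Finset.sum_add_distrib, sum_flow, add_zero] at h1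
      have h2 : ∑ j, c' / S.β j = c' * ∑ j, 1 / S.β j := by
        rw [Finset.mul_sum]
        exact Finset.sum_congr rfl fun j _ => by ring
      rw [h2] at h1
      rw [hc, eq_div_iff hβ.ne']
      linarith
    have hθx : State.θ x = θ := by
      rw [← sub_eq_zero]
      refine eq_zero_of_flow_eq_zero hS (Submodule.sub_mem _ hx hθ) ?_
      change S.flowLin (State.θ x - θ) = 0
      rw [map_sub]
      change S.flow (State.θ x) - S.flow θ = 0
      ext j
      have := hP j
      rw [hθv, Pi.sub_apply, Pi.zero_apply, ← hcc]
      linarith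
    exact Prod.ext hθx (Prod.ext hω (Prod.ext (funext fun j => (hμ j).trans hcc)
      (Prod.ext hη (Prod.ext hζ hα))))
  · rintro rfl
    refine ⟨hθ, rfl, rfl, rfl, rfl, c, fun _ => rfl, fun j => ?_⟩
    change S.P j + S.flow θ j - c / S.β j = 0
    rw [hθv]
    ring

end PowerSystem
end FreqControl

/-! ### The closed-loop field: regularity and bounds -/

namespace FreqControl

section ENorm

variable {ι : Type*} [Fintype ι]

theorem eNorm_nonneg (v : ι → ℝ) : 0 ≤ eNorm v := norm_nonneg _

theorem eNorm_sq (v : ι → ℝ) : eNorm v ^ 2 = ∑ i, v i ^ 2 := EuclideanSpace.real_norm_sq_eq _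

theorem eNorm_add_le (v w : ι → ℝ) : eNorm (v + w) ≤ eNorm v + eNorm w :=
  norm_add_le (WithLp.toLp 2 v) (WithLp.toLp 2 w)

theorem eNorm_smul (c : ℝ) (v : ι → ℝ) : eNorm (c • v) = |c| * eNorm v :=
  norm_smul c (WithLp.toLp 2 v)

theorem abs_dotProduct_le (v w : ι → ℝ) : |v ⬝ᵥ w| ≤ eNorm v * eNorm w := by
  apply abs_le_of_sq_le_sq
  · rw [mul_pow, eNorm_sq, eNorm_sq]
    exact Finset.sum_mul_sq_le_sq_mul_sq _ _ _
  · exact mul_nonneg (eNorm_nonneg _) (eNorm_nonneg _)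

theorem abs_apply_le_eNorm (v : ι → ℝ) (i : ι) : |v i| ≤ eNorm v :=
  PiLp.norm_apply_le (WithLp.toLp 2 v) i

end ENorm

theorem eNorm_Lam_le (s : ℕ) (x : Fin (2 * s + 1) → ℝ) : eNorm (Lam s x) ≤ eNorm x := by
  rw [← pow_le_pow_iff_left₀ (eNorm_nonneg _) (eNorm_nonneg _) two_ne_zero, eNorm_sq, eNorm_sq]
  let f : Fin s ↪ Fin (2 * s + 1) := ⟨fun m => ⟨2 * (m : ℕ) + 1, by omega⟩, fun m l h => by
    have := congrArg Fin.val h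
    simp only at this
    exact Fin.ext (by omega)⟩
  have : ∑ m, Lam s x m ^ 2 = ∑ i ∈ Finset.univ.map f, x i ^ 2 := by
    rw [Finset.sum_map]
    rfl
  rw [this]
  exact Finset.sum_le_sum_of_subset_of_nonneg (Finset.subset_univ _) fun _ _ _ => sq_nonneg _

theorem one_le_eNorm_rowR (s : ℕ) (r : Fin (2 * s) → ℝ) : 1 ≤ eNorm (rowR s r) := by
  have := abs_apply_le_eNorm (rowR s r) (Fin.last _)
  simpa [rowR] using this

theorem rowR_vecMul_exoMatrix {s : ℕ} (r : Fin (2 * s) → ℝ) (α : Fin s → ℝ)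
    (x : Fin (2 * s + 1) → ℝ) : Matrix.vecMul (rowR s r) (exoMatrix s α) ⬝ᵥ x =
      ∑ k, r k * x k.succ + ∑ m, α m * Lam s x m := by
  rw [← Matrix.dotProduct_mulVec, rowR_dotProduct, exoMatrix_mulVec_last]
  simp only [exoMatrix_mulVec_castSucc]

namespace PowerSystem

variable {n : ℕ} {S : PowerSystem n}

/-- `ρ_{qj}` as a function of the value `p` of `φ_j(t)`. -/
noncomputable def rhoOf (S : PowerSystem n) (j : Fin n) (p ζ : Fin (2 * S.s j + 1) → ℝ)
    (α : Fin (S.s j) → ℝ) : ℝ :=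
  -(rowR (S.s j) (S.r j) ⬝ᵥ ζ) -
    Matrix.vecMul (rowR (S.s j) (S.r j)) (exoMatrix (S.s j) (S.alpha j)) ⬝ᵥ ζ -
    α ⬝ᵥ Lam (S.s j) (ζ + p)

/-- The terms `Ã(α) φ` cancel, and the parameter error acts only through the last row of `A`, where
`R` has the coefficient `1`. Hence `ρ_{qj}` is linear in `ζ̃` apart from `α̃ · Λ(ζ)` and vanishes
with `ν_j`. -/
theorem rho_eq (j : Fin n) (t : ℝ) (ζ : Fin (2 * S.s j + 1) → ℝ) (α : Fin (S.s j) → ℝ) :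
    S.rho j t ζ α = S.rhoOf j (S.varphi j t) ζ α := by
  simp only [rho, rhoOf, rowA, Matrix.vecMul_add, Matrix.vecMul_one, add_dotProduct,
    rowR_vecMul_exoMatrix, dotProduct_add, Pi.add_apply]
  simp only [dotProduct, Lam_add, mul_add, add_mul, Finset.sum_add_distrib]
  ring

/-- The `ζ̃`-field as a function of the value `p` of `φ_j(t)`. -/
noncomputable def zetaOf (S : PowerSystem n) (j : Fin n) (p : Fin (2 * S.s j + 1) → ℝ) (η : ℝ)
    (ζ : Fin (2 * S.s j + 1) → ℝ) (α : Fin (S.s j) → ℝ) : Fin (2 * S.s j + 1) → ℝ :=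
  Fin.snoc (α := fun _ => ℝ)
    (fun k : Fin (2 * S.s j) => if h : (k : ℕ) + 1 < 2 * S.s j then
      ζ (⟨k + 1, h⟩ : Fin (2 * S.s j)).castSucc else -(∑ i, S.r j i * ζ i.castSucc) - η)
    (∑ m, α m * Lam (S.s j) (ζ + p) m + ∑ m, S.alpha j m * Lam (S.s j) ζ m -
      S.γ * (rowR (S.s j) (S.r j) ⬝ᵥ ζ + η))

theorem zetaField_eq (j : Fin n) (t η : ℝ) (ζ : Fin (2 * S.s j + 1) → ℝ)
    (α : Fin (S.s j) → ℝ) : S.zetaField j t η ζ α = S.zetaOf j (S.varphi j t) η ζ α := by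
  ext i
  refine Fin.lastCases ?_ (fun k => ?_) i
  · rw [zetaField_last, zetaOf, Fin.snoc_last]
  · rw [zetaField_castSucc, zetaOf, Fin.snoc_castSucc]

open Classical in
/-- The closed-loop field as a function of the values `p j` of `φ_j(t)`. -/
noncomputable def fieldOf (S : PowerSystem n) (Dhat : Fin n → ℝ)
    (z : (∀ j, Fin (2 * S.s j + 1) → ℝ) × S.State) : S.State :=
  (fun e => State.ω z.2 e.1.1 - State.ω z.2 e.1.2,
   fun j => (1 / S.M j) * (S.P j + S.rhoOf j (z.1 j) (State.ζ z.2 j) (State.α z.2 j) +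
      S.flow (State.θ z.2) j - State.μ z.2 j / S.β j - S.d j * State.ω z.2 j -
      S.D j * State.ω z.2 j),
   fun j => -(∑ k, if S.H.Adj j k then State.μ z.2 j - State.μ z.2 k else 0) +
      State.ω z.2 j / S.β j,
   fun j => -State.η z.2 j + S.P j + S.rhoOf j (z.1 j) (State.ζ z.2 j) (State.α z.2 j) +
      S.flow (State.θ z.2) j - Dhat j * State.ω z.2 j - State.μ z.2 j / S.β j -
      S.d j * State.ω z.2 j,
   fun j => S.zetaOf j (z.1 j) (State.η z.2 j) (State.ζ z.2 j) (State.α z.2 j),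
   fun j => (-S.kα * (State.η z.2 j + rowR (S.s j) (S.r j) ⬝ᵥ State.ζ z.2 j)) •
      Lam (S.s j) (State.ζ z.2 j + z.1 j))

/-- Time enters only through the bounded signals `φ_j`, so the field is a `C¹` function of finitely
many variables and can be cut off outside a ball. -/
theorem closedLoop_eq (Dhat : Fin n → ℝ) (t : ℝ) (x : S.State) :
    S.closedLoop Dhat t x = S.fieldOf Dhat (fun j => S.varphi j t, x) := by
  simp only [closedLoop, fieldOf, rho_eq, zetaField_eq, alphaField]

theorem contDiff_flow {E : Type*} [NormedAddCommGroup E] [NormedSpace ℝ E] {f : E → S.E → ℝ}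
    (hf : ContDiff ℝ 1 f) (j : Fin n) : ContDiff ℝ 1 fun z => S.flow (f z) j := by
  let L : (S.E → ℝ) →ₗ[ℝ] ℝ := (LinearMap.proj j : (Fin n → ℝ) →ₗ[ℝ] ℝ) ∘ₗ S.flowLin
  exact (LinearMap.toContinuousLinearMap L).contDiff.comp hf

theorem contDiff_fieldOf (Dhat : Fin n → ℝ) : ContDiff ℝ 1 (S.fieldOf Dhat) := by
  have hθ : ContDiff ℝ 1 fun z : (∀ j, Fin (2 * S.s j + 1) → ℝ) × S.State => State.θ z.2 :=
    contDiff_fst.comp contDiff_snd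
  have hω : ∀ j, ContDiff ℝ 1
      fun z : (∀ j, Fin (2 * S.s j + 1) → ℝ) × S.State => State.ω z.2 j := fun j =>
    (contDiff_apply ℝ ℝ j).comp (contDiff_fst.comp (contDiff_snd.comp contDiff_snd))
  have hμ : ∀ j, ContDiff ℝ 1
      fun z : (∀ j, Fin (2 * S.s j + 1) → ℝ) × S.State => State.μ z.2 j := fun j =>
    (contDiff_apply ℝ ℝ j).comp (contDiff_fst.comp (contDiff_snd.comp
      (contDiff_snd.comp contDiff_snd)))
  have hη : ∀ j, ContDiff ℝ 1
      fun z : (∀ j, Fin (2 * S.s j + 1) → ℝ) × S.State => State.η z.2 j := fun j =>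
    (contDiff_apply ℝ ℝ j).comp (contDiff_fst.comp (contDiff_snd.comp (contDiff_snd.comp
      (contDiff_snd.comp contDiff_snd))))
  have hζ : ∀ j i, ContDiff ℝ 1
      fun z : (∀ j, Fin (2 * S.s j + 1) → ℝ) × S.State => State.ζ z.2 j i := fun j i =>
    contDiff_pi.1 (contDiff_pi.1 (contDiff_fst.comp (contDiff_snd.comp (contDiff_snd.comp
      (contDiff_snd.comp (contDiff_snd.comp contDiff_snd))))) j) i
  have hα : ∀ j i, ContDiff ℝ 1
      fun z : (∀ j, Fin (2 * S.s j + 1) → ℝ) × S.State => State.α z.2 j i := fun j i =>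
    contDiff_pi.1 (contDiff_pi.1 (contDiff_snd.comp (contDiff_snd.comp (contDiff_snd.comp
      (contDiff_snd.comp (contDiff_snd.comp contDiff_snd))))) j) i
  have hp : ∀ j i, ContDiff ℝ 1
      fun z : (∀ j, Fin (2 * S.s j + 1) → ℝ) × S.State => z.1 j i := fun j i =>
    contDiff_pi.1 (contDiff_pi.1 contDiff_fst j) i
  have hΛ : ∀ j m, ContDiff ℝ 1 fun z : (∀ j, Fin (2 * S.s j + 1) → ℝ) × S.State =>
      Lam (S.s j) (State.ζ z.2 j + z.1 j) m := fun j m => (hζ j _).add (hp j _)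
  have hdot : ∀ j (u : Fin (2 * S.s j + 1) → ℝ), ContDiff ℝ 1
      fun z : (∀ j, Fin (2 * S.s j + 1) → ℝ) × S.State => u ⬝ᵥ State.ζ z.2 j := fun j u =>
    ContDiff.sum fun i _ => contDiff_const.mul (hζ j i)
  have hρ : ∀ j, ContDiff ℝ 1 fun z : (∀ j, Fin (2 * S.s j + 1) → ℝ) × S.State =>
      S.rhoOf j (z.1 j) (State.ζ z.2 j) (State.α z.2 j) := fun j =>
    ((hdot j _).neg.sub (hdot j _)).sub (ContDiff.sum fun m _ => (hα j m).mul (hΛ j m))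
  refine ContDiff.prodMk ?_ (ContDiff.prodMk ?_ (ContDiff.prodMk ?_ (ContDiff.prodMk ?_
    (ContDiff.prodMk ?_ ?_))))
  · exact contDiff_pi.2 fun e => (hω _).sub (hω _)
  · exact contDiff_pi.2 fun j => contDiff_const.mul (((((contDiff_const.add (hρ j)).add
      (contDiff_flow hθ j)).sub ((hμ j).div_const _)).sub (contDiff_const.mul (hω j))).sub
      (contDiff_const.mul (hω j)))
  · refine contDiff_pi.2 fun j => ContDiff.add (ContDiff.neg (ContDiff.sum fun k _ => ?_))
      ((hω j).div_const _)
    split_ifs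
    · exact (hμ j).sub (hμ k)
    · exact contDiff_const
  · exact contDiff_pi.2 fun j => ((((((hη j).neg.add contDiff_const).add (hρ j)).add
      (contDiff_flow hθ j)).sub (contDiff_const.mul (hω j))).sub ((hμ j).div_const _)).sub
      (contDiff_const.mul (hω j))
  · refine contDiff_pi.2 fun j => contDiff_pi.2 fun i => ?_
    refine Fin.lastCases ?_ (fun k => ?_) i
    · simp only [zetaOf, Fin.snoc_last]
      exact ((ContDiff.sum fun m _ => (hα j m).mul (hΛ j m)).add
        (ContDiff.sum fun m _ => contDiff_const.mul (hζ j _))).sub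
        (contDiff_const.mul ((hdot j _).add (hη j)))
    · simp only [zetaOf, Fin.snoc_castSucc]
      split_ifs
      · exact hζ j _
      · exact (ContDiff.neg (ContDiff.sum fun i _ => contDiff_const.mul (hζ j _))).sub (hη j)
  · exact contDiff_pi.2 fun j => contDiff_pi.2 fun m =>
      (contDiff_const.mul ((hη j).add (hdot j _))).mul (hΛ j m)

/-- `ν_j` as a continuous linear function of the state. -/
noncomputable def nuL (S : PowerSystem n) (j : Fin n) : S.State →L[ℝ] S.NuSpace j :=
  LinearMap.toContinuousLinearMap
    { toFun := fun x => S.nu x j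
      map_add' := fun x y => by
        ext i
        rcases i with i | i | i
        · change State.η x j + State.η y j - S.M j * (State.ω x j + State.ω y j) =
            (State.η x j - S.M j * State.ω x j) + (State.η y j - S.M j * State.ω y j)
          ring
        · rfl
        · rfl
      map_smul' := fun c x => by
        ext i
        rcases i with i | i | i
        · change c * State.η x j - S.M j * (c * State.ω x j) =
            c * (State.η x j - S.M j * State.ω x j)
          ring
        · rfl
        · rfl }

theorem norm_mkNu_sq (j : Fin n) (a : ℝ) (u : Fin (2 * S.s j + 1) → ℝ) (w : Fin (S.s j) → ℝ) :
    ‖S.mkNu j a u w‖ ^ 2 = a ^ 2 + (eNorm u ^ 2 + eNorm w ^ 2) := by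
  rw [EuclideanSpace.real_norm_sq_eq, Fintype.sum_sum_type, Fintype.sum_sum_type, eNorm_sq,
    eNorm_sq]
  simp [mkNu]

theorem norm_mkNu_le (j : Fin n) (a : ℝ) (u : Fin (2 * S.s j + 1) → ℝ) (w : Fin (S.s j) → ℝ) :
    ‖S.mkNu j a u w‖ ≤ |a| + eNorm u + eNorm w := by
  have hu := eNorm_nonneg u
  have hw := eNorm_nonneg w
  have ha := abs_nonneg a
  rw [← pow_le_pow_iff_left₀ (norm_nonneg _) (by positivity) two_ne_zero, norm_mkNu_sq, ← sq_abs a]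
  nlinarith [mul_nonneg hu hw, mul_nonneg ha hu, mul_nonneg ha hw]

theorem eNorm_zeta_le (x : S.State) (j : Fin n) : eNorm (State.ζ x j) ≤ ‖S.nu x j‖ := by
  rw [← pow_le_pow_iff_left₀ (eNorm_nonneg _) (norm_nonneg _) two_ne_zero, nu, norm_mkNu_sq]
  nlinarith [sq_nonneg (eNorm (State.α x j)), sq_nonneg (State.η x j - S.M j * State.ω x j)]

theorem eNorm_alpha_le (x : S.State) (j : Fin n) : eNorm (State.α x j) ≤ ‖S.nu x j‖ := by
  rw [← pow_le_pow_iff_left₀ (eNorm_nonneg _) (norm_nonneg _) two_ne_zero, nu, norm_mkNu_sq]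
  nlinarith [sq_nonneg (eNorm (State.ζ x j)), sq_nonneg (State.η x j - S.M j * State.ω x j)]

theorem abs_eta_sub_le (x : S.State) (j : Fin n) :
    |State.η x j - S.M j * State.ω x j| ≤ ‖S.nu x j‖ := by
  apply abs_le_of_sq_le_sq _ (norm_nonneg _)
  rw [nu, norm_mkNu_sq]
  nlinarith [sq_nonneg (eNorm (State.ζ x j)), sq_nonneg (eNorm (State.α x j))]

/-- The bound obtained directly has the factor `‖R‖ + ‖R A‖ + φ + r`. As `R` contains the entry `1`,
`‖R‖ ≥ 1`, and this is at most `c₂ (1 + r)`. -/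
theorem abs_rho_le {j : Fin n} {t φ c₂ r : ℝ} (x : S.State)
    (hφ : eNorm (S.varphi j t) ≤ φ)
    (hc : eNorm (rowR (S.s j) (S.r j)) * φ + eNorm (rowR (S.s j) (S.r j)) +
      eNorm (Matrix.vecMul (rowR (S.s j) (S.r j)) (exoMatrix (S.s j) (S.alpha j))) ≤ c₂)
    (hr : ‖S.nu x j‖ ≤ r) :
    |S.rho j t (State.ζ x j) (State.α x j)| ≤ c₂ * (1 + r) * ‖S.nu x j‖ := by
  have hζ := eNorm_zeta_le x j
  have hα := eNorm_alpha_le x j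
  have hR := one_le_eNorm_rowR (S.s j) (S.r j)
  set N := ‖S.nu x j‖
  have hN : 0 ≤ N := norm_nonneg _
  have hφ0 : 0 ≤ φ := (eNorm_nonneg _).trans hφ
  set R := eNorm (rowR (S.s j) (S.r j))
  set RA := eNorm (Matrix.vecMul (rowR (S.s j) (S.r j)) (exoMatrix (S.s j) (S.alpha j)))
  have hRA : 0 ≤ RA := eNorm_nonneg _
  have h1 := (abs_dotProduct_le (rowR (S.s j) (S.r j)) (State.ζ x j)).trans
    (mul_le_mul_of_nonneg_left hζ (eNorm_nonneg _))
  have h2 := (abs_dotProduct_le (Matrix.vecMul (rowR (S.s j) (S.r j))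
    (exoMatrix (S.s j) (S.alpha j))) (State.ζ x j)).trans
    (mul_le_mul_of_nonneg_left hζ (eNorm_nonneg _))
  have h3 : eNorm (Lam (S.s j) (State.ζ x j + S.varphi j t)) ≤ r + φ :=
    (eNorm_Lam_le _ _).trans ((eNorm_add_le _ _).trans (add_le_add (hζ.trans hr) hφ))
  have h4 := (abs_dotProduct_le (State.α x j) (Lam (S.s j) (State.ζ x j + S.varphi j t))).trans
    (mul_le_mul hα h3 (eNorm_nonneg _) hN)
  rw [rho_eq, rhoOf]
  have h5 := abs_sub (-(rowR (S.s j) (S.r j) ⬝ᵥ State.ζ x j) -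
    Matrix.vecMul (rowR (S.s j) (S.r j)) (exoMatrix (S.s j) (S.alpha j)) ⬝ᵥ State.ζ x j)
    (State.α x j ⬝ᵥ Lam (S.s j) (State.ζ x j + S.varphi j t))
  have h6 := abs_sub (-(rowR (S.s j) (S.r j) ⬝ᵥ State.ζ x j))
    (Matrix.vecMul (rowR (S.s j) (S.r j)) (exoMatrix (S.s j) (S.alpha j)) ⬝ᵥ State.ζ x j)
  rw [abs_neg] at h6
  have h7 : (R + RA + φ + r) * N ≤ c₂ * (1 + r) * N := by
    refine mul_le_mul_of_nonneg_right ?_ hN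
    have : 0 ≤ r := hN.trans hr
    nlinarith [mul_le_mul_of_nonneg_right hR hφ0]
  linarith

/-- The `ν_j`-component of the closed loop as a perturbation of the unforced subsystem. -/
theorem nu_closedLoop (hS : S.WellPosed) (Dhat : Fin n → ℝ) (t : ℝ) (x : S.State) (j : Fin n) :
    S.nu (S.closedLoop Dhat t x) j = S.nuField j t (S.nu x j) +
      (-State.ω x j) • S.mkNu j (S.M j + (Dhat j - S.D j)) (S.M j • colG (S.s j) S.γ)
        ((S.kα * S.M j) • Lam (S.s j) (State.ζ x j + S.varphi j t)) := by
  have hM := (hS.M_pos j).ne'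
  ext i
  rcases i with i | i | i
  -- In `η̃ - M ω` all power terms cancel; only the mismatch `Dhat - D` and `M` multiply `ω`.
  · change (-State.η x j + S.P j + S.rho j t (State.ζ x j) (State.α x j) + S.flow (State.θ x) j
      - Dhat j * State.ω x j - State.μ x j / S.β j - S.d j * State.ω x j) -
      S.M j * ((1 / S.M j) * (S.P j + S.rho j t (State.ζ x j) (State.α x j) + S.flow (State.θ x) j
      - State.μ x j / S.β j - S.d j * State.ω x j - S.D j * State.ω x j)) =
      -(State.η x j - S.M j * State.ω x j) + (-State.ω x j) * (S.M j + (Dhat j - S.D j))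
    rw [← mul_assoc, mul_one_div_cancel hM]
    ring
  · change S.zetaField j t (State.η x j) (State.ζ x j) (State.α x j) i =
      S.zetaField j t (State.η x j - S.M j * State.ω x j) (State.ζ x j) (State.α x j) i +
      (-State.ω x j) * (S.M j * colG (S.s j) S.γ i)
    simp only [zetaField, Pi.add_apply, Pi.sub_apply, Pi.smul_apply, smul_eq_mul]
    ring
  · change (-S.kα * (State.η x j + rowR (S.s j) (S.r j) ⬝ᵥ State.ζ x j)) *
      Lam (S.s j) (State.ζ x j + S.varphi j t) i =
      (-S.kα * (State.η x j - S.M j * State.ω x j + rowR (S.s j) (S.r j) ⬝ᵥ State.ζ x j)) *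
      Lam (S.s j) (State.ζ x j + S.varphi j t) i +
      (-State.ω x j) * ((S.kα * S.M j) * Lam (S.s j) (State.ζ x j + S.varphi j t) i)
    ring

theorem norm_perturbation_le (hS : S.WellPosed) {j : Fin n} {t φ r a : ℝ} (x : S.State)
    (hφ : eNorm (S.varphi j t) ≤ φ) (hr : ‖S.nu x j‖ ≤ r) :
    ‖S.mkNu j a (S.M j • colG (S.s j) S.γ)
      ((S.kα * S.M j) • Lam (S.s j) (State.ζ x j + S.varphi j t))‖ ≤
      |a| + eNorm (colG (S.s j) S.γ) * |S.M j| + S.kα * |S.M j| * (r + φ) := by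
  refine (norm_mkNu_le _ _ _ _).trans ?_
  rw [eNorm_smul, eNorm_smul, abs_mul, abs_of_pos hS.kα_pos, mul_comm |S.M j|]
  refine add_le_add le_rfl (mul_le_mul_of_nonneg_left ?_ ?_)
  · exact (eNorm_Lam_le _ _).trans ((eNorm_add_le _ _).trans
      (add_le_add ((eNorm_zeta_le x j).trans hr) hφ))
  · exact mul_nonneg hS.kα_pos.le (abs_nonneg _)

end PowerSystem
end FreqControl

/-! ### Derivative of the composite Lyapunov function -/

namespace FreqControl

theorem hasDerivWithinAt_uncurry {E : Type*} [NormedAddCommGroup E] [NormedSpace ℝ E]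
    {U : ℝ → E → ℝ} (hU : ContDiff ℝ 1 (Function.uncurry U)) {ν : ℝ → E} {ν' : E} {s : Set ℝ}
    {t : ℝ} (hν : HasDerivWithinAt ν ν' s t) :
    HasDerivWithinAt (fun t => U t (ν t))
      (deriv (fun τ => U τ (ν t)) t + fderiv ℝ (U t) (ν t) ν') s t := by
  have hd : Differentiable ℝ (Function.uncurry U) := hU.differentiable (by simp)
  set D := fderiv ℝ (Function.uncurry U) (t, ν t)
  have hD : HasFDerivAt (Function.uncurry U) D (t, ν t) := (hd _).hasFDerivAt
  have h1 : HasDerivAt (fun τ => U τ (ν t)) (D (1, 0)) t :=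
    HasFDerivAt.comp_hasDerivAt (l := Function.uncurry U) (f := fun τ => (τ, ν t)) t hD ((hasDerivAt_id t).prodMk (hasDerivAt_const t (ν t)))
  have h2 : HasFDerivAt (U t) (D.comp (ContinuousLinearMap.inr ℝ ℝ E)) (ν t) :=
    hD.comp (ν t) (hasFDerivAt_prodMk_right t (ν t))
  have h3 : HasDerivWithinAt (fun t => U t (ν t)) (D (1, ν')) s t :=
    HasFDerivAt.comp_hasDerivWithinAt (l := Function.uncurry U) (f := fun τ => (τ, ν τ)) t hD ((hasDerivWithinAt_id t s).prodMk hν)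
  rw [h1.deriv, h2.fderiv]
  have e : D (1, ν') = D (1, 0) + D.comp (ContinuousLinearMap.inr ℝ ℝ E) ν' := by
    rw [ContinuousLinearMap.comp_apply, ContinuousLinearMap.inr_apply, ← map_add]
    simp
  rwa [e] at h3

theorem quadratic_nonneg {a B c x y : ℝ} (hc : 0 < c) (h : B ^ 2 ≤ 4 * a * c) :
    0 ≤ a * x ^ 2 - B * x * y + c * y ^ 2 := by
  have h1 : 0 ≤ (2 * c * y - B * x) ^ 2 + (4 * a * c - B ^ 2) * x ^ 2 := by
    have := sub_nonneg.2 h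
    positivity
  have h2 : (2 * c * y - B * x) ^ 2 + (4 * a * c - B ^ 2) * x ^ 2 =
      4 * c * (a * x ^ 2 - B * x * y + c * y ^ 2) := by ring
  rw [h2] at h1
  exact nonneg_of_mul_nonneg_right h1 (by positivity)

namespace PowerSystem

variable {n : ℕ} {S : PowerSystem n}

theorem hasDerivWithinAt_V1 {xs : S.State} {x : ℝ → S.State} {x' : S.State} {s : Set ℝ} {t : ℝ}
    (hx : HasDerivWithinAt x x' s t) :
    HasDerivWithinAt (fun t => S.V1 xs (x t))
      ((∑ e, S.B e * (State.θ (x t) e - State.θ xs e) * State.θ x' e) +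
        (∑ j, S.M j * (State.ω (x t) j - State.ω xs j) * State.ω x' j) +
        ∑ j, (State.μ (x t) j - State.μ xs j) * State.μ x' j) s t := by
  have hθ : ∀ e, HasDerivWithinAt (fun t => State.θ (x t) e) (State.θ x' e) s t :=
    hasDerivWithinAt_pi.1 hx.fst
  have hω : ∀ j, HasDerivWithinAt (fun t => State.ω (x t) j) (State.ω x' j) s t :=
    hasDerivWithinAt_pi.1 hx.snd.fst
  have hμ : ∀ j, HasDerivWithinAt (fun t => State.μ (x t) j) (State.μ x' j) s t :=
    hasDerivWithinAt_pi.1 hx.snd.snd.fst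
  have h1 := HasDerivWithinAt.fun_sum (u := Finset.univ) fun e _ =>
    (((hθ e).sub_const (State.θ xs e)).pow 2).const_mul (S.B e)
  have h2 := HasDerivWithinAt.fun_sum (u := Finset.univ) fun j _ =>
    (((hω j).sub_const (State.ω xs j)).pow 2).const_mul (S.M j)
  have h3 := HasDerivWithinAt.fun_sum (u := Finset.univ) fun j _ =>
    ((hμ j).sub_const (State.μ xs j)).pow 2
  refine (((h1.add h2).add h3).const_mul (1 / 2 : ℝ)).congr_deriv ?_
  simp only [mul_add, Finset.mul_sum]
  congr 1
  · congr 1 <;> exact Finset.sum_congr rfl fun _ _ => by push_cast; ring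
  · exact Finset.sum_congr rfl fun _ _ => by push_cast; ring

open Classical in
/-- The disagreement `∑_{j ~ k} (μ_j - μ_k)²` (every edge counted twice). -/
noncomputable def disagreement (S : PowerSystem n) (μ : Fin n → ℝ) : ℝ :=
  ∑ j, ∑ k, if S.H.Adj j k then (μ j - μ k) * (μ j - μ k) else 0

/-- The interconnection is skew: the power exchanged between `θ̃` and `ω` and between `ω` and `μ`
cancels in `V1`. Subtracting the balance at the equilibrium removes the constants, and only `ρ` and
the dissipative terms remain. -/
theorem V1_closedLoop (hS : S.WellPosed) {Dhat : Fin n → ℝ} {xs : S.State}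
    (hxs : S.IsEquilibrium Dhat xs) (t : ℝ) (x : S.State) :
    (∑ e, S.B e * (State.θ x e - State.θ xs e) * State.θ (S.closedLoop Dhat t x) e) +
        (∑ j, S.M j * (State.ω x j - State.ω xs j) * State.ω (S.closedLoop Dhat t x) j) +
        ∑ j, (State.μ x j - State.μ xs j) * State.μ (S.closedLoop Dhat t x) j =
      ∑ j, (State.ω x j * S.rho j t (State.ζ x j) (State.α x j) -
        (S.d j + S.D j) * State.ω x j ^ 2) - S.disagreement (State.μ x) / 2 := by
  classical
  obtain ⟨-, hω, -, -, -, c, hμ, hP⟩ := (isEquilibrium_iff hS Dhat xs).1 hxs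
  have h1 : ∑ e, S.B e * (State.θ x e - State.θ xs e) * State.θ (S.closedLoop Dhat t x) e =
      -∑ j, State.ω x j * S.flow (State.θ x - State.θ xs) j := by
    rw [sum_mul_flow, ← Finset.sum_neg_distrib]
    refine Finset.sum_congr rfl fun e _ => ?_
    change S.B e * (State.θ x e - State.θ xs e) * (State.ω x e.1.1 - State.ω x e.1.2) =
      -(S.B e * (State.θ x e - State.θ xs e) * (State.ω x e.1.2 - State.ω x e.1.1))
    ring
  have h2 : ∀ j, S.flow (State.θ x - State.θ xs) j =
      S.flow (State.θ x) j - S.flow (State.θ xs) j := fun j =>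
    congrFun (map_sub S.flowLin (State.θ x) (State.θ xs)) j
  have h3 : ∀ j, S.M j * (State.ω x j - State.ω xs j) * State.ω (S.closedLoop Dhat t x) j =
      State.ω x j * (S.P j + S.rho j t (State.ζ x j) (State.α x j) + S.flow (State.θ x) j
      - State.μ x j / S.β j - S.d j * State.ω x j - S.D j * State.ω x j) := by
    intro j
    rw [hω]
    change S.M j * (State.ω x j - 0) * (1 / S.M j * (S.P j +
      S.rho j t (State.ζ x j) (State.α x j) + S.flow (State.θ x) j
      - State.μ x j / S.β j - S.d j * State.ω x j - S.D j * State.ω x j)) = _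
    have := (hS.M_pos j).ne'
    field_simp
    ring
  have h4 : ∑ j, (State.μ x j - State.μ xs j) * State.μ (S.closedLoop Dhat t x) j =
      -(S.disagreement (State.μ x) / 2) + ∑ j, (State.μ x j - c) * (State.ω x j / S.β j) := by
    have e := sum_laplacian_mul S.H (State.μ x) fun j => State.μ x j - c
    simp only [sub_sub_sub_cancel_right] at e
    rw [disagreement, ← e, ← Finset.sum_neg_distrib, ← Finset.sum_add_distrib]
    refine Finset.sum_congr rfl fun j _ => ?_
    rw [hμ j]
    change (State.μ x j - c) * (-(∑ k, if S.H.Adj j k then State.μ x j - State.μ x k else 0)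
      + State.ω x j / S.β j) = _
    ring
  rw [h1, h4, Finset.sum_congr rfl fun j _ => h3 j]
  have h5 : ∀ j, State.ω x j * (S.P j + S.rho j t (State.ζ x j) (State.α x j) +
      S.flow (State.θ x) j - State.μ x j / S.β j - S.d j * State.ω x j - S.D j * State.ω x j) =
      (State.ω x j * S.rho j t (State.ζ x j) (State.α x j) - (S.d j + S.D j) * State.ω x j ^ 2) +
      State.ω x j * S.flow (State.θ x - State.θ xs) j -
      (State.μ x j - c) * (State.ω x j / S.β j) := by
    intro j
    rw [h2 j]
    linear_combination (State.ω x j) * hP j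
  rw [Finset.sum_congr rfl fun j _ => h5 j, Finset.sum_sub_distrib, Finset.sum_add_distrib]
  ring

/-- The dissipation rate of the Lyapunov function. -/
noncomputable def dissipation (S : PowerSystem n) (κ : Fin n → ℝ) (p : ℝ) (x : S.State) : ℝ :=
  ∑ j, κ j * (State.ω x j ^ 2 + ‖S.nu x j‖ ^ 2) + p * (S.disagreement (State.μ x) / 2)

theorem disagreement_nonneg (μ : Fin n → ℝ) : 0 ≤ S.disagreement μ := by
  refine Finset.sum_nonneg fun j _ => Finset.sum_nonneg fun k _ => ?_
  split_ifs
  · exact mul_self_nonneg _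
  · exact le_rfl

theorem sq_sub_le_disagreement (μ : Fin n → ℝ) {j k : Fin n} (h : S.H.Adj j k) :
    (μ j - μ k) ^ 2 ≤ S.disagreement μ := by
  classical
  have hnn : ∀ j k, 0 ≤ if S.H.Adj j k then (μ j - μ k) * (μ j - μ k) else 0 := fun j k => by
    split_ifs
    · exact mul_self_nonneg _
    · exact le_rfl
  have h1 := Finset.single_le_sum (f := fun k => if S.H.Adj j k then
    (μ j - μ k) * (μ j - μ k) else 0) (fun k _ => hnn j k) (Finset.mem_univ k)
  have h2 := Finset.single_le_sum (f := fun j => ∑ k, if S.H.Adj j k then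
    (μ j - μ k) * (μ j - μ k) else 0) (fun j _ => Finset.sum_nonneg fun k _ => hnn j k)
    (Finset.mem_univ j)
  simp only [if_pos h] at h1
  rw [sq]
  refine h1.trans (h2.trans (le_of_eq ?_))
  rw [disagreement]

/-- Constants `r > cbar` and `c` for which the bounds of the gain condition persist on `‖ν_j‖ ≤ r`,
together with a strict dissipation rate `κ`. -/
theorem GainCondition.exists_slack {Dhat b phibar : Fin n → ℝ} {cbar c₂ c₃ : ℝ}
    (hg : S.GainCondition Dhat b phibar cbar c₂ c₃) :
    ∃ (r c : ℝ) (κ : Fin n → ℝ), cbar < r ∧ 0 ≤ c ∧ c₂ * (1 + r) ≤ c ∧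
      (∀ j, b j * (1 + r ^ 2) ≤ c) ∧
      (∀ j, |S.M j + (Dhat j - S.D j)| + eNorm (colG (S.s j) S.γ) * |S.M j| +
        S.kα * |S.M j| * (r + phibar j) ≤ c) ∧
      ∀ j, 0 < κ j ∧ κ j < 1 ∧ (1 / (2 * c₃ ^ 2) * c + c ^ 2) ^ 2 ≤
        4 * (1 / (2 * c₃ ^ 2) * (S.d j + S.D j) - κ j) * (1 - κ j) := by
  have h3 := hg.c₃_ge_one
  have h3p : 0 < c₃ := by linarith
  -- This is the discriminant condition for `p (d + D) ω² - (p c₃ + c₃²) ω ν + ν²` with `p = 1 / (2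
  -- c₃²)`. It amounts to `1/8 + c₃³/2 + c₃⁶/2 < d + D`, which follows from `d + D > 1/2 + c₃⁶`.
  have hq : ∀ j, (1 / (2 * c₃ ^ 2) * c₃ + c₃ ^ 2) ^ 2 <
      4 * (1 / (2 * c₃ ^ 2) * (S.d j + S.D j)) := by
    intro j
    have h1 := (le_max_left _ _).trans_lt (hg.d_gt j)
    have h2 : 1 / 2 + c₃ ^ 6 < S.d j + S.D j := by linarith
    have e1 : (1 / (2 * c₃ ^ 2) * c₃ + c₃ ^ 2) ^ 2 =
        2 / c₃ ^ 2 * (1 / 8 + c₃ ^ 3 / 2 + c₃ ^ 6 / 2) := by field_simp; ring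
    have e2 : 4 * (1 / (2 * c₃ ^ 2) * (S.d j + S.D j)) = 2 / c₃ ^ 2 * (S.d j + S.D j) := by
      field_simp; ring
    rw [e1, e2]
    refine mul_lt_mul_of_pos_left ?_ (by positivity)
    nlinarith [sq_nonneg (c₃ ^ 3 - 1 / 2)]
  -- The inequality is strict, so it survives a slightly larger constant, and with it the bounds
  -- survive on a slightly larger ball. This gives an open set around the sublevel sets of `V`, on
  -- which the decrease is still known.
  have hc : ∀ᶠ c in 𝓝[>] c₃, ∀ j, (1 / (2 * c₃ ^ 2) * c + c ^ 2) ^ 2 <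
      4 * (1 / (2 * c₃ ^ 2) * (S.d j + S.D j)) := by
    refine eventually_all.2 fun j => ?_
    have hcont : Continuous fun c : ℝ => (1 / (2 * c₃ ^ 2) * c + c ^ 2) ^ 2 := by fun_prop
    exact (hcont.continuousAt.eventually (gt_mem_nhds (hq j))).filter_mono nhdsWithin_le_nhds
  obtain ⟨c, hcq, hc3⟩ := (hc.and self_mem_nhdsWithin).exists
  have hc3' : c₃ < c := hc3
  have key : ∀ f : ℝ → ℝ, Continuous f → f cbar ≤ c₃ → ∀ᶠ r in 𝓝[>] cbar, f r ≤ c := by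
    intro f hf h
    have : ∀ᶠ r in 𝓝 cbar, f r < c := hf.continuousAt.eventually (gt_mem_nhds (h.trans_lt hc3'))
    filter_upwards [this.filter_mono nhdsWithin_le_nhds] with r hr using hr.le
  have k1 := key (fun r => c₂ * (1 + r)) (by fun_prop) hg.c₃_ge_rho
  have k2 := eventually_all.2 fun j => key (fun r => b j * (1 + r ^ 2)) (by fun_prop)
    (hg.c₃_ge_grad j)
  have k3 := eventually_all.2 fun j => key (fun r => |S.M j + (Dhat j - S.D j)| +
    eNorm (colG (S.s j) S.γ) * |S.M j| + S.kα * |S.M j| * (r + phibar j)) (by fun_prop)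
    (hg.c₃_ge_field j)
  obtain ⟨r, ⟨⟨hr1, hr2⟩, hr3⟩, hr⟩ := (((k1.and k2).and k3).and self_mem_nhdsWithin).exists
  -- With `A = p (d + D)` this `κ` satisfies `4κ (A + 1) = 4A - B²`, so `4 (A - κ)(1 - κ) = B² +
  -- 4κ²`.
  refine ⟨r, c, fun j => (4 * (1 / (2 * c₃ ^ 2) * (S.d j + S.D j)) -
    (1 / (2 * c₃ ^ 2) * c + c ^ 2) ^ 2) / (4 * (1 / (2 * c₃ ^ 2) * (S.d j + S.D j) + 1)), hr,
    by linarith, hr1, hr2, hr3, fun j => ?_⟩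
  have hj := hcq j
  set A := 1 / (2 * c₃ ^ 2) * (S.d j + S.D j)
  set B2 := (1 / (2 * c₃ ^ 2) * c + c ^ 2) ^ 2
  have hB : 0 ≤ B2 := sq_nonneg _
  have hA : 0 < A := by linarith
  have hA1 : 0 < 4 * (A + 1) := by linarith
  set κ := (4 * A - B2) / (4 * (A + 1)) with hκ
  have e : κ * (4 * (A + 1)) = 4 * A - B2 := div_mul_cancel₀ _ hA1.ne'
  refine ⟨div_pos (by linarith) hA1, (div_lt_one hA1).2 (by linarith), ?_⟩
  nlinarith [sq_nonneg κ]

/-- Decrease of the Lyapunov function where `‖ν_j‖ ≤ r`. -/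
theorem lyapunov_decrease (hS : S.WellPosed) {Dhat b phibar : Fin n → ℝ} {xs : S.State}
    (hxs : S.IsEquilibrium Dhat xs) {U : ∀ j, ℝ → S.NuSpace j → ℝ}
    {Ulow Uup : ∀ j, S.NuSpace j → ℝ}
    (hU : ∀ j, S.IsSubsystemLyapunov j (U j) (Ulow j) (Uup j) (b j)) {cbar c₂ c₃ r c : ℝ}
    (hg : S.GainCondition Dhat b phibar cbar c₂ c₃) {κ : Fin n → ℝ} (hc : 0 ≤ c)
    (hρ : c₂ * (1 + r) ≤ c) (hb : ∀ j, b j * (1 + r ^ 2) ≤ c)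
    (hf : ∀ j, |S.M j + (Dhat j - S.D j)| + eNorm (colG (S.s j) S.γ) * |S.M j| +
        S.kα * |S.M j| * (r + phibar j) ≤ c)
    (hκ : ∀ j, 0 < κ j ∧ κ j < 1 ∧ (1 / (2 * c₃ ^ 2) * c + c ^ 2) ^ 2 ≤
        4 * (1 / (2 * c₃ ^ 2) * (S.d j + S.D j) - κ j) * (1 - κ j))
    {x : ℝ → S.State} {t : ℝ} (ht : 0 ≤ t) (hr : ∀ j, ‖S.nu (x t) j‖ ≤ r)
    (hx : HasDerivWithinAt x (S.closedLoop Dhat t (x t)) (Set.Ici 0) t) :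
    ∃ v' ≤ -S.dissipation κ (1 / (2 * c₃ ^ 2)) (x t),
      HasDerivWithinAt (fun t => S.V c₃ U xs t (x t)) v' (Set.Ici 0) t := by
  set p := 1 / (2 * c₃ ^ 2) with hp
  have h3p : 0 < c₃ := by linarith [hg.c₃_ge_one]
  have hp0 : 0 < p := by rw [hp]; positivity
  have hν : ∀ j, HasDerivWithinAt (fun t => S.nu (x t) j)
      (S.nu (S.closedLoop Dhat t (x t)) j) (Set.Ici 0) t := fun j =>
    (S.nuL j).hasFDerivAt.comp_hasDerivWithinAt t hx
  have h1 := (hasDerivWithinAt_V1 (xs := xs) hx).const_mul p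
  rw [V1_closedLoop hS hxs] at h1
  have h2 := HasDerivWithinAt.fun_sum (u := Finset.univ) fun j _ =>
    hasDerivWithinAt_uncurry (hU j).contDiff (hν j)
  refine ⟨_, ?_, h1.add h2⟩
  have hj : ∀ j, p * (State.ω (x t) j * S.rho j t (State.ζ (x t) j) (State.α (x t) j) -
        (S.d j + S.D j) * State.ω (x t) j ^ 2) + (deriv (fun τ => U j τ (S.nu (x t) j)) t +
      fderiv ℝ (U j t) (S.nu (x t) j) (S.nu (S.closedLoop Dhat t (x t)) j)) ≤
      -(κ j * (State.ω (x t) j ^ 2 + ‖S.nu (x t) j‖ ^ 2)) := by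
    intro j
    have hφ := hg.phibar_bound j t ht
    have e1 := (abs_rho_le (x t) hφ (hg.c₂_ge j) (hr j)).trans
      (mul_le_mul_of_nonneg_right hρ (norm_nonneg _))
    have e2 := (norm_perturbation_le hS (a := S.M j + (Dhat j - S.D j)) (x t) hφ (hr j)).trans
      (hf j)
    have e3 := (hU j).decrease t ht (S.nu (x t) j)
    have e4 := (hU j).grad_le t ht (S.nu (x t) j)
    rw [nu_closedLoop hS, map_add]
    set g := S.mkNu j (S.M j + (Dhat j - S.D j)) (S.M j • colG (S.s j) S.γ)
        ((S.kα * S.M j) • Lam (S.s j) (State.ζ (x t) j + S.varphi j t))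
    set N := ‖S.nu (x t) j‖ with hN
    have hN0 : 0 ≤ N := norm_nonneg _
    set w := State.ω (x t) j
    have e5 : ‖fderiv ℝ (U j t) (S.nu (x t) j)‖ ≤ c * N := by
      refine e4.trans ?_
      have : N ^ 2 ≤ r ^ 2 := pow_le_pow_left₀ hN0 (hr j) 2
      have h7 : b j * (1 + N ^ 2) ≤ c :=
        (mul_le_mul_of_nonneg_left (by linarith) (hU j).b_pos.le).trans (hb j)
      have := mul_le_mul_of_nonneg_right h7 hN0
      calc b j * (N + N ^ 3) = b j * (1 + N ^ 2) * N := by ring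
        _ ≤ c * N := this
    have e6 : |fderiv ℝ (U j t) (S.nu (x t) j) ((-w) • g)| ≤ c * N * (|w| * c) := by
      refine ((fderiv ℝ (U j t) (S.nu (x t) j)).le_opNorm _).trans ?_
      rw [norm_smul, Real.norm_eq_abs, abs_neg]
      exact mul_le_mul e5 (mul_le_mul_of_nonneg_left e2 (abs_nonneg _)) (by positivity)
        (by positivity)
    have e7 := (abs_le.1 e6).2
    have e8 : w * S.rho j t (State.ζ (x t) j) (State.α (x t) j) ≤ |w| * (c * N) := by
      refine (le_abs_self _).trans ?_
      rw [abs_mul]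
      exact mul_le_mul_of_nonneg_left e1 (abs_nonneg _)
    obtain ⟨-, hκ1, hκ2⟩ := hκ j
    -- The cross terms `p c |ω| ‖ν‖` from `ρ` and `c² |ω| ‖ν‖` from the perturbation are absorbed,
    -- leaving `κ (ω² + ‖ν‖²)`.
    have e9 := quadratic_nonneg (x := |w|) (y := N) (sub_pos.2 hκ1) hκ2
    rw [sq_abs] at e9
    have e10 := mul_le_mul_of_nonneg_left e8 hp0.le
    linarith
  have hsum := Finset.sum_le_sum fun j (_ : j ∈ Finset.univ) => hj j
  rw [Finset.sum_add_distrib, ← Finset.mul_sum, Finset.sum_neg_distrib] at hsum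
  rw [dissipation]
  linarith

theorem dissipation_nonneg {κ : Fin n → ℝ} (hκ : ∀ j, 0 < κ j) {p : ℝ} (hp : 0 ≤ p)
    (x : S.State) : 0 ≤ S.dissipation κ p x := by
  refine add_nonneg (Finset.sum_nonneg fun j _ => ?_) (mul_nonneg hp ?_)
  · have := hκ j
    positivity
  · have := disagreement_nonneg (S := S) (State.μ x)
    positivity

end PowerSystem
end FreqControl

/-! ### Invariance, existence and decay along solutions -/

namespace FreqControl

/-- A `C¹` map times a bump function has compact support, hence is globally Lipschitz and bounded,
without being changed on the given ball. -/
theorem exists_cutoff {F G : Type*} [NormedAddCommGroup F] [NormedSpace ℝ F]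
    [FiniteDimensional ℝ F] [NormedAddCommGroup G] [NormedSpace ℝ G] {g : F → G}
    (hg : ContDiff ℝ 1 g) (R : ℝ) :
    ∃ h : F → G, (∀ z, ‖z‖ ≤ R → h z = g z) ∧ (∃ K, LipschitzWith K h) ∧
      ∃ L : NNReal, ∀ z, ‖h z‖ ≤ L := by
  let χ : ContDiffBump (0 : F) := ⟨|R| + 1, |R| + 2, by positivity, by linarith⟩
  have hs : HasCompactSupport fun z => χ z • g z := χ.hasCompactSupport.smul_right
  have hd : ContDiff ℝ 1 fun z => χ z • g z := χ.contDiff.smul hg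
  refine ⟨fun z => χ z • g z, fun z hz => ?_, hd.lipschitzWith_of_hasCompactSupport hs (by simp),
    ?_⟩
  · have : χ z = 1 := by
      apply χ.one_of_mem_closedBall
      rw [mem_closedBall_zero_iff]
      change ‖z‖ ≤ |R| + 1
      have := le_abs_self R
      linarith
    simp only [this, one_smul]
  · obtain ⟨L, hL⟩ := hs.exists_bound_of_continuous hd.continuous
    exact ⟨⟨max L 0, le_max_right _ _⟩, fun z => (hL z).trans (le_max_left _ _)⟩

/-- `V` decreases at rate `W` along the solutions of `x' = f t x` inside `O`, and `O` contains the
sublevel sets `V t ≤ c`. -/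
structure DecreasesOn {E : Type*} [NormedAddCommGroup E] [NormedSpace ℝ E] (f : ℝ → E → E)
    (V : ℝ → E → ℝ) (W : E → ℝ) (O : Set E) (c : ℝ) : Prop where
  isOpen : IsOpen O
  continuous : Continuous (Function.uncurry V)
  sublevel : ∀ t, 0 ≤ t → ∀ x, V t x ≤ c → x ∈ O
  nonneg : ∀ x, 0 ≤ W x
  decrease : ∀ (x : ℝ → E) (t : ℝ), 0 ≤ t → x t ∈ O →
    HasDerivWithinAt x (f t (x t)) (Set.Ici 0) t →
    ∃ v' ≤ -W (x t), HasDerivWithinAt (fun t => V t (x t)) v' (Set.Ici 0) t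

namespace DecreasesOn

variable {E P : Type*} [NormedAddCommGroup E] [NormedSpace ℝ E]
  [NormedAddCommGroup P] [NormedSpace ℝ P]

/-- The equation is assumed only while the curve is in `O`, so that the result also covers solutions
of a field modified outside `O`. Near a time with `V ≤ c` the curve stays in the open set `O`, where
`V` is nonincreasing. -/
theorem invariant {f : ℝ → E → E} {V : ℝ → E → ℝ} {W : E → ℝ} {O : Set E} {c : ℝ}
    (hD : DecreasesOn f V W O c) {x : ℝ → E} (hx : ContinuousOn x (Set.Ici 0))
    (hloc : ∀ t, 0 ≤ t → x t ∈ O → HasDerivWithinAt x (f t (x t)) (Set.Ici 0) t)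
    (h0 : V 0 (x 0) ≤ c) : ∀ t, 0 ≤ t → V t (x t) ≤ c := by
  apply le_of_barrier (v := fun t => V t (x t)) _ h0
  · intro t ht hv
    have hmem : ∀ᶠ u in 𝓝[≥] t, x u ∈ O := by
      have hc : ContinuousWithinAt x (Set.Ici t) t :=
        (hx t ht).mono (Set.Ici_subset_Ici.2 ht)
      exact hc.eventually_mem (hD.isOpen.mem_nhds (hD.sublevel t ht _ hv))
    filter_upwards [hmem, self_mem_nhdsWithin] with u hu htu
    have hu0 : 0 ≤ u := ht.trans htu
    obtain ⟨v', hv', hd⟩ := hD.decrease x u hu0 hu (hloc u hu0 hu)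
    exact ⟨v', hv'.trans (neg_nonpos.2 (hD.nonneg _)), hd⟩
  · exact hD.continuous.comp_continuousOn (continuousOn_id.prodMk hx)

/-- The truncated field has global solutions; by invariance such a solution never leaves `O`, where
the truncation is not felt. -/
theorem exists_solution [FiniteDimensional ℝ E] [FiniteDimensional ℝ P] {g : P × E → E}
    (hg : ContDiff ℝ 1 g) {p : ℝ → P} (hp : ContinuousOn p (Set.Ici 0)) {R : ℝ}
    (hpR : ∀ t, 0 ≤ t → ‖p t‖ ≤ R) {V : ℝ → E → ℝ} {W : E → ℝ} {O : Set E} {c : ℝ}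
    (hD : DecreasesOn (fun t x => g (p t, x)) V W O c) (hO : ∀ x ∈ O, ‖x‖ ≤ R) {x₀ : E}
    (h0 : V 0 x₀ ≤ c) :
    ∃ x : ℝ → E, x 0 = x₀ ∧ ∀ t, 0 ≤ t → HasDerivWithinAt x (g (p t, x t)) (Set.Ici 0) t := by
  have := FiniteDimensional.complete ℝ E
  obtain ⟨h, hh, ⟨K, hK⟩, L, hL⟩ := exists_cutoff hg R
  obtain ⟨x, hx0, hx⟩ := exists_global_solution (fun t x => h (p t, x)) K L
    (fun t _ => LipschitzWith.of_dist_le_mul fun x y => by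
      simpa [Prod.dist_eq] using hK.dist_le_mul (p t, x) (p t, y))
    (fun x => hK.continuous.comp_continuousOn (hp.prodMk continuousOn_const))
    (fun t _ x => hL _) x₀
  have hloc : ∀ t, 0 ≤ t → x t ∈ O → HasDerivWithinAt x (g (p t, x t)) (Set.Ici 0) t := by
    intro t ht hxt
    rw [← hh]
    · exact hx t ht
    · exact max_le (hpR t ht) (hO _ hxt)
  have hinv := hD.invariant (fun t ht => (hx t ht).continuousWithinAt) hloc (by rwa [hx0])
  exact ⟨x, hx0, fun t ht => hloc t ht (hD.sublevel t ht _ (hinv t ht))⟩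

/-- A bounded solution has bounded speed, and a `C¹` function is Lipschitz on bounded sets. This
gives the uniform continuity that the Barbalat lemma requires. -/
theorem lipschitz_of_solution [FiniteDimensional ℝ E] [FiniteDimensional ℝ P] {g : P × E → E}
    (hg : ContDiff ℝ 1 g) {p : ℝ → P} {R : ℝ} (hpR : ∀ t, 0 ≤ t → ‖p t‖ ≤ R) {x : ℝ → E}
    (hxR : ∀ t, 0 ≤ t → ‖x t‖ ≤ R)
    (hx : ∀ t, 0 ≤ t → HasDerivWithinAt x (g (p t, x t)) (Set.Ici 0) t) {h : E → ℝ}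
    (hh : ContDiff ℝ 1 h) :
    ∃ K, ∀ t u, 0 ≤ t → t ≤ u → |h (x u) - h (x t)| ≤ K * (u - t) := by
  obtain ⟨g', hg', -, L, hL⟩ := exists_cutoff hg R
  obtain ⟨h', hh', ⟨K, hK⟩, -⟩ := exists_cutoff hh R
  refine ⟨K * L, fun t u ht htu => ?_⟩
  have hu := ht.trans htu
  have h1 : ‖x u - x t‖ ≤ L * ‖u - t‖ :=
    (convex_Ici (0 : ℝ)).norm_image_sub_le_of_norm_hasDerivWithin_le (fun s hs => hx s hs)
      (fun s hs => by
        rw [← hg' _ (max_le (hpR s hs) (hxR s hs))]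
        exact hL _) ht hu
  rw [← hh' _ (hxR u hu), ← hh' _ (hxR t ht), ← Real.dist_eq]
  refine (hK.dist_le_mul _ _).trans ?_
  rw [mul_assoc, dist_eq_norm]
  refine mul_le_mul_of_nonneg_left (h1.trans_eq ?_) K.2
  rw [Real.norm_of_nonneg (sub_nonneg.2 htu)]

/-- `V` is nonincreasing and bounded below along the solution, hence converges, and `-V` has
derivative at least `W`. Barbalat then applies, since `W` is Lipschitz along the solution. -/
theorem tendsto_rate [FiniteDimensional ℝ E] [FiniteDimensional ℝ P] {g : P × E → E}
    (hg : ContDiff ℝ 1 g) {p : ℝ → P} {R : ℝ} (hpR : ∀ t, 0 ≤ t → ‖p t‖ ≤ R)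
    {V : ℝ → E → ℝ} {W : E → ℝ} {O : Set E} {c : ℝ}
    (hD : DecreasesOn (fun t x => g (p t, x)) V W O c) (hO : ∀ x ∈ O, ‖x‖ ≤ R)
    (hV : ∀ t, 0 ≤ t → ∀ x, 0 ≤ V t x) (hW : ContDiff ℝ 1 W) {x : ℝ → E}
    (hx : ∀ t, 0 ≤ t → HasDerivWithinAt x (g (p t, x t)) (Set.Ici 0) t)
    (h0 : V 0 (x 0) ≤ c) : Tendsto (fun t => W (x t)) atTop (𝓝 0) := by
  have hinv := hD.invariant (fun t ht => (hx t ht).continuousWithinAt) (fun t ht _ => hx t ht) h0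
  have hmem : ∀ t, 0 ≤ t → x t ∈ O := fun t ht => hD.sublevel t ht _ (hinv t ht)
  obtain ⟨K, hK⟩ := lipschitz_of_solution hg hpR (fun t ht => hO _ (hmem t ht)) hx hW
  have hex : ∀ t, ∃ v', 0 ≤ t → v' ≤ -W (x t) ∧
      HasDerivWithinAt (fun t => V t (x t)) v' (Set.Ici 0) t := fun t => by
    by_cases ht : 0 ≤ t
    · obtain ⟨v', h1, h2⟩ := hD.decrease x t ht (hmem t ht) (hx t ht)
      exact ⟨v', fun _ => ⟨h1, h2⟩⟩
    · exact ⟨0, fun h => absurd h ht⟩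
  choose v' hv' using hex
  have hanti : AntitoneOn (fun t => V t (x t)) (Set.Ici 0) := by
    refine antitoneOn_of_hasDerivWithinAt_nonpos (convex_Ici 0)
      (fun t ht => (hv' t ht).2.continuousWithinAt)
      (f' := v') (fun t ht => ((hv' t (interior_subset ht)).2).mono interior_subset)
      fun t ht => ((hv' t (interior_subset ht)).1).trans (neg_nonpos.2 (hD.nonneg _))
  have hlim : ∃ l, Tendsto (fun t => V t (x t)) atTop (𝓝 l) := by
    have h1 : Antitone fun t => V (max t 0) (x (max t 0)) := fun s t hst =>
      hanti (le_max_right s 0) (le_max_right t 0) (max_le_max_right 0 hst)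
    refine ⟨_, (tendsto_atTop_ciInf h1 ⟨0, ?_⟩).congr' ?_⟩
    · rintro _ ⟨t, rfl⟩
      exact hV _ (le_max_right _ _) _
    · filter_upwards [eventually_ge_atTop 0] with t ht
      rw [max_eq_left ht]
  obtain ⟨l, hl⟩ := hlim
  refine Metric.tendsto_nhds.2 fun ε hε => ?_
  have := eventually_le_of_deriv_ge (G := fun t => -V t (x t)) (G' := fun t => -v' t)
    (h := fun t => W (x t)) (r := fun _ => 0) (fun t ht => (hv' t ht).2.neg)
    (fun t ht => by have := (hv' t ht).1; linarith) hK tendsto_const_nhds hl.neg (half_pos hε)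
  filter_upwards [this] with t ht
  rw [Real.dist_eq, sub_zero, abs_of_nonneg (hD.nonneg _)]
  linarith

end DecreasesOn

end FreqControl

/-! ### Bounded sublevel sets and invariance of angle differences -/

namespace FreqControl

theorem exists_norm_le_pi {X ι : Type*} [Fintype ι] {E : ι → Type*}
    [∀ i, SeminormedAddCommGroup (E i)] {A : X → Prop} {f : X → ∀ i, E i}
    (h : ∀ i, ∃ C, ∀ x, A x → ‖f x i‖ ≤ C) : ∃ C, ∀ x, A x → ‖f x‖ ≤ C := by
  choose C hC using h
  refine ⟨∑ i, |C i|, fun x hx => ?_⟩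
  rw [pi_norm_le_iff_of_nonneg (Finset.sum_nonneg fun i _ => abs_nonneg _)]
  exact fun i => ((hC i x hx).trans (le_abs_self _)).trans
    (Finset.single_le_sum (f := fun i => |C i|) (fun i _ => abs_nonneg _) (Finset.mem_univ i))

theorem IsProperPosDef.nonneg {X : Type*} [TopologicalSpace X] {f : X → ℝ} {p : X}
    (hf : IsProperPosDef f p) (x : X) : 0 ≤ f x := by
  by_cases hx : x = p
  · rw [hx, hf.eq_zero]
  · exact (hf.pos x hx).le

theorem abs_le_of_mul_sq_sub_le {b u v K : ℝ} (hb : 0 < b) (h : b * (u - v) ^ 2 ≤ K) :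
    |u| ≤ |v| + 1 + K / b := by
  have h1 : (u - v) ^ 2 ≤ K / b := by
    rw [le_div_iff₀ hb, mul_comm]
    exact h
  have h2 : |u| ≤ |v| + |u - v| := by
    have := abs_add_le v (u - v)
    rwa [add_sub_cancel] at this
  have h3 : |u - v| ≤ 1 + (u - v) ^ 2 := by
    rw [← sq_abs (u - v)]
    nlinarith [sq_nonneg (|u - v| - 1)]
  linarith

namespace PowerSystem

variable {n : ℕ} {S : PowerSystem n}

theorem V1_nonneg (hS : S.WellPosed) (xs x : S.State) : 0 ≤ S.V1 xs x := by
  have h1 := fun e => (hS.B_pos e).le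
  have h2 := fun j => (hS.M_pos j).le
  refine mul_nonneg (by norm_num) (add_nonneg (add_nonneg ?_ ?_) ?_)
  · exact Finset.sum_nonneg fun e _ => mul_nonneg (h1 e) (sq_nonneg _)
  · exact Finset.sum_nonneg fun e _ => mul_nonneg (h2 e) (sq_nonneg _)
  · exact Finset.sum_nonneg fun e _ => sq_nonneg _

theorem terms_le_V1 (hS : S.WellPosed) (xs x : S.State) :
    (∀ e, S.B e * (State.θ x e - State.θ xs e) ^ 2 ≤ 2 * S.V1 xs x) ∧
      (∀ j, S.M j * (State.ω x j - State.ω xs j) ^ 2 ≤ 2 * S.V1 xs x) ∧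
      ∀ j, 1 * (State.μ x j - State.μ xs j) ^ 2 ≤ 2 * S.V1 xs x := by
  have h1 : ∀ e, 0 ≤ S.B e * (State.θ x e - State.θ xs e) ^ 2 := fun e =>
    mul_nonneg (hS.B_pos e).le (sq_nonneg _)
  have h2 : ∀ j, 0 ≤ S.M j * (State.ω x j - State.ω xs j) ^ 2 := fun j =>
    mul_nonneg (hS.M_pos j).le (sq_nonneg _)
  have h3 : ∀ j, 0 ≤ (State.μ x j - State.μ xs j) ^ 2 := fun j => sq_nonneg _
  have s1 := Finset.sum_nonneg fun e (_ : e ∈ Finset.univ) => h1 e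
  have s2 := Finset.sum_nonneg fun e (_ : e ∈ Finset.univ) => h2 e
  have s3 := Finset.sum_nonneg fun e (_ : e ∈ Finset.univ) => h3 e
  have hV : 2 * S.V1 xs x = ((∑ e, S.B e * (State.θ x e - State.θ xs e) ^ 2) +
    (∑ j, S.M j * (State.ω x j - State.ω xs j) ^ 2) +
    ∑ j, (State.μ x j - State.μ xs j) ^ 2) := by
    rw [V1]
    ring
  rw [hV]
  refine ⟨fun e => ?_, fun j => ?_, fun j => ?_⟩
  · have := Finset.single_le_sum (fun e _ => h1 e) (Finset.mem_univ e)
    linarith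
  · have := Finset.single_le_sum (fun e _ => h2 e) (Finset.mem_univ j)
    linarith
  · have := Finset.single_le_sum (fun e _ => h3 e) (Finset.mem_univ j)
    linarith

section Lyapunov

variable {U : ∀ j, ℝ → S.NuSpace j → ℝ} {Ulow Uup : ∀ j, S.NuSpace j → ℝ} {b : Fin n → ℝ}

theorem IsSubsystemLyapunov.nonneg {j : Fin n} {U : ℝ → S.NuSpace j → ℝ}
    {Ulow Uup : S.NuSpace j → ℝ} {b : ℝ} (hU : S.IsSubsystemLyapunov j U Ulow Uup b) {t : ℝ}
    (ht : 0 ≤ t) (ν : S.NuSpace j) : 0 ≤ U t ν :=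
  (hU.low.nonneg ν).trans (hU.low_le t ht ν)

theorem V_nonneg (hS : S.WellPosed)
    (hU : ∀ j, S.IsSubsystemLyapunov j (U j) (Ulow j) (Uup j) (b j)) (c₃ : ℝ) (xs : S.State)
    {t : ℝ} (ht : 0 ≤ t) (x : S.State) : 0 ≤ S.V c₃ U xs t x :=
  add_nonneg (mul_nonneg (by positivity) (V1_nonneg hS xs x))
    (Finset.sum_nonneg fun j _ => (hU j).nonneg ht _)

theorem continuous_V (hU : ∀ j, S.IsSubsystemLyapunov j (U j) (Ulow j) (Uup j) (b j)) (c₃ : ℝ)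
    (xs : S.State) : Continuous (Function.uncurry (S.V c₃ U xs)) := by
  have h1 : Continuous fun z : ℝ × S.State => S.V1 xs z.2 := by
    unfold V1 State.θ State.ω State.μ
    fun_prop
  have h2 : ∀ j, Continuous fun z : ℝ × S.State => U j z.1 (S.nu z.2 j) := fun j =>
    (hU j).contDiff.continuous.comp
      (continuous_fst.prodMk ((S.nuL j).continuous.comp continuous_snd))
  exact (continuous_const.mul h1).add (continuous_finsetSum _ fun j _ => h2 j)

/-- `V1` controls `θ̃`, `ω` and `μ`; `cbar` controls `ζ̃`, `α̃` and `η̃ - M ω`, and `η̃` follows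
from the last bound and that of `ω`. -/
theorem exists_norm_le_of_V_le (hS : S.WellPosed)
    (hU : ∀ j, S.IsSubsystemLyapunov j (U j) (Ulow j) (Uup j) (b j)) {c₃ ctilde cbar : ℝ}
    (hc₃ : 0 < c₃) (hcbar : ∀ t, 0 ≤ t → ∀ ν : (∀ j, S.NuSpace j), ∑ j, U j t (ν j) ≤ ctilde →
      ∀ j, ‖ν j‖ ≤ cbar) (xs : S.State) :
    ∃ R, ∀ t, 0 ≤ t → ∀ x, S.V c₃ U xs t x ≤ ctilde → ‖x‖ ≤ R ∧ ∀ j, ‖S.nu x j‖ ≤ cbar := by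
  have hν : ∀ t, 0 ≤ t → ∀ x, S.V c₃ U xs t x ≤ ctilde → ∀ j, ‖S.nu x j‖ ≤ cbar := by
    intro t ht x hx
    refine hcbar t ht (S.nu x) (le_trans ?_ hx)
    exact le_add_of_nonneg_left (mul_nonneg (by positivity) (V1_nonneg hS xs x))
  have hV1 : ∀ t, 0 ≤ t → ∀ x, S.V c₃ U xs t x ≤ ctilde →
      2 * S.V1 xs x ≤ 2 * ((2 * c₃ ^ 2) * ctilde) := by
    intro t ht x hx
    have h1 : 1 / (2 * c₃ ^ 2) * S.V1 xs x ≤ ctilde :=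
      (le_add_of_nonneg_right (Finset.sum_nonneg fun j _ => (hU j).nonneg ht _)).trans hx
    rw [one_div, inv_mul_le_iff₀ (by positivity)] at h1
    linarith
  set K := 2 * ((2 * c₃ ^ 2) * ctilde)
  let A : S.State → Prop := fun x => ∃ t, 0 ≤ t ∧ S.V c₃ U xs t x ≤ ctilde
  have hA : ∀ x, A x → (∀ j, ‖S.nu x j‖ ≤ cbar) ∧ 2 * S.V1 xs x ≤ K := fun x ⟨t, ht, hx⟩ =>
    ⟨hν t ht x hx, hV1 t ht x hx⟩
  have hωb : ∀ j, ∀ x, A x → |State.ω x j| ≤ |State.ω xs j| + 1 + K / S.M j := fun j x hx =>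
    abs_le_of_mul_sq_sub_le (hS.M_pos j) (((terms_le_V1 hS xs x).2.1 j).trans (hA x hx).2)
  obtain ⟨C1, h1⟩ := exists_norm_le_pi (A := A) (f := State.θ) fun e => ⟨_, fun x hx =>
    abs_le_of_mul_sq_sub_le (hS.B_pos e) (((terms_le_V1 hS xs x).1 e).trans (hA x hx).2)⟩
  obtain ⟨C2, h2⟩ := exists_norm_le_pi (A := A) (f := State.ω) fun j => ⟨_, hωb j⟩
  obtain ⟨C3, h3⟩ := exists_norm_le_pi (A := A) (f := State.μ) fun j => ⟨_, fun x hx =>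
    abs_le_of_mul_sq_sub_le one_pos (((terms_le_V1 hS xs x).2.2 j).trans (hA x hx).2)⟩
  obtain ⟨C4, h4⟩ := exists_norm_le_pi (A := A) (f := State.η) fun j =>
    ⟨cbar + S.M j * (|State.ω xs j| + 1 + K / S.M j), fun x hx => by
      have h5 := (abs_eta_sub_le x j).trans ((hA x hx).1 j)
      have h6 := mul_le_mul_of_nonneg_left (hωb j x hx) (hS.M_pos j).le
      have h7 := abs_add_le (State.η x j - S.M j * State.ω x j) (S.M j * State.ω x j)
      rw [sub_add_cancel, abs_mul, abs_of_pos (hS.M_pos j)] at h7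
      exact h7.trans (add_le_add h5 h6)⟩
  obtain ⟨C5, h5⟩ := exists_norm_le_pi (A := A) (f := State.ζ) fun j =>
    exists_norm_le_pi (f := fun x => State.ζ x j) fun i => ⟨cbar, fun x hx =>
      (abs_apply_le_eNorm _ i).trans ((eNorm_zeta_le x j).trans ((hA x hx).1 j))⟩
  obtain ⟨C6, h6⟩ := exists_norm_le_pi (A := A) (f := State.α) fun j =>
    exists_norm_le_pi (f := fun x => State.α x j) fun i => ⟨cbar, fun x hx =>
      (abs_apply_le_eNorm _ i).trans ((eNorm_alpha_le x j).trans ((hA x hx).1 j))⟩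
  refine ⟨max C1 (max C2 (max C3 (max C4 (max C5 C6)))), fun t ht x hx => ⟨?_, hν t ht x hx⟩⟩
  have hAx : A x := ⟨t, ht, hx⟩
  exact max_le_max (h1 x hAx) (max_le_max (h2 x hAx) (max_le_max (h3 x hAx)
    (max_le_max (h4 x hAx) (max_le_max (h5 x hAx) (h6 x hAx)))))

theorem contDiff_dissipation (κ : Fin n → ℝ) (p : ℝ) : ContDiff ℝ 1 (S.dissipation κ p) := by
  classical
  have hω : ∀ j, ContDiff ℝ 1 fun x : S.State => State.ω x j := fun j =>
    (contDiff_apply ℝ ℝ j).comp (contDiff_fst.comp contDiff_snd)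
  have hμ : ∀ j, ContDiff ℝ 1 fun x : S.State => State.μ x j := fun j =>
    (contDiff_apply ℝ ℝ j).comp (contDiff_fst.comp (contDiff_snd.comp contDiff_snd))
  refine ContDiff.add (ContDiff.sum fun j _ => contDiff_const.mul (((hω j).pow 2).add
    ((S.nuL j).contDiff.norm_sq ℝ))) (contDiff_const.mul (ContDiff.div_const ?_ _))
  refine ContDiff.sum fun j _ => ContDiff.sum fun k _ => ?_
  split_ifs
  · exact ((hμ j).sub (hμ k)).mul ((hμ j).sub (hμ k))
  · exact contDiff_const

theorem exists_varphi_le {Dhat phibar : Fin n → ℝ} {cbar c₂ c₃ : ℝ}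
    (hg : S.GainCondition Dhat b phibar cbar c₂ c₃) :
    ∃ R, ∀ t, 0 ≤ t → ‖fun j => S.varphi j t‖ ≤ R :=
  exists_norm_le_pi (A := fun t : ℝ => 0 ≤ t) (f := fun t j => S.varphi j t) fun j =>
    exists_norm_le_pi (f := fun t => S.varphi j t) fun i => ⟨phibar j, fun t ht =>
      (abs_apply_le_eNorm _ i).trans (hg.phibar_bound j t ht)⟩

theorem exists_decreasesOn (hS : S.WellPosed) {Dhat phibar : Fin n → ℝ} {xs : S.State}
    (hxs : S.IsEquilibrium Dhat xs)
    (hU : ∀ j, S.IsSubsystemLyapunov j (U j) (Ulow j) (Uup j) (b j)) {ctilde cbar c₂ c₃ : ℝ}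
    (hcbar : ∀ t, 0 ≤ t → ∀ ν : (∀ j, S.NuSpace j), ∑ j, U j t (ν j) ≤ ctilde →
      ∀ j, ‖ν j‖ ≤ cbar)
    (hg : S.GainCondition Dhat b phibar cbar c₂ c₃) :
    ∃ (κ : Fin n → ℝ) (p R : ℝ) (O : Set S.State), (∀ j, 0 < κ j) ∧ 0 < p ∧
      (∀ x ∈ O, ‖x‖ ≤ R) ∧ (∀ t, 0 ≤ t → ‖fun j => S.varphi j t‖ ≤ R) ∧
      DecreasesOn (fun t x => S.fieldOf Dhat (fun j => S.varphi j t, x)) (S.V c₃ U xs)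
        (S.dissipation κ p) O ctilde := by
  have hc₃ : 0 < c₃ := one_pos.trans_le hg.c₃_ge_one
  obtain ⟨r, c, κ, hr, hc, hρ, hb, hf, hκ⟩ := hg.exists_slack
  obtain ⟨R, hR⟩ := exists_norm_le_of_V_le hS hU hc₃ hcbar xs
  obtain ⟨R', hR'⟩ := exists_varphi_le hg
  have hp : 0 < 1 / (2 * c₃ ^ 2) := by positivity
  refine ⟨κ, 1 / (2 * c₃ ^ 2), max (R + 1) R', {x | ‖x‖ < R + 1 ∧ ∀ j, ‖S.nu x j‖ < r},
    fun j => (hκ j).1, hp, fun x hx => hx.1.le.trans (le_max_left _ _),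
    fun t ht => (hR' t ht).trans (le_max_right _ _), ?_, continuous_V hU c₃ xs, ?_,
    dissipation_nonneg (fun j => (hκ j).1) hp.le, ?_⟩
  · have : {x : S.State | ‖x‖ < R + 1 ∧ ∀ j, ‖S.nu x j‖ < r} =
        {x : S.State | ‖x‖ < R + 1} ∩ ⋂ j, {x : S.State | ‖S.nu x j‖ < r} := by
      ext x
      simp
    rw [this]
    exact (isOpen_lt continuous_norm continuous_const).inter (isOpen_iInter_of_finite fun j =>
      isOpen_lt (S.nuL j).continuous.norm continuous_const)
  · intro t ht x hx
    obtain ⟨h1, h2⟩ := hR t ht x hx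
    exact ⟨by linarith, fun j => (h2 j).trans_lt hr⟩
  · intro x t ht hx hd
    refine lyapunov_decrease hS hxs hU hg hc hρ hb hf hκ ht (fun j => (hx.2 j).le) ?_
    rw [closedLoop_eq]
    exact hd

end Lyapunov

/-- The velocity of `θ̃` always lies in the subspace of angle differences, so each linear functional
vanishing on that subspace is constant along the solution. -/
theorem isAngleDifference_of_solution {Dhat : Fin n → ℝ} {x : ℝ → S.State}
    (hx : ∀ t, 0 ≤ t → HasDerivWithinAt x (S.closedLoop Dhat t (x t)) (Set.Ici 0) t)
    (h0 : IsAngleDifference (x 0)) {t : ℝ} (ht : 0 ≤ t) : IsAngleDifference (x t) := by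
  rw [isAngleDifference_iff] at h0 ⊢
  by_contra hcon
  obtain ⟨f, hf, hle⟩ := Submodule.exists_le_ker_of_notMem hcon
  let F := LinearMap.toContinuousLinearMap f
  have hd : ∀ s, 0 ≤ s → HasDerivWithinAt (fun s => F (State.θ (x s))) 0 (Set.Ici 0) s := by
    intro s hs
    have h1 : HasDerivWithinAt (fun s => State.θ (x s))
        (State.θ (S.closedLoop Dhat s (x s))) (Set.Ici 0) s := (hx s hs).fst
    have h2 : State.θ (S.closedLoop Dhat s (x s)) ∈ LinearMap.range S.diffLin :=
      ⟨State.ω (x s), rfl⟩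
    have h3 : F (State.θ (S.closedLoop Dhat s (x s))) = 0 := hle h2
    exact (F.hasFDerivAt.comp_hasDerivWithinAt s h1).congr_deriv h3
  have h1 := (convex_Ici (0 : ℝ)).norm_image_sub_le_of_norm_hasDerivWithin_le (C := 0)
    (fun s hs => hd s hs) (fun s _ => by simp) (Set.self_mem_Ici) (Set.mem_Ici.2 ht)
  have h2 : F (State.θ (x 0)) = 0 := hle h0
  rw [h2, sub_zero, zero_mul] at h1
  exact hf (norm_le_zero_iff.1 h1)

end PowerSystem
end FreqControl

/-! ### Convergence to the equilibrium -/

namespace FreqControl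

theorem tendsto_zero_of_mul_sq_le {f W : ℝ → ℝ} {k : ℝ} (hk : 0 < k)
    (h : ∀ t, k * f t ^ 2 ≤ W t) (hW : Tendsto W atTop (𝓝 0)) : Tendsto f atTop (𝓝 0) := by
  have h1 : Tendsto (fun t => √(W t / k)) atTop (𝓝 0) := by
    simpa using (hW.div_const k).sqrt
  refine squeeze_zero_norm (fun t => ?_) h1
  rw [Real.norm_eq_abs]
  refine Real.abs_le_sqrt ?_
  rw [le_div_iff₀ hk, mul_comm]
  exact h t

theorem tendsto_sub_of_connected {n : ℕ} {G : SimpleGraph (Fin n)} (hG : G.Connected)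
    {u : ℝ → Fin n → ℝ}
    (h : ∀ i j, G.Adj i j → Tendsto (fun t => u t i - u t j) atTop (𝓝 0)) (i j : Fin n) :
    Tendsto (fun t => u t i - u t j) atTop (𝓝 0) := by
  obtain ⟨p⟩ := hG.preconnected i j
  induction p with
  | nil => simp
  | cons hadj _ ih => simpa using (h _ _ hadj).add ih

namespace PowerSystem

variable {n : ℕ} {S : PowerSystem n}

theorem flow_sub (θ θ' : S.E → ℝ) (j : Fin n) :
    S.flow (θ - θ') j = S.flow θ j - S.flow θ' j :=
  congrFun (map_sub S.flowLin θ θ') j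

theorem tendsto_of_dissipation {κ : Fin n → ℝ} (hκ : ∀ j, 0 < κ j) {p : ℝ} (hp : 0 < p)
    {x : ℝ → S.State} (h : Tendsto (fun t => S.dissipation κ p (x t)) atTop (𝓝 0)) :
    (∀ j, Tendsto (fun t => State.ω (x t) j) atTop (𝓝 0)) ∧
      (∀ j, Tendsto (fun t => ‖S.nu (x t) j‖) atTop (𝓝 0)) ∧
      ∀ i j, S.H.Adj i j → Tendsto (fun t => State.μ (x t) i - State.μ (x t) j) atTop (𝓝 0) := by
  have hd : ∀ t, 0 ≤ p * (S.disagreement (State.μ (x t)) / 2) := fun t => by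
    have := disagreement_nonneg (S := S) (State.μ (x t))
    positivity
  have hnn : ∀ t j, 0 ≤ κ j * (State.ω (x t) j ^ 2 + ‖S.nu (x t) j‖ ^ 2) := fun t j => by
    have := hκ j
    positivity
  have h1 : ∀ t j, κ j * (State.ω (x t) j ^ 2 + ‖S.nu (x t) j‖ ^ 2) ≤
      S.dissipation κ p (x t) := fun t j =>
    (Finset.single_le_sum (fun j _ => hnn t j) (Finset.mem_univ j)).trans
      (le_add_of_nonneg_right (hd t))
  refine ⟨fun j => tendsto_zero_of_mul_sq_le (hκ j) (fun t => ?_) h,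
    fun j => tendsto_zero_of_mul_sq_le (hκ j) (fun t => ?_) h,
    fun i j hij => tendsto_zero_of_mul_sq_le (half_pos hp) (fun t => ?_) h⟩
  · refine (mul_le_mul_of_nonneg_left ?_ (hκ j).le).trans (h1 t j)
    exact le_add_of_nonneg_right (sq_nonneg _)
  · refine (mul_le_mul_of_nonneg_left ?_ (hκ j).le).trans (h1 t j)
    exact le_add_of_nonneg_left (sq_nonneg _)
  · have h2 := mul_le_mul_of_nonneg_left
      (sq_sub_le_disagreement (S := S) (State.μ (x t)) hij) (half_pos hp).le
    have h3 := Finset.sum_nonneg fun j (_ : j ∈ Finset.univ) => hnn t j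
    rw [dissipation]
    linarith

theorem tendsto_rho {b Dhat phibar : Fin n → ℝ} {cbar c₂ c₃ : ℝ}
    (hg : S.GainCondition Dhat b phibar cbar c₂ c₃) {x : ℝ → S.State} {j : Fin n}
    (h : Tendsto (fun t => ‖S.nu (x t) j‖) atTop (𝓝 0)) :
    Tendsto (fun t => S.rho j t (State.ζ (x t) j) (State.α (x t) j)) atTop (𝓝 0) := by
  refine squeeze_zero_norm' ?_ (by simpa using h.const_mul (c₂ * (1 + 1)))
  filter_upwards [eventually_ge_atTop 0, h.eventually (ge_mem_nhds one_pos)] with t ht h1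
  exact abs_rho_le (x t) (hg.phibar_bound j t ht) (hg.c₂_ge j) h1

/-- Once the dissipation tends to `0`, so does the power mismatch at each node. -/
theorem tendsto_mismatch (hS : S.WellPosed) {b Dhat phibar : Fin n → ℝ} {cbar c₂ c₃ : ℝ}
    (hg : S.GainCondition Dhat b phibar cbar c₂ c₃) {R : ℝ}
    (hR : ∀ t, 0 ≤ t → ‖fun j => S.varphi j t‖ ≤ R) {x : ℝ → S.State}
    (hxR : ∀ t, 0 ≤ t → ‖x t‖ ≤ R)
    (hx : ∀ t, 0 ≤ t → HasDerivWithinAt x (S.closedLoop Dhat t (x t)) (Set.Ici 0) t)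
    (hω : ∀ j, Tendsto (fun t => State.ω (x t) j) atTop (𝓝 0))
    (hν : ∀ j, Tendsto (fun t => ‖S.nu (x t) j‖) atTop (𝓝 0)) (j : Fin n) :
    Tendsto (fun t => S.P j + S.flow (State.θ (x t)) j - State.μ (x t) j / S.β j) atTop (𝓝 0) := by
  have hM := hS.M_pos j
  set h : S.State → ℝ := fun x =>
    (1 / S.M j) * (S.P j + S.flow (State.θ x) j - State.μ x j / S.β j)
  have hh : ContDiff ℝ 1 h := by
    have hμ : ContDiff ℝ 1 fun x : S.State => State.μ x j :=
      (contDiff_apply ℝ ℝ j).comp (contDiff_fst.comp (contDiff_snd.comp contDiff_snd))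
    exact contDiff_const.mul ((contDiff_const.add (contDiff_flow contDiff_fst j)).sub
      (hμ.div_const _))
  obtain ⟨K, hK⟩ := DecreasesOn.lipschitz_of_solution (contDiff_fieldOf Dhat) hR hxR
    (fun t ht => by rw [← closedLoop_eq]; exact hx t ht) hh
  set r : ℝ → ℝ := fun t => (1 / S.M j) * (S.rho j t (State.ζ (x t) j) (State.α (x t) j) -
    S.d j * State.ω (x t) j - S.D j * State.ω (x t) j)
  have hr : Tendsto r atTop (𝓝 0) := by
    simpa [r] using (((tendsto_rho hg (hν j)).sub ((hω j).const_mul (S.d j))).sub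
      ((hω j).const_mul (S.D j))).const_mul (1 / S.M j)
  have hd : ∀ t, 0 ≤ t →
      HasDerivWithinAt (fun t => State.ω (x t) j) (h (x t) + r t) (Set.Ici 0) t := by
    intro t ht
    have h1 : HasDerivWithinAt (fun t => State.ω (x t) j)
      (State.ω (S.closedLoop Dhat t (x t)) j) (Set.Ici 0) t :=
      hasDerivWithinAt_pi.1 (hx t ht).snd.fst j
    refine h1.congr_deriv ?_
    change (1 / S.M j) * (S.P j + S.rho j t (State.ζ (x t) j) (State.α (x t) j) +
      S.flow (State.θ (x t)) j - State.μ (x t) j / S.β j - S.d j * State.ω (x t) j -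
      S.D j * State.ω (x t) j) = _
    simp only [h, r]
    ring
  have hlim : Tendsto (fun t => h (x t)) atTop (𝓝 0) := by
    refine Metric.tendsto_nhds.2 fun ε hε => ?_
    -- `ω_j` converges and its derivative is `h + r` with `r → 0`. Barbalat for `ω_j` bounds `h`
    -- from above, and for `-ω_j` from below.
    have h1 := eventually_le_of_deriv_ge hd (fun t _ => le_rfl) hK hr (hω j) (half_pos hε)
    have h2 := eventually_le_of_deriv_ge (h := fun t => -h (x t)) (r := fun t => -r t)
      (fun t ht => (hd t ht).neg) (fun t _ => by linarith)
      (K := K) (fun t u ht htu => by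
        rw [neg_sub_neg, abs_sub_comm]
        exact hK t u ht htu) (by simpa using hr.neg) (hω j).neg (half_pos hε)
    filter_upwards [h1, h2] with t ht1 ht2
    rw [Real.dist_eq, sub_zero]
    exact abs_lt.2 ⟨by linarith, by linarith⟩
  have := hlim.const_mul (S.M j)
  simp only [h, ← mul_assoc, mul_one_div_cancel hM.ne', one_mul, mul_zero] at this
  exact this

/-- Summing the mismatches over the nodes eliminates the flows, so the weighted mean of `μ` tends to
`c`; together with the vanishing disagreement this gives the limit of every `μ_j`. The flow then
converges, and its lower bound on angle differences carries this over to `θ̃`. -/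
theorem tendsto_equilibrium (hS : S.WellPosed) {Dhat : Fin n → ℝ} {xs : S.State}
    (hxs : S.IsEquilibrium Dhat xs) {x : ℝ → S.State}
    (hθ : ∀ t, 0 ≤ t → IsAngleDifference (x t))
    (hω : ∀ j, Tendsto (fun t => State.ω (x t) j) atTop (𝓝 0))
    (hν : ∀ j, Tendsto (fun t => ‖S.nu (x t) j‖) atTop (𝓝 0))
    (hμ : ∀ i j, S.H.Adj i j →
      Tendsto (fun t => State.μ (x t) i - State.μ (x t) j) atTop (𝓝 0))
    (he : ∀ j, Tendsto (fun t => S.P j + S.flow (State.θ (x t)) j - State.μ (x t) j / S.β j)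
      atTop (𝓝 0)) : Tendsto x atTop (𝓝 xs) := by
  obtain ⟨hθs, hωs, hηs, hζs, hαs, c, hμs, hP⟩ := (isEquilibrium_iff hS Dhat xs).1 hxs
  have hdiff := tendsto_sub_of_connected hS.comm_connected hμ
  have hsumP : ∑ j, S.P j = ∑ j, c / S.β j := by
    have h1 := Finset.sum_eq_zero fun j (_ : j ∈ Finset.univ) => hP j
    rw [Finset.sum_sub_distrib, Finset.sum_add_distrib, sum_flow] at h1
    linarith
  have hβ : 0 < ∑ j, 1 / S.β j := by
    have := hS.nonempty
    exact Finset.sum_pos (fun j _ => one_div_pos.2 (hS.β_pos j)) Finset.univ_nonempty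
  have hμlim : ∀ j, Tendsto (fun t => State.μ (x t) j - c) atTop (𝓝 0) := by
    intro k
    have h1 : Tendsto (fun t => (∑ j, (State.μ (x t) k - State.μ (x t) j) / S.β j -
        ∑ j, (S.P j + S.flow (State.θ (x t)) j - State.μ (x t) j / S.β j)) / ∑ j, 1 / S.β j)
        atTop (𝓝 0) := by
      have := ((tendsto_finsetSum Finset.univ fun j _ => (hdiff k j).div_const (S.β j)).sub
        (tendsto_finsetSum Finset.univ fun j _ => he j)).div_const (∑ j, 1 / S.β j)
      simpa using this
    refine h1.congr fun t => ?_
    rw [div_eq_iff hβ.ne', Finset.sum_sub_distrib, Finset.sum_add_distrib, sum_flow, hsumP,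
      Finset.mul_sum, add_zero, ← Finset.sum_sub_distrib, ← Finset.sum_sub_distrib]
    exact Finset.sum_congr rfl fun j _ => by ring
  have hθlim : Tendsto (fun t => State.θ (x t)) atTop (𝓝 (State.θ xs)) := by
    obtain ⟨k, hk, hflow⟩ := flow_bounded_below hS
    have h1 : Tendsto (fun t => S.flow (State.θ (x t) - State.θ xs)) atTop (𝓝 0) := by
      refine tendsto_pi_nhds.2 fun j => ?_
      have h2 := (he j).add ((hμlim j).div_const (S.β j))
      rw [zero_div, add_zero] at h2
      refine h2.congr fun t => ?_
      rw [flow_sub]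
      have := hP j
      linear_combination this
    rw [tendsto_iff_norm_sub_tendsto_zero]
    have h3 : Tendsto (fun t => ‖S.flow (State.θ (x t) - State.θ xs)‖ / k) atTop (𝓝 0) := by
      simpa using h1.norm.div_const k
    refine squeeze_zero' (Eventually.of_forall fun t => norm_nonneg _) ?_ h3
    filter_upwards [eventually_ge_atTop 0] with t ht
    rw [le_div_iff₀ hk, mul_comm]
    exact hflow _ (sub_mem ((isAngleDifference_iff _).1 (hθ t ht)) hθs)
  have hηlim : ∀ j, Tendsto (fun t => State.η (x t) j) atTop (𝓝 0) := by
    intro j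
    have h1 : Tendsto (fun t => State.η (x t) j - S.M j * State.ω (x t) j) atTop (𝓝 0) :=
      squeeze_zero_norm (fun t => abs_eta_sub_le (x t) j) (hν j)
    simpa using h1.add ((hω j).const_mul (S.M j))
  have hωlim : Tendsto (fun t => State.ω (x t)) atTop (𝓝 (State.ω xs)) := by
    rw [hωs]
    exact tendsto_pi_nhds.2 hω
  have hμlim' : Tendsto (fun t => State.μ (x t)) atTop (𝓝 (State.μ xs)) := by
    refine tendsto_pi_nhds.2 fun j => ?_
    rw [hμs j]
    simpa using (hμlim j).add_const c
  have hηlim' : Tendsto (fun t => State.η (x t)) atTop (𝓝 (State.η xs)) := by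
    rw [hηs]
    exact tendsto_pi_nhds.2 hηlim
  have hζlim : Tendsto (fun t => State.ζ (x t)) atTop (𝓝 (State.ζ xs)) := by
    rw [hζs]
    exact tendsto_pi_nhds.2 fun j => tendsto_pi_nhds.2 fun i => squeeze_zero_norm
      (fun t => (abs_apply_le_eNorm _ i).trans (eNorm_zeta_le (x t) j)) (hν j)
  have hαlim : Tendsto (fun t => State.α (x t)) atTop (𝓝 (State.α xs)) := by
    rw [hαs]
    exact tendsto_pi_nhds.2 fun j => tendsto_pi_nhds.2 fun i => squeeze_zero_norm
      (fun t => (abs_apply_le_eNorm _ i).trans (eNorm_alpha_le (x t) j)) (hν j)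
  exact hθlim.prodMk_nhds (hωlim.prodMk_nhds (hμlim'.prodMk_nhds (hηlim'.prodMk_nhds
    (hζlim.prodMk_nhds hαlim))))

theorem exists_trajectory_and_tendsto (hS : S.WellPosed) {Dhat phibar b : Fin n → ℝ}
    {xs : S.State} (hxs : S.IsEquilibrium Dhat xs) {U : ∀ j, ℝ → S.NuSpace j → ℝ}
    {Ulow Uup : ∀ j, S.NuSpace j → ℝ}
    (hU : ∀ j, S.IsSubsystemLyapunov j (U j) (Ulow j) (Uup j) (b j)) {ctilde cbar c₂ c₃ : ℝ}
    (hcbar : ∀ t, 0 ≤ t → ∀ ν : (∀ j, S.NuSpace j), ∑ j, U j t (ν j) ≤ ctilde →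
      ∀ j, ‖ν j‖ ≤ cbar)
    (hg : S.GainCondition Dhat b phibar cbar c₂ c₃) {x₀ : S.State} (hx₀ : IsAngleDifference x₀)
    (hV : S.V c₃ U xs 0 x₀ ≤ ctilde) :
    (∃ x : ℝ → S.State, S.IsTrajectory Dhat x ∧ x 0 = x₀) ∧
      ∀ x : ℝ → S.State, S.IsTrajectory Dhat x → x 0 = x₀ → Tendsto x atTop (𝓝 xs) := by
  obtain ⟨κ, p, R, O, hκ, hp, hO, hR, hD⟩ := exists_decreasesOn hS hxs hU hcbar hg
  refine ⟨?_, ?_⟩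
  · obtain ⟨x, hx0, hx⟩ := hD.exists_solution (contDiff_fieldOf Dhat)
      (p := fun t j => S.varphi j t)
      (continuous_pi fun j => continuous_varphi hS j).continuousOn hR hO hV
    have hx' : ∀ t, 0 ≤ t → HasDerivWithinAt x (S.closedLoop Dhat t (x t)) (Set.Ici 0) t :=
      fun t ht => by
        rw [closedLoop_eq]
        exact hx t ht
    exact ⟨x, fun t ht => ⟨isAngleDifference_of_solution hx' (by rwa [hx0]) ht, hx' t ht⟩, hx0⟩
  · intro x hx hx0
    have hx' : ∀ t, 0 ≤ t → HasDerivWithinAt x (S.fieldOf Dhat (fun j => S.varphi j t, x t))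
        (Set.Ici 0) t := fun t ht => by
      rw [← closedLoop_eq]
      exact (hx t ht).2
    rw [← hx0] at hV
    have hmem : ∀ t, 0 ≤ t → ‖x t‖ ≤ R := fun t ht => hO _ (hD.sublevel t ht _
      (hD.invariant (fun t ht => (hx' t ht).continuousWithinAt) (fun t ht _ => hx' t ht) hV t ht))
    have hW := hD.tendsto_rate (contDiff_fieldOf Dhat) (p := fun t j => S.varphi j t) hR hO
      (fun t ht => V_nonneg hS hU c₃ xs ht) (contDiff_dissipation κ p) hx' hV
    obtain ⟨hω, hν, hμ⟩ := tendsto_of_dissipation hκ hp hW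
    exact tendsto_equilibrium hS hxs (fun t ht => (hx t ht).1) hω hν hμ
      (tendsto_mismatch hS hg hR hmem (fun t ht => (hx t ht).2) hω hν)

end PowerSystem
end FreqControl

theorem corollary1 {n : ℕ} (S : FreqControl.PowerSystem n) (hS : S.WellPosed)
    (Dhat : Fin n → ℝ) (hDhat : ∀ j, 0 < Dhat j) :
    -- the closed loops with `Dhat` and with the true `D` have the same, unique equilibrium
    (∃ xs : S.State, ∀ x : S.State,
      (S.IsEquilibrium S.D x ↔ x = xs) ∧ (S.IsEquilibrium Dhat x ↔ x = xs)) ∧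
    -- the functions `U_j` that enter the set of initial states exist
    (∀ j, ∃ (U : ℝ → S.NuSpace j → ℝ) (Ulow Uup : S.NuSpace j → ℝ) (b : ℝ),
      S.IsSubsystemLyapunov j U Ulow Uup b) ∧
    -- convergence, for every choice of these functions
    (∀ (xs : S.State) (U : ∀ j, ℝ → S.NuSpace j → ℝ) (Ulow Uup : ∀ j, S.NuSpace j → ℝ)
      (b phibar : Fin n → ℝ) (ctilde cbar c₂ c₃ : ℝ) (Vbar : S.State → ℝ),
      S.IsEquilibrium Dhat xs →
      (∀ j, S.IsSubsystemLyapunov j (U j) (Ulow j) (Uup j) (b j)) →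
      0 < ctilde →
      (∀ t, 0 ≤ t → ∀ ν : (∀ j, S.NuSpace j), ∑ j, U j t (ν j) ≤ ctilde → ∀ j, ‖ν j‖ ≤ cbar) →
      S.GainCondition Dhat b phibar cbar c₂ c₃ →
      FreqControl.IsProperPosDef Vbar xs →
      (∀ t, 0 ≤ t → ∀ x, S.V c₃ U xs t x ≤ Vbar x) →
      ∀ x₀ : S.State, FreqControl.PowerSystem.IsAngleDifference x₀ → Vbar x₀ ≤ ctilde →
        (∃ x : ℝ → S.State, S.IsTrajectory Dhat x ∧ x 0 = x₀) ∧
        ∀ x : ℝ → S.State, S.IsTrajectory Dhat x → x 0 = x₀ →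
          Filter.Tendsto x Filter.atTop (nhds xs)) := by
  obtain ⟨xs, h⟩ := FreqControl.PowerSystem.exists_unique_equilibrium hS
  refine ⟨⟨xs, fun x => ⟨h S.D x, h Dhat x⟩⟩,
    FreqControl.PowerSystem.exists_isSubsystemLyapunov hS, ?_⟩
  intro xs U Ulow Uup b phibar ctilde cbar c₂ c₃ Vbar hxs hU _ hcbar hg _ hV x₀ hx₀ hle
  -- The time-independent bound `Vbar` places the initial state in the sublevel set of `V` at time
  -- `0`.
  exact FreqControl.PowerSystem.exists_trajectory_and_tendsto hS hxs hU hcbar hg hx₀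
    ((hV 0 le_rfl x₀).trans hle)
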